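/- Let $0<\alpha\le 1$. For $0<\gamma\le 2$ and $m=\lceil\gamma\rceil$, let $\partial_t^\gamma$ be the Dzherbashyan–Caputo derivative, $\partial_t^\gamma f(t)=\frac1{\Gamma(m-\gamma)}\int_0^t (t-z)^{m-\gamma-1}f^{(m)}(z)\,dz$ for $\gamma<m$ and $\partial_t^\gamma f=f^{(m)}$ for $\gamma=m$, and consider the problem $$(P_\gamma)\qquad \partial_t^\gamma w=\partial_x^2 w\ \ (x\in\mathbb R,\ t>0),\qquad w(x,0)=\delta(x),\qquad \partial_t w(x,0)=0\ \text{ if }\gamma>1 .$$ A solution is a family $(w_t)_{t>0}$ of tempered distributions on $\mathbb R$ such that for every Schwartz function $\varphi$ the function $f(t)=\langle w_t,\varphi\rangle$ is $C^m$ on $(0,\infty)$ with $f^{(m)}$ integrable on $(0,T)$ for every $T>0$, satisfies $\partial_t^\gamma f(t)=\langle w_t,\varphi''\rangle$ for $t>0$, $f(0^+)=\varphi(0)$, and $f'(0^+)=0$ if $\gamma>1$. Write $W(x;\eta,\beta)=\sum_{k\ge0}\frac{x^k}{k!\,\Gamma(\eta k+\beta)}$ for the Wright function (with $1/\Gamma=0$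 at the poles of $\Gamma$). Then $(P_\alpha)$ and $(P_{2\alpha})$ have unique solutions $(U_t)_{t>0}$ and $(V_t)_{t>0}$; these are families of probability measures. For every $t>0$: 1. The folded solution $\overline V_t=2\,V_t|_{[0,\infty)}$ is a probability measure on $[0,\infty)$. 2. $U_t$ is the transition function of Brownian motion, with variance $2s$ at time $s$, at an independent random time $\mathcal T_\alpha(t)$ with law $\overline V_t$. That is, $U_t=\int_{[0,\infty)}N(0,2s)\,\overline V_t(ds)$, and if $B$ is a Brownian motion started at $0$ with variance $2s$ at time $s$, and $\mathcal T_\alpha(t)$ is a random variable with law $\overline V_t$ independent of $B$, then $B(\mathcal T_\alpha(t))$ has law $U_t$. 3. If $\alpha<1$, then $\mathcal T_\alpha(t)$ has the density $$\overline v_{2\alpha}(u,t)=\frac1{t^\alpha}W\Big(-\frac u{t^\alpha};-\alpha,1-\alpha\Big)\ge 0,\qquad u\ge0,$$ and $V_t$ has the density $\tfrac12\overline v_{2\alpha}(|u|,t)$, which tends to $0$ as $|u|\to\infty$. If $\alpha=1$, then $\overline V_t=\delta_t$, that is, $\mathcal T_1(t)=t$ almost surely. 4. $U_t$ has the density $$u_\alpha(x,t)=\frac1{2t^{\alpha/2}}W\Big(-\frac{|x|}{t^{\alpha/2}};-\frac\alpha2,1-\frac\alpha2\Big)\ge0,\qquad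 x\in\mathbb R .$$ -/

import Mathlib

open MeasureTheory ProbabilityTheory Filter Set
open scoped Topology SchwartzMap NNReal ENNReal

noncomputable section

namespace FracDiff

/-- The Wright function `W(x; η, β) = ∑ₖ xᵏ / (k! Γ(η k + β))`. Mathlib's `Real.Gamma` vanishes at
the poles of `Γ`, so division by zero gives the usual convention `1 / Γ = 0` there. -/
def wright (x η β : ℝ) : ℝ :=
  ∑' k : ℕ, x ^ k / ((k.factorial : ℝ) * Real.Gamma (η * (k : ℝ) + β))

/-- The Dzherbashyan-Caputo derivative of order `γ > 0` of `f` at `t`, with `m = ⌈γ⌉`: it is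
`1 / Γ(m - γ) ∫₀ᵗ f⁽ᵐ⁾(z) (t - z)^(m - γ - 1) dz` if `γ` is not an integer, and `f⁽ᵐ⁾(t)` if
`γ = m`. -/
def caputoDeriv (γ : ℝ) (f : ℝ → ℂ) (t : ℝ) : ℂ :=
  if (⌈γ⌉₊ : ℝ) = γ then iteratedDeriv ⌈γ⌉₊ f t
  else (Real.Gamma ((⌈γ⌉₊ : ℝ) - γ))⁻¹ •
    ∫ z in (0 : ℝ)..t, (t - z) ^ ((⌈γ⌉₊ : ℝ) - γ - 1) • iteratedDeriv ⌈γ⌉₊ f z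

/-- The regularity that makes the Caputo derivative of order `γ` meaningful for all `t > 0`:
`f` is `Cᵐ` on `(0, ∞)`, `m = ⌈γ⌉`, and `f⁽ᵐ⁾` is integrable on `(0, T)` for every `T > 0`. -/
structure CaputoRegular (γ : ℝ) (f : ℝ → ℂ) : Prop where
  contDiffOn : ContDiffOn ℝ (⌈γ⌉₊ : ℕ) f (Ioi 0)
  integrable : ∀ T : ℝ, 0 < T → IntervalIntegrable (iteratedDeriv ⌈γ⌉₊ f) volume 0 T

/-- `u = (u t), t > 0`, is a solution of the Cauchy problem
`∂^γ u / ∂t^γ = ∂² u / ∂x²` on `ℝ × (0, ∞)`, `u(x, 0) = δ(x)`, and `∂u/∂t (x, 0) = 0` if `γ > 1`: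
each `u t` is a tempered distribution in `x`, the space derivative is the distributional one, and
equation and initial conditions hold after pairing with any Schwartz function. Only the values
`u t` with `t > 0` matter. -/
structure IsFundamentalSolution (γ : ℝ) (u : ℝ → 𝓢'(ℝ, ℂ)) : Prop where
  regular : ∀ φ : 𝓢(ℝ, ℂ), CaputoRegular γ (fun t => u t φ)
  equation : ∀ φ : 𝓢(ℝ, ℂ), ∀ t : ℝ, 0 < t →
    caputoDeriv γ (fun s => u s φ) t =
      TemperedDistribution.derivCLM ℂ (TemperedDistribution.derivCLM ℂ (u t)) φ
  initial : ∀ φ : 𝓢(ℝ, ℂ), Tendsto (fun t => u t φ) (𝓝[>] 0)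
    (𝓝 ((Measure.dirac (0 : ℝ)).toTemperedDistribution φ))
  initial_velocity : 1 < γ → ∀ φ : 𝓢(ℝ, ℂ),
    Tendsto (deriv (fun t => u t φ)) (𝓝[>] 0) (𝓝 0)

/-- The family of probability measures `μ t`, `t > 0`, is the solution of the above Cauchy problem:
it is a solution, and every solution agrees with it for all `t > 0`. -/
def IsTheFundamentalSolution (γ : ℝ) (μ : ℝ → ProbabilityMeasure ℝ) : Prop :=
  IsFundamentalSolution γ (fun t => (μ t : Measure ℝ).toTemperedDistribution) ∧
    ∀ w : ℝ → 𝓢'(ℝ, ℂ), IsFundamentalSolution γ w →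
      ∀ t : ℝ, 0 < t → w t = (μ t : Measure ℝ).toTemperedDistribution

/-- Folding: twice the measure on `[0, ∞)`, and zero on `(-∞, 0)`. -/
def fold (μ : Measure ℝ) : Measure ℝ := (2 : ℝ≥0∞) • μ.restrict (Ici 0)

/-- The law at time `s ≥ 0` of a Brownian motion started at `0` with variance `2 s`, that is, for
`s > 0`, the law with density `exp (-x² / (4 s)) / √(4 π s)`. -/
def brownianLaw (s : ℝ) : Measure ℝ := gaussianReal 0 (2 * s).toNNReal

/-- The density `t^(-α) W(-u / t^α; -α, 1 - α)`, `u ≥ 0`, of the random time. -/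
def vBar (α u t : ℝ) : ℝ := 1 / t ^ α * wright (-(u / t ^ α)) (-α) (1 - α)

/-- The function `1 / (2 t^(α/2)) W(-|x| / t^(α/2); -α/2, 1 - α/2)`. -/
def uDensity (α x t : ℝ) : ℝ :=
  1 / (2 * t ^ (α / 2)) * wright (-(|x| / t ^ (α / 2))) (-(α / 2)) (1 - α / 2)

end FracDiff

end

noncomputable section

namespace FracDiff

/-! ### Gamma function estimates -/

/-! Write `I^a` for the fractional integral `fracInt a`. Paired with a Schwartz function `φ`, the
Cauchy problem of order `γ` becomes the Volterra equation `w_t(φ) = φ(0) + I^γ(w(φ''))(t)`, because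
`I^γ` undoes the Caputo derivative up to the initial data
(`CaputoRegular.eq_add_fracInt_caputoDeriv`).

Uniqueness. The difference `Λ` of two solutions satisfies `Λ_t(φ) = I^γ(Λ(φ''))(t)`. Iterating this
directly puts ever higher derivatives on `φ`, which a tempered distribution does not control.
Instead one tests with `(μ² + d²/dx²)⁻¹ φ` for nonreal `μ`: the equation becomes scalar, and its
Neumann series is an entire function of `μ`. Off the real axis this function is bounded by powers of
`1/|Im μ|`, with decay, so it vanishes by a Liouville theorem (`eq_zero_of_norm_le_abs_im`); its
constant term is `I^γ(Λ(φ))(t)`.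

Existence. If a probability law `σ` has characteristic function `E_γ(-y²) = ∑ (-y²)ⁿ / Γ(γ n + 1)`,
its dilations by `t^(γ/2)` solve the problem: each Fourier mode solves the scalar equation, and the
iterated Volterra equation gives an expansion in powers `t^(γ i)` from which regularity and the
Caputo derivative are read off. Such a `σ` is the symmetrization of the Mittag-Leffler law `τ_ν`, `ν
= γ/2`, with moments `n! / Γ(ν n + 1)`, since the moments turn the cosine series into `E_{2ν}(-y²)`.
For `ν < 1`, `τ_ν` is the law of `S^(-ν)`, where `S` is one-sided stable with Laplace transform
`exp(-s^ν)`; `S` is a limit of sums of Pareto variables. For `ν = 1` it is the point mass at `1`.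

Subordination. `V_t` is the symmetrized dilation of `τ_α`, so folding returns the dilation of `τ_α`
itself. Its Laplace transform at `y²` is `E_α(-t^α y²)`, the characteristic function of `U_t` at
`y`, and `exp(-s y²)` is that of `N(0, 2s)` (`charFun_dilate_eq_laplace`). So `U_t` is the required
Gaussian mixture.

Densities. A Hankel-type integral for `W(-u; -ν, 1-ν)` gives its Mellin transform `Γ(z) /
Γ(ν(z-1)+1)`, which is the moment of order `z-1` of `τ_ν`. Uniqueness of Mellin transforms yields
the density and its nonnegativity together (`eq_withDensity_of_mellin_eq`). -/

theorem rpow_mul_exp_neg_le_Gamma {a R : ℝ} (ha : 0 ≤ a) (hR : 0 ≤ R) :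
    R ^ a * Real.exp (-R) ≤ Real.Gamma (a + 1) := by
  have hint := Real.GammaIntegral_convergent (s := a + 1) (by linarith)
  rw [Real.Gamma_eq_integral (by linarith)]
  -- The tail of the Gamma integral over `(R, ∞)` suffices, since `x ^ a ≥ R ^ a` there.
  have h1 : ∫ x in Ioi R, R ^ a * Real.exp (-x) = R ^ a * Real.exp (-R) := by
    rw [integral_const_mul, integral_exp_neg_Ioi]
  rw [← h1]
  have hsub : Ioi R ⊆ Ioi (0 : ℝ) := Ioi_subset_Ioi hR
  calc ∫ x in Ioi R, R ^ a * Real.exp (-x)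
      ≤ ∫ x in Ioi R, Real.exp (-x) * x ^ (a + 1 - 1) := by
        refine setIntegral_mono_on ((integrableOn_exp_neg_Ioi R).const_mul _)
          (hint.mono_set hsub) measurableSet_Ioi fun x hx => ?_
        rw [mul_comm, add_sub_cancel_right]
        gcongr
        exact le_of_lt hx
    _ ≤ _ := by
        refine setIntegral_mono_set hint ?_ hsub.eventuallyLE
        filter_upwards [ae_restrict_mem measurableSet_Ioi] with x hx
        have : (0 : ℝ) < x := hx
        positivity

theorem pow_div_Gamma_le {ν y : ℝ} (hν : 0 < ν) (hy : 0 ≤ y) :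
    ∃ C : ℝ, 0 ≤ C ∧ ∀ n : ℕ, y ^ n / Real.Gamma (ν * n + 1) ≤ C * (1 / 2) ^ n := by
  -- `R` is chosen so that `R ^ (ν n) = (2y + 1) ^ n`, which exceeds `y ^ n` by a factor of at least
  -- `2 ^ n`.
  set R : ℝ := (2 * y + 1) ^ (1 / ν) with hRdef
  have hR0 : 0 < R := by positivity
  have hR : R ^ ν = 2 * y + 1 := by
    rw [hRdef, ← Real.rpow_mul (by positivity)]; simp [hν.ne']
  refine ⟨Real.exp R, by positivity, fun n => ?_⟩
  have hg := rpow_mul_exp_neg_le_Gamma (a := ν * n) (R := R) (by positivity) hR0.le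
  rw [Real.rpow_mul hR0.le, hR, Real.rpow_natCast] at hg
  have hG : 0 < Real.Gamma (ν * n + 1) := Real.Gamma_pos_of_pos (by positivity)
  rw [div_le_iff₀ hG]
  have h2 : y ^ n ≤ (1 / 2) ^ n * (2 * y + 1) ^ n := by
    rw [← mul_pow]; gcongr; linarith
  calc y ^ n ≤ (1 / 2) ^ n * (2 * y + 1) ^ n := h2
    _ = Real.exp R * (1 / 2) ^ n * ((2 * y + 1) ^ n * Real.exp (-R)) := by
        rw [Real.exp_neg]; field_simp
    _ ≤ _ := by gcongr

theorem summable_pow_div_Gamma {ν y : ℝ} (hν : 0 < ν) (hy : 0 ≤ y) :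
    Summable fun n : ℕ => y ^ n / Real.Gamma (ν * n + 1) := by
  obtain ⟨C, -, hC⟩ := pow_div_Gamma_le hν hy
  refine Summable.of_nonneg_of_le (fun n => ?_) hC
    ((summable_geometric_of_lt_one (by norm_num) (by norm_num)).mul_left C)
  have : 0 < Real.Gamma (ν * n + 1) := Real.Gamma_pos_of_pos (by positivity)
  positivity

/-! ### The Riemann–Liouville fractional integral -/

theorem intervalIntegrable_beta {a b t : ℝ} (ha : 0 < a) (hb : 0 < b) (ht : 0 < t) :
    IntervalIntegrable (fun z : ℝ => (t - z) ^ (a - 1) * z ^ (b - 1)) volume 0 t := by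
  have h1 := (Complex.betaIntegral_convergent (u := b) (v := a) (by simpa) (by simpa)).norm
  have h2 := (h1.comp_mul_right (c := t⁻¹)).const_mul (t ^ (a - 1) * t ^ (b - 1))
  simp only [zero_div, one_div, inv_inv] at h2
  rw [intervalIntegrable_iff_integrableOn_Ioo_of_le ht.le] at h2 ⊢
  refine h2.congr_fun (fun z hz => ?_) measurableSet_Ioo
  have hz1 : 0 < z * t⁻¹ := mul_pos hz.1 (by positivity)
  have hz2 : 0 < 1 - z * t⁻¹ := by
    have : z * t⁻¹ < 1 := by rw [← div_eq_mul_inv, div_lt_one ht]; exact hz.2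
    linarith
  have e1 : (1 : ℂ) - ((z * t⁻¹ : ℝ) : ℂ) = ((1 - z * t⁻¹ : ℝ) : ℂ) := by push_cast; ring
  have e2 : ((a : ℂ) - 1) = ((a - 1 : ℝ) : ℂ) := by push_cast; ring
  have e3 : ((b : ℂ) - 1) = ((b - 1 : ℝ) : ℂ) := by push_cast; ring
  simp only
  rw [norm_mul, e1, e2, e3, Complex.norm_cpow_eq_rpow_re_of_pos hz1,
    Complex.norm_cpow_eq_rpow_re_of_pos hz2, Complex.ofReal_re, Complex.ofReal_re]
  have h3 : t - z = t * (1 - z * t⁻¹) := by field_simp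
  rw [h3, Real.mul_rpow ht.le hz2.le]
  have h4 : z ^ (b - 1) = t ^ (b - 1) * (z * t⁻¹) ^ (b - 1) := by
    rw [← Real.mul_rpow ht.le hz1.le]; congr 1; field_simp
  rw [h4]; ring

theorem integral_beta {a b t : ℝ} (ha : 0 < a) (hb : 0 < b) (ht : 0 < t) :
    ∫ z in (0 : ℝ)..t, (t - z) ^ (a - 1) * z ^ (b - 1) =
      Real.Gamma a * Real.Gamma b / Real.Gamma (a + b) * t ^ (a + b - 1) := by
  have h1 := Complex.betaIntegral_scaled (b : ℂ) (a : ℂ) ht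
  have h2 := Complex.Gamma_mul_Gamma_eq_betaIntegral (s := b) (t := a) (by simpa) (by simpa)
  have hab : Complex.Gamma ((b : ℂ) + a) ≠ 0 := by
    apply Complex.Gamma_ne_zero_of_re_pos; simp; linarith
  have h3 : Complex.betaIntegral b a = Complex.Gamma b * Complex.Gamma a / Complex.Gamma (b + a) := by
    rw [h2]; field_simp
  have h4 : ((∫ z in (0 : ℝ)..t, (t - z) ^ (a - 1) * z ^ (b - 1) : ℝ) : ℂ) =
      ∫ x in (0 : ℝ)..t, (x : ℂ) ^ ((b : ℂ) - 1) * ((t : ℂ) - x) ^ ((a : ℂ) - 1) := by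
    rw [← intervalIntegral.integral_ofReal]
    refine intervalIntegral.integral_congr fun z hz => ?_
    rw [uIcc_of_le ht.le] at hz
    rw [mul_comm, Complex.ofReal_mul, Complex.ofReal_cpow hz.1, Complex.ofReal_cpow (by linarith [hz.2])]
    push_cast; rfl
  rw [← Complex.ofReal_inj, h4, h1, h3]
  push_cast
  rw [Complex.ofReal_cpow ht.le]
  simp only [← Complex.Gamma_ofReal]
  push_cast
  rw [add_comm (b : ℂ) a]
  ring

/-- The Riemann–Liouville fractional integral of order `a`, based at `0`. -/
def fracInt (a : ℝ) (f : ℝ → ℂ) (t : ℝ) : ℂ :=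
  (Real.Gamma a)⁻¹ • ∫ z in (0 : ℝ)..t, (t - z) ^ (a - 1) • f z

/-- The normalized power `tᵇ / Γ(b + 1)`. -/
def powKer (b t : ℝ) : ℂ := ((t ^ b / Real.Gamma (b + 1) : ℝ) : ℂ)

theorem fracInt_powKer {a b t : ℝ} (ha : 0 < a) (hb : -1 < b) (ht : 0 < t) :
    fracInt a (powKer b) t = powKer (a + b) t := by
  have hbG : 0 < Real.Gamma (b + 1) := Real.Gamma_pos_of_pos (by linarith)
  have haG : 0 < Real.Gamma a := Real.Gamma_pos_of_pos ha
  have h := integral_beta ha (b := b + 1) (by linarith) ht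
  have h2 : ∫ z in (0 : ℝ)..t, (t - z) ^ (a - 1) • powKer b z =
      (((∫ z in (0 : ℝ)..t, (t - z) ^ (a - 1) * z ^ (b + 1 - 1)) / Real.Gamma (b + 1) : ℝ) : ℂ) := by
    rw [← intervalIntegral.integral_div, ← intervalIntegral.integral_ofReal]
    congr 1; ext z
    simp only [powKer, add_sub_cancel_right, Complex.real_smul]
    push_cast; ring
  rw [fracInt, h2, h, powKer, Complex.real_smul, ← Complex.ofReal_mul]
  congr 1
  rw [show a + (b + 1) - 1 = a + b by ring, show a + (b + 1) = a + b + 1 by ring]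
  field_simp

theorem intervalIntegrable_powKer {b t : ℝ} (hb : -1 < b) :
    IntervalIntegrable (powKer b) volume 0 t :=
  have h := (intervalIntegral.intervalIntegrable_rpow' (a := 0) (b := t) hb).div_const
    (Real.Gamma (b + 1))
  ⟨h.1.ofReal, h.2.ofReal⟩

theorem fracInt_congr {a t : ℝ} {f g : ℝ → ℂ} (ht : 0 ≤ t) (h : ∀ z ∈ Ioc 0 t, f z = g z) :
    fracInt a f t = fracInt a g t := by
  unfold fracInt
  congr 1
  refine intervalIntegral.integral_congr_ae (Eventually.of_forall fun z hz => ?_)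
  rw [uIoc_of_le ht] at hz
  simp only [h z hz]

/-- The kernel is nonnegative, so the bound passes through the integral, and the dominating power is
integrated by the beta integral. -/
theorem norm_fracInt_le {a b C t : ℝ} {f : ℝ → ℂ} (ha : 0 < a) (hb : -1 < b) (ht : 0 < t)
    (h : ∀ z ∈ Ioc 0 t, ‖f z‖ ≤ C * (z ^ b / Real.Gamma (b + 1))) :
    ‖fracInt a f t‖ ≤ C * (t ^ (a + b) / Real.Gamma (a + b + 1)) := by
  have hbG : 0 < Real.Gamma (b + 1) := Real.Gamma_pos_of_pos (by linarith)
  have haG : 0 < Real.Gamma a := Real.Gamma_pos_of_pos ha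
  have hI := (intervalIntegrable_beta ha (b := b + 1) (by linarith) ht).const_mul
    (C / Real.Gamma (b + 1))
  have h1 : ‖∫ z in (0 : ℝ)..t, (t - z) ^ (a - 1) • f z‖ ≤ ∫ z in (0 : ℝ)..t,
      C / Real.Gamma (b + 1) * ((t - z) ^ (a - 1) * z ^ (b + 1 - 1)) := by
    refine intervalIntegral.norm_integral_le_of_norm_le ht.le (Eventually.of_forall fun z hz => ?_) hI
    have hz2 : 0 ≤ t - z := by linarith [hz.2]
    rw [norm_smul, Real.norm_of_nonneg (by positivity)]
    calc (t - z) ^ (a - 1) * ‖f z‖ ≤ (t - z) ^ (a - 1) * (C * (z ^ b / Real.Gamma (b + 1))) := by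
          gcongr; exact h z hz
      _ = _ := by rw [add_sub_cancel_right]; ring
  rw [intervalIntegral.integral_const_mul, integral_beta ha (by linarith) ht] at h1
  rw [fracInt, norm_smul, norm_inv, Real.norm_of_nonneg haG.le]
  calc (Real.Gamma a)⁻¹ * ‖∫ z in (0 : ℝ)..t, (t - z) ^ (a - 1) • f z‖
      ≤ (Real.Gamma a)⁻¹ * (C / Real.Gamma (b + 1) * (Real.Gamma a * Real.Gamma (b + 1) /
        Real.Gamma (a + (b + 1)) * t ^ (a + (b + 1) - 1))) := by gcongr
    _ = _ := by
        rw [show a + (b + 1) - 1 = a + b by ring, show a + (b + 1) = a + b + 1 by ring]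
        field_simp

/-- The kernel of two iterated fractional integrals. -/
theorem integral_beta_shift {a b y t : ℝ} (ha : 0 < a) (hb : 0 < b) (hyt : y < t) :
    ∫ z in y..t, (t - z) ^ (a - 1) * (z - y) ^ (b - 1) =
      Real.Gamma a * Real.Gamma b / Real.Gamma (a + b) * (t - y) ^ (a + b - 1) := by
  rw [← integral_beta ha hb (sub_pos.2 hyt)]
  have := intervalIntegral.integral_comp_sub_right (a := y) (b := t)
    (fun z => (t - y - z) ^ (a - 1) * z ^ (b - 1)) y
  rw [sub_self] at this
  rw [← this]
  congr 1; ext z; congr 2; ring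

theorem intervalIntegrable_beta_shift {a b y t : ℝ} (ha : 0 < a) (hb : 0 < b) (hyt : y < t) :
    IntervalIntegrable (fun z => (t - z) ^ (a - 1) * (z - y) ^ (b - 1)) volume y t := by
  have := (intervalIntegrable_beta ha hb (sub_pos.2 hyt)).comp_sub_right y
  simp only [zero_add, sub_add_cancel] at this
  refine this.congr (fun z _ => ?_)
  congr 2; ring

/-- Semigroup law by Fubini on the triangle `y ≤ z ≤ t`: the inner integral over `z` is a beta
integral. Integrability against the composed kernel is exactly what Tonelli needs. -/
theorem fracInt_fracInt {a b t : ℝ} {f : ℝ → ℂ} (ha : 0 < a) (hb : 0 < b) (ht : 0 < t)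
    (hfm : AEStronglyMeasurable f (volume.restrict (Ioc 0 t)))
    (hf : IntervalIntegrable (fun y => (t - y) ^ (a + b - 1) • f y) volume 0 t) :
    fracInt a (fracInt b f) t = fracInt (a + b) f t := by
  have haG : 0 < Real.Gamma a := Real.Gamma_pos_of_pos ha
  have hbG : 0 < Real.Gamma b := Real.Gamma_pos_of_pos hb
  set μ : Measure ℝ := volume.restrict (Ioc 0 t) with hμ
  -- The triangle enters through an indicator, so both orders of integration run over the same
  -- square.
  set K : ℝ × ℝ → ℝ := {p : ℝ × ℝ | p.2 ≤ p.1}.indicator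
    (fun p => (t - p.1) ^ (a - 1) * (p.1 - p.2) ^ (b - 1)) with hK
  set F : ℝ × ℝ → ℂ := fun p => K p • f p.2 with hF
  have hKm : Measurable K := by
    refine Measurable.indicator ?_ (measurableSet_le measurable_snd measurable_fst)
    fun_prop
  have hsm : AEStronglyMeasurable F (μ.prod μ) :=
    hKm.aestronglyMeasurable.smul hfm.comp_snd
  have hlt : ∀ᵐ y ∂μ, y ∈ Ioo 0 t := by
    rw [hμ, ← restrict_Ioo_eq_restrict_Ioc]
    exact ae_restrict_mem measurableSet_Ioo
  -- the slices in the first variable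
  have hslice : ∀ y ∈ Ioo 0 t, (fun z => K (z, y)) =ᵐ[μ]
      (Ioc y t).indicator (fun z => (t - z) ^ (a - 1) * (z - y) ^ (b - 1)) := by
    intro y hy
    -- The diagonal point `z = y` lies in the triangle but not in `Ioc y t`; it is negligible.
    have : ∀ᵐ z ∂μ, z ≠ y := by
      refine ae_restrict_of_ae ?_
      simp [ae_iff]
    filter_upwards [this, ae_restrict_mem measurableSet_Ioc] with z hz hz'
    simp only [hK, indicator]
    have : (z, y) ∈ {p : ℝ × ℝ | p.2 ≤ p.1} ↔ z ∈ Ioc y t := by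
      simp only [mem_ofPred_eq, mem_Ioc]
      exact ⟨fun h => ⟨lt_of_le_of_ne h (Ne.symm hz), hz'.2⟩, fun h => h.1.le⟩
    by_cases h : z ∈ Ioc y t
    · rw [if_pos h, if_pos (this.2 h)]
    · rw [if_neg h, if_neg (mt this.1 h)]
  have hsub : ∀ y ∈ Ioo 0 t, Ioc y t ⊆ Ioc 0 t := fun y hy => Ioc_subset_Ioc_left hy.1.le
  have hKint : ∀ y ∈ Ioo 0 t, Integrable (fun z => K (z, y)) μ := by
    intro y hy
    refine Integrable.congr ?_ (hslice y hy).symm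
    rw [integrable_indicator_iff measurableSet_Ioc, hμ, IntegrableOn,
      Measure.restrict_restrict measurableSet_Ioc, inter_eq_left.2 (hsub y hy)]
    exact (intervalIntegrable_iff_integrableOn_Ioc_of_le hy.2.le).1
      (intervalIntegrable_beta_shift ha hb hy.2)
  have hKval : ∀ y ∈ Ioo 0 t, ∫ z, K (z, y) ∂μ =
      Real.Gamma a * Real.Gamma b / Real.Gamma (a + b) * (t - y) ^ (a + b - 1) := by
    intro y hy
    rw [integral_congr_ae (hslice y hy), integral_indicator measurableSet_Ioc, hμ,
      Measure.restrict_restrict measurableSet_Ioc, inter_eq_left.2 (hsub y hy),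
      ← intervalIntegral.integral_of_le hy.2.le, integral_beta_shift ha hb hy.2]
  have hKnn : ∀ z ∈ Ioc 0 t, ∀ y, 0 ≤ K (z, y) := by
    intro z hz y
    simp only [hK, indicator, mem_ofPred_eq]
    split_ifs with hp
    · have h1 : (0 : ℝ) ≤ t - z := by linarith [hz.2]
      have h2 : (0 : ℝ) ≤ z - y := sub_nonneg.2 hp
      positivity
    · exact le_rfl
  have hfI : Integrable (fun y => (t - y) ^ (a + b - 1) • f y) μ :=
    (intervalIntegrable_iff_integrableOn_Ioc_of_le ht.le).1 hf
  have hFint : Integrable F (μ.prod μ) := by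
    rw [integrable_prod_iff' hsm]
    constructor
    · filter_upwards [hlt] with y hy
      exact (hKint y hy).smul_const (f y)
    · refine (hfI.norm.const_mul (Real.Gamma a * Real.Gamma b / Real.Gamma (a + b))).congr ?_
      filter_upwards [hlt] with y hy
      have : ∫ z, ‖F (z, y)‖ ∂μ = (∫ z, K (z, y) ∂μ) * ‖f y‖ := by
        rw [← integral_mul_const]
        refine integral_congr_ae ?_
        filter_upwards [ae_restrict_mem measurableSet_Ioc] with z hz
        simp only [hF]
        rw [norm_smul, Real.norm_of_nonneg (hKnn z hz y)]
      have hty : 0 ≤ t - y := by linarith [hy.2]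
      rw [this, hKval y hy, norm_smul, Real.norm_of_nonneg (by positivity)]
      ring
  have hswap := integral_integral_swap (f := fun z y => F (z, y)) hFint
  have hL : ∫ z, ∫ y, F (z, y) ∂μ ∂μ =
      ∫ z in (0 : ℝ)..t, (t - z) ^ (a - 1) • ∫ y in (0 : ℝ)..z, (z - y) ^ (b - 1) • f y := by
    rw [intervalIntegral.integral_of_le ht.le]
    refine setIntegral_congr_fun measurableSet_Ioc fun z hz => ?_
    have : ∀ y, F (z, y) = (Iic z).indicator
        (fun y => (t - z) ^ (a - 1) • ((z - y) ^ (b - 1) • f y)) y := by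
      intro y
      simp only [hF, hK, indicator, mem_ofPred_eq, mem_Iic]
      split_ifs
      · rw [mul_smul]
      · simp
    simp only [this]
    rw [integral_indicator measurableSet_Iic, hμ, Measure.restrict_restrict measurableSet_Iic,
      inter_comm, Ioc_inter_Iic, min_eq_right hz.2, integral_smul,
      intervalIntegral.integral_of_le hz.1.le]
  have hR : ∫ y, ∫ z, F (z, y) ∂μ ∂μ = (Real.Gamma a * Real.Gamma b / Real.Gamma (a + b)) •
      ∫ y in (0 : ℝ)..t, (t - y) ^ (a + b - 1) • f y := by
    rw [intervalIntegral.integral_of_le ht.le, ← integral_smul]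
    refine integral_congr_ae ?_
    filter_upwards [hlt] with y hy
    simp only [hF]
    rw [integral_smul_const, hKval y hy, mul_smul]
  rw [hL, hR] at hswap
  have habG : 0 < Real.Gamma (a + b) := Real.Gamma_pos_of_pos (by linarith)
  have : fracInt a (fracInt b f) t = ((Real.Gamma a)⁻¹ * (Real.Gamma b)⁻¹) •
      ∫ z in (0 : ℝ)..t, (t - z) ^ (a - 1) • ∫ y in (0 : ℝ)..z, (z - y) ^ (b - 1) • f y := by
    simp only [fracInt]
    rw [mul_smul]
    congr 1
    rw [← intervalIntegral.integral_smul]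
    congr 1; ext z
    rw [smul_comm]
  rw [this, hswap, smul_smul, fracInt]
  congr 1
  field_simp

/-! ### Continuous and locally bounded functions on the half-line -/

/-- `f` is continuous on `(0, ∞)` and bounded on `(0, T]` for every `T > 0`. -/
structure LocBdd (f : ℝ → ℂ) : Prop where
  cont : ContinuousOn f (Ioi 0)
  bdd : ∀ T : ℝ, 0 < T → ∃ C : ℝ, 0 ≤ C ∧ ∀ z ∈ Ioc 0 T, ‖f z‖ ≤ C

theorem LocBdd.aesm {f : ℝ → ℂ} (hf : LocBdd f) (t : ℝ) :
    AEStronglyMeasurable f (volume.restrict (Ioc 0 t)) :=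
  (hf.cont.mono Ioc_subset_Ioi_self).aestronglyMeasurable measurableSet_Ioc

theorem LocBdd.intervalIntegrable_kernel {f : ℝ → ℂ} (hf : LocBdd f) {a t : ℝ} (ha : 0 < a)
    (ht : 0 < t) : IntervalIntegrable (fun z => (t - z) ^ (a - 1) • f z) volume 0 t := by
  obtain ⟨C, hC0, hC⟩ := hf.bdd t ht
  have h := (intervalIntegrable_beta ha one_pos ht).const_mul C
  refine h.mono_fun' ?_ ?_
  · rw [uIoc_of_le ht.le]
    exact (by fun_prop : Measurable fun z : ℝ => (t - z) ^ (a - 1)).aestronglyMeasurable.smul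
      (hf.aesm t)
  · rw [uIoc_of_le ht.le]
    filter_upwards [ae_restrict_mem measurableSet_Ioc] with z hz
    have h2 : 0 ≤ t - z := by linarith [hz.2]
    rw [norm_smul, Real.norm_of_nonneg (by positivity), sub_self, Real.rpow_zero, mul_one, mul_comm]
    gcongr
    exact hC z hz

theorem LocBdd.fracInt_fracInt {f : ℝ → ℂ} (hf : LocBdd f) {a b t : ℝ} (ha : 0 < a) (hb : 0 < b)
    (ht : 0 < t) : fracInt a (fracInt b f) t = fracInt (a + b) f t :=
  FracDiff.fracInt_fracInt ha hb ht (hf.aesm t) (hf.intervalIntegrable_kernel (by linarith) ht)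

/-- Rescaling removes `t` from the domain and from the singular kernel, so continuity in `t` follows
by dominated convergence. -/
theorem fracInt_eq_scaled (a : ℝ) (f : ℝ → ℂ) {t : ℝ} (ht : 0 < t) :
    fracInt a f t = ((Real.Gamma a)⁻¹ * t ^ a) •
      ∫ y in (0 : ℝ)..1, (1 - y) ^ (a - 1) • f (t * y) := by
  have h := intervalIntegral.integral_comp_mul_left (a := 0) (b := 1)
    (fun z => (t - z) ^ (a - 1) • f z) ht.ne'
  rw [mul_zero, mul_one] at h
  have h2 : ∫ z in (0 : ℝ)..t, (t - z) ^ (a - 1) • f z =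
      t • ∫ y in (0 : ℝ)..1, (t - t * y) ^ (a - 1) • f (t * y) := by
    rw [h, smul_smul, mul_inv_cancel₀ ht.ne', one_smul]
  rw [fracInt, h2, mul_smul]
  congr 1
  have h3 : ∫ y in (0 : ℝ)..1, (t - t * y) ^ (a - 1) • f (t * y) =
      t ^ (a - 1) • ∫ y in (0 : ℝ)..1, (1 - y) ^ (a - 1) • f (t * y) := by
    rw [← intervalIntegral.integral_smul]
    refine intervalIntegral.integral_congr fun y hy => ?_
    rw [uIcc_of_le zero_le_one] at hy
    rw [show t - t * y = t * (1 - y) by ring, Real.mul_rpow ht.le (by linarith [hy.2]), mul_smul]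
  rw [h3, smul_smul]
  congr 1
  rw [Real.rpow_sub_one ht.ne']; field_simp

theorem LocBdd.continuousOn_fracInt {f : ℝ → ℂ} (hf : LocBdd f) {a : ℝ} (ha : 0 < a) :
    ContinuousOn (fracInt a f) (Ioi 0) := by
  intro t ht
  have ht0 : (0 : ℝ) < t := ht
  refine ContinuousAt.continuousWithinAt ?_
  have heq : fracInt a f =ᶠ[𝓝 t] fun t => ((Real.Gamma a)⁻¹ * t ^ a) •
      ∫ y in (0 : ℝ)..1, (1 - y) ^ (a - 1) • f (t * y) := by
    filter_upwards [Ioi_mem_nhds ht0] with s hs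
    exact fracInt_eq_scaled a f hs
  refine ContinuousAt.congr ?_ heq.symm
  refine ContinuousAt.smul
    (continuousAt_const.mul (Real.continuousAt_rpow_const t a (Or.inl ht0.ne'))) ?_
  obtain ⟨C, hC0, hC⟩ := hf.bdd (2 * t) (by linarith)
  have hb := (intervalIntegrable_beta ha one_pos one_pos).const_mul C
  have hnear : ∀ᶠ s in 𝓝 t, s ∈ Ioo 0 (2 * t) := Ioo_mem_nhds ht0 (by linarith)
  refine intervalIntegral.continuousAt_of_dominated_interval
    (bound := fun y => C * ((1 - y) ^ (a - 1) * y ^ ((1 : ℝ) - 1))) ?_ ?_ hb ?_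
  · filter_upwards [hnear] with s hs
    rw [uIoc_of_le zero_le_one]
    refine (by fun_prop : Measurable fun z : ℝ => (1 - z) ^ (a - 1)).aestronglyMeasurable.smul ?_
    refine ContinuousOn.aestronglyMeasurable ?_ measurableSet_Ioc
    exact hf.cont.comp (by fun_prop) fun y hy => mul_pos hs.1 hy.1
  · filter_upwards [hnear] with s hs
    refine Eventually.of_forall fun y hy => ?_
    rw [uIoc_of_le zero_le_one] at hy
    have h2 : 0 ≤ 1 - y := by linarith [hy.2]
    rw [norm_smul, Real.norm_of_nonneg (by positivity), sub_self, Real.rpow_zero, mul_one, mul_comm]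
    gcongr
    exact hC _ ⟨mul_pos hs.1 hy.1, by nlinarith [hs.1, hs.2, hy.1, hy.2]⟩
  · refine Eventually.of_forall fun y hy => ?_
    rw [uIoc_of_le zero_le_one] at hy
    have h1 : ContinuousAt f (t * y) :=
      hf.cont.continuousAt (Ioi_mem_nhds (mul_pos ht0 hy.1))
    have h2 : ContinuousAt (fun s => f (s * y)) t :=
      ContinuousAt.comp (f := fun s => s * y) h1 (by fun_prop)
    exact h2.const_smul ((1 - y) ^ (a - 1))

theorem LocBdd.norm_fracInt_le {f : ℝ → ℂ} {a t C : ℝ} (ha : 0 < a) (ht : 0 < t)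
    (hC : ∀ z ∈ Ioc 0 t, ‖f z‖ ≤ C) : ‖fracInt a f t‖ ≤ C * (t ^ a / Real.Gamma (a + 1)) := by
  have := FracDiff.norm_fracInt_le (b := 0) ha (by norm_num) ht (f := f) (C := C)
    (by simpa using hC)
  simpa using this

theorem LocBdd.fracInt {f : ℝ → ℂ} (hf : LocBdd f) {a : ℝ} (ha : 0 < a) :
    LocBdd (fracInt a f) where
  cont := hf.continuousOn_fracInt ha
  bdd T hT := by
    obtain ⟨C, hC0, hC⟩ := hf.bdd T hT
    have hG : 0 < Real.Gamma (a + 1) := Real.Gamma_pos_of_pos (by linarith)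
    refine ⟨C * (T ^ a / Real.Gamma (a + 1)), by positivity, fun t ht => ?_⟩
    refine (LocBdd.norm_fracInt_le ha ht.1 fun z hz => hC z ⟨hz.1, hz.2.trans ht.2⟩).trans ?_
    have := ht.1.le
    gcongr
    exact ht.2

theorem LocBdd.const (c : ℂ) : LocBdd fun _ => c :=
  ⟨continuousOn_const, fun _ _ => ⟨‖c‖, norm_nonneg c, fun _ _ => le_rfl⟩⟩

theorem LocBdd.add {f g : ℝ → ℂ} (hf : LocBdd f) (hg : LocBdd g) : LocBdd fun t => f t + g t where
  cont := hf.cont.add hg.cont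
  bdd T hT := by
    obtain ⟨C, hC0, hC⟩ := hf.bdd T hT
    obtain ⟨D, hD0, hD⟩ := hg.bdd T hT
    exact ⟨C + D, by positivity, fun z hz => (norm_add_le _ _).trans (add_le_add (hC z hz) (hD z hz))⟩

theorem LocBdd.const_mul {f : ℝ → ℂ} (hf : LocBdd f) (c : ℂ) : LocBdd fun t => c * f t where
  cont := continuousOn_const.mul hf.cont
  bdd T hT := by
    obtain ⟨C, hC0, hC⟩ := hf.bdd T hT
    refine ⟨‖c‖ * C, by positivity, fun z hz => ?_⟩
    rw [norm_mul]
    gcongr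
    exact hC z hz

theorem fracInt_const_mul (a : ℝ) (c : ℂ) (f : ℝ → ℂ) (t : ℝ) :
    fracInt a (fun s => c * f s) t = c * fracInt a f t := by
  simp only [fracInt, Complex.real_smul]
  have : ∀ z : ℝ, (((t - z) ^ (a - 1) : ℝ) : ℂ) * (c * f z) =
      c * ((((t - z) ^ (a - 1) : ℝ) : ℂ) * f z) := fun z => by ring
  simp only [this, intervalIntegral.integral_const_mul]
  ring

theorem fracInt_add_of_intervalIntegrable {a t : ℝ} {f g : ℝ → ℂ}
    (hf : IntervalIntegrable (fun z => (t - z) ^ (a - 1) • f z) volume 0 t)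
    (hg : IntervalIntegrable (fun z => (t - z) ^ (a - 1) • g z) volume 0 t) :
    fracInt a (fun s => f s + g s) t = fracInt a f t + fracInt a g t := by
  simp only [fracInt, smul_add]
  rw [intervalIntegral.integral_add hf hg, smul_add]

theorem LocBdd.fracInt_add {f g : ℝ → ℂ} (hf : LocBdd f) (hg : LocBdd g) {a t : ℝ} (ha : 0 < a)
    (ht : 0 < t) : FracDiff.fracInt a (fun s => f s + g s) t =
      FracDiff.fracInt a f t + FracDiff.fracInt a g t :=
  fracInt_add_of_intervalIntegrable (hf.intervalIntegrable_kernel ha ht)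
    (hg.intervalIntegrable_kernel ha ht)

theorem fracInt_one (f : ℝ → ℂ) (t : ℝ) : fracInt 1 f t = ∫ z in (0 : ℝ)..t, f z := by
  simp [fracInt]

theorem LocBdd.intervalIntegrable {f : ℝ → ℂ} (hf : LocBdd f) {t : ℝ} (ht : 0 < t) :
    IntervalIntegrable f volume 0 t := by
  simpa using hf.intervalIntegrable_kernel one_pos ht

/-- By the semigroup law `I^(a+1) = I^1 I^a`, so this is the fundamental theorem of calculus for the
continuous function `I^a f`. -/
theorem LocBdd.hasDerivAt_fracInt {f : ℝ → ℂ} (hf : LocBdd f) {a t : ℝ} (ha : 0 < a) (ht : 0 < t) :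
    HasDerivAt (FracDiff.fracInt (a + 1) f) (FracDiff.fracInt a f t) t := by
  have hg := hf.fracInt ha
  have heq : FracDiff.fracInt (a + 1) f =ᶠ[𝓝 t] fun s => ∫ z in (0 : ℝ)..s, FracDiff.fracInt a f z := by
    filter_upwards [Ioi_mem_nhds ht] with s hs
    rw [← fracInt_one, hf.fracInt_fracInt one_pos ha hs, add_comm]
  refine HasDerivAt.congr_of_eventuallyEq ?_ heq
  refine intervalIntegral.integral_hasDerivAt_right (hg.intervalIntegrable ht) ?_
    (hg.cont.continuousAt (Ioi_mem_nhds ht))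
  exact hg.cont.stronglyMeasurableAtFilter isOpen_Ioi t ht

theorem hasDerivAt_powKer {b t : ℝ} (ht : 0 < t) : HasDerivAt (powKer b) (powKer (b - 1) t) t := by
  have h := ((Real.hasDerivAt_rpow_const (p := b) (Or.inl ht.ne')).div_const
    (Real.Gamma (b + 1))).ofReal_comp
  convert! h using 1
  simp only [powKer, sub_add_cancel]
  congr 1
  -- At `b = 0` both sides vanish, the right one through the convention `1 / Γ(0) = 0`.
  rcases eq_or_ne b 0 with rfl | hb
  · simp
  · rw [Real.Gamma_add_one hb]; field_simp

theorem intervalIntegrable_kernel_smul {s t : ℝ} {G : ℝ → ℂ} (hs : 1 ≤ s)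
    (hG : IntervalIntegrable G volume 0 t) :
    IntervalIntegrable (fun y => (t - y) ^ (s - 1) • G y) volume 0 t := by
  refine hG.continuousOn_smul ?_
  refine ContinuousOn.rpow_const (by fun_prop) fun x _ => Or.inr (by linarith)

/-! ### From the Caputo problem to a Volterra equation -/

theorem eq_add_integral_of_tendsto {G G' : ℝ → ℂ} {c : ℂ} {t : ℝ} (ht : 0 < t)
    (hd : ∀ x ∈ Ioi (0 : ℝ), HasDerivAt G (G' x) x) (hi : IntervalIntegrable G' volume 0 t)
    (h0 : Tendsto G (𝓝[>] 0) (𝓝 c)) : G t = c + ∫ z in (0 : ℝ)..t, G' z := by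
  rw [intervalIntegral.integral_eq_sub_of_hasDerivAt_of_tendsto ht
    (fun x hx => hd x hx.1) hi h0 ((hd t ht).continuousAt.tendsto.mono_left nhdsWithin_le_nhds)]
  ring

theorem ceil_eq_one {γ : ℝ} (h0 : 0 < γ) (h1 : γ ≤ 1) : ⌈γ⌉₊ = 1 := by
  rw [Nat.ceil_eq_iff one_ne_zero]; simp [h0, h1]

theorem ceil_eq_two {γ : ℝ} (h1 : 1 < γ) (h2 : γ ≤ 2) : ⌈γ⌉₊ = 2 := by
  rw [Nat.ceil_eq_iff two_ne_zero]; simp [h1, h2]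

/-- Taylor's formula at `0` with integral remainder of order `m = ⌈γ⌉`. For `m = 2` the linear term
is absent because the initial velocity is zero. -/
theorem CaputoRegular.eq_add_fracInt_iteratedDeriv {γ : ℝ} (hγ0 : 0 < γ) (hγ2 : γ ≤ 2) {F : ℝ → ℂ}
    (h : CaputoRegular γ F) {c : ℂ} (h0 : Tendsto F (𝓝[>] 0) (𝓝 c))
    (h1 : 1 < γ → Tendsto (deriv F) (𝓝[>] 0) (𝓝 0)) {t : ℝ} (ht : 0 < t) :
    F t = c + fracInt (⌈γ⌉₊ : ℝ) (iteratedDeriv ⌈γ⌉₊ F) t := by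
  obtain ⟨hc, hi⟩ := h
  rcases le_or_gt γ 1 with hle | hgt
  · rw [ceil_eq_one hγ0 hle] at hc hi ⊢
    rw [Nat.cast_one, fracInt_one]
    simp only [iteratedDeriv_one] at hi ⊢
    refine eq_add_integral_of_tendsto ht (fun x hx => ?_) (hi t ht) h0
    exact ((hc.contDiffAt (Ioi_mem_nhds hx)).differentiableAt (by norm_num)).hasDerivAt
  · rw [ceil_eq_two hgt hγ2] at hc hi ⊢
    have e2 : iteratedDeriv 2 F = deriv (deriv F) := by
      rw [iteratedDeriv_succ, iteratedDeriv_one]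
    rw [e2] at hi ⊢
    have hd1 : ∀ x ∈ Ioi (0 : ℝ), HasDerivAt F (deriv F x) x := fun x hx =>
      ((hc.contDiffAt (Ioi_mem_nhds hx)).differentiableAt (by norm_num)).hasDerivAt
    have hc1 : ContDiffOn ℝ 1 (deriv F) (Ioi 0) := hc.deriv_of_isOpen isOpen_Ioi (by norm_num)
    have hd2 : ∀ x ∈ Ioi (0 : ℝ), HasDerivAt (deriv F) (deriv (deriv F) x) x := fun x hx =>
      ((hc1.contDiffAt (Ioi_mem_nhds hx)).differentiableAt (by norm_num)).hasDerivAt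
    have hF' : ∀ s, 0 < s → deriv F s = ∫ z in (0 : ℝ)..s, deriv (deriv F) z := fun s hs => by
      simpa using eq_add_integral_of_tendsto hs hd2 (hi s hs) (h1 hgt)
    -- The second derivative is only integrable near `0`; its primitive `F'` is bounded there.
    have hlb : LocBdd (deriv F) := by
      refine ⟨hc1.continuousOn, fun T hT => ⟨∫ z in (0 : ℝ)..T, ‖deriv (deriv F) z‖, ?_, ?_⟩⟩
      · exact intervalIntegral.integral_nonneg hT.le fun _ _ => norm_nonneg _
      · intro z hz
        rw [hF' z hz.1]
        refine (intervalIntegral.norm_integral_le_integral_norm hz.1.le).trans ?_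
        exact intervalIntegral.integral_mono_interval le_rfl hz.1.le hz.2
          (Eventually.of_forall fun _ => norm_nonneg _) (hi T hT).norm
    have hF := eq_add_integral_of_tendsto ht hd1 (hlb.intervalIntegrable ht) h0
    rw [hF]
    congr 1
    have h11 : fracInt 1 (fracInt 1 (deriv (deriv F))) t = fracInt (1 + 1) (deriv (deriv F)) t := by
      refine fracInt_fracInt one_pos one_pos ht ((hi t ht).1.aestronglyMeasurable) ?_
      exact intervalIntegrable_kernel_smul (by norm_num) (hi t ht)
    rw [Nat.cast_ofNat, show (2 : ℝ) = 1 + 1 by norm_num, ← h11, fracInt_one]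
    refine intervalIntegral.integral_congr_ae (Eventually.of_forall fun z hz => ?_)
    rw [uIoc_of_le ht.le] at hz
    rw [hF' z hz.1, fracInt_one]

theorem caputoDeriv_eq_fracInt {γ : ℝ} (h : (⌈γ⌉₊ : ℝ) ≠ γ) (F : ℝ → ℂ) :
    caputoDeriv γ F = fracInt ((⌈γ⌉₊ : ℝ) - γ) (iteratedDeriv ⌈γ⌉₊ F) := by
  ext t
  rw [caputoDeriv, if_neg h, fracInt]

/-- For `γ < m`, `I^γ` of the Caputo derivative is `I^γ I^(m-γ) f⁽ᵐ⁾ = I^m f⁽ᵐ⁾`, the Taylor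
remainder. -/
theorem CaputoRegular.eq_add_fracInt_caputoDeriv {γ : ℝ} (hγ0 : 0 < γ) (hγ2 : γ ≤ 2) {F : ℝ → ℂ}
    (h : CaputoRegular γ F) {c : ℂ} (h0 : Tendsto F (𝓝[>] 0) (𝓝 c))
    (h1 : 1 < γ → Tendsto (deriv F) (𝓝[>] 0) (𝓝 0)) {t : ℝ} (ht : 0 < t) :
    F t = c + fracInt γ (caputoDeriv γ F) t := by
  rw [h.eq_add_fracInt_iteratedDeriv hγ0 hγ2 h0 h1 ht]
  congr 1
  by_cases hm : (⌈γ⌉₊ : ℝ) = γ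
  · have : caputoDeriv γ F = iteratedDeriv ⌈γ⌉₊ F := by
      ext s; rw [caputoDeriv, if_pos hm]
    rw [this, hm]
  · have hlt : γ < ⌈γ⌉₊ := lt_of_le_of_ne (Nat.le_ceil γ) (Ne.symm hm)
    have h1m : (1 : ℝ) ≤ ⌈γ⌉₊ := by exact_mod_cast Nat.one_le_ceil_iff.2 hγ0
    rw [caputoDeriv_eq_fracInt hm, fracInt_fracInt hγ0 (sub_pos.2 hlt) ht
      (h.integrable t ht).1.aestronglyMeasurable]
    · congr 1; ring
    · rw [add_sub_cancel]
      exact intervalIntegrable_kernel_smul h1m (h.integrable t ht)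

/-! ### Resolvents of the derivative on Schwartz functions -/

theorem sub_two_pi_ne_zero {μ : ℂ} (hμ : μ.im ≠ 0) (ξ : ℝ) : μ - 2 * Real.pi * ξ ≠ 0 := by
  intro h
  apply hμ
  have := congrArg Complex.im h
  simpa using this

theorem abs_im_le_norm_sub_two_pi (μ : ℂ) (ξ : ℝ) : |μ.im| ≤ ‖μ - 2 * Real.pi * ξ‖ := by
  have := Complex.abs_im_le_norm (μ - 2 * Real.pi * ξ)
  simpa using this

theorem iteratedDeriv_inv_sub_two_pi {μ : ℂ} (hμ : μ.im ≠ 0) (n : ℕ) :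
    iteratedDeriv n (fun ξ : ℝ => (μ - 2 * Real.pi * ξ)⁻¹) =
      fun ξ : ℝ => (n.factorial : ℂ) * (2 * Real.pi) ^ n * ((μ - 2 * Real.pi * ξ)⁻¹) ^ (n + 1) := by
  induction n with
  | zero => ext ξ; simp
  | succ n ih =>
    rw [iteratedDeriv_succ, ih]
    ext ξ
    have h1 : HasDerivAt (fun ξ : ℝ => μ - 2 * Real.pi * (ξ : ℂ)) (-(2 * Real.pi)) ξ := by
      have := (((hasDerivAt_id ξ).ofReal_comp).const_mul (2 * Real.pi : ℂ)).const_sub μ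
      simpa using this
    have h2 := ((h1.fun_inv (sub_two_pi_ne_zero hμ ξ)).fun_pow (n + 1)).const_mul
      ((n.factorial : ℂ) * (2 * Real.pi) ^ n)
    rw [h2.deriv]
    have h0 := sub_two_pi_ne_zero hμ ξ
    simp only [Nat.add_sub_cancel, neg_neg, Nat.factorial_succ]
    push_cast
    generalize (μ - 2 * Real.pi * ξ) = w at h0
    field_simp
    simp only [one_div, inv_pow]
    field_simp
    ring

theorem contDiff_inv_sub_two_pi {μ : ℂ} (hμ : μ.im ≠ 0) {n : WithTop ℕ∞} :
    ContDiff ℝ n (fun ξ : ℝ => (μ - 2 * Real.pi * (ξ : ℂ))⁻¹) := by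
  refine ContDiff.inv ?_ (sub_two_pi_ne_zero hμ)
  exact contDiff_const.sub (contDiff_const.mul Complex.ofRealCLM.contDiff)

/-- The bound is uniform in `ξ`. Its base is at least `1`, so bounds with different exponents can be
merged by raising the exponent. -/
theorem norm_iteratedFDeriv_inv_sub_two_pi_le {μ : ℂ} (hμ : μ.im ≠ 0) (n : ℕ) (ξ : ℝ) :
    ‖iteratedFDeriv ℝ n (fun ξ : ℝ => (μ - 2 * Real.pi * ξ)⁻¹) ξ‖ ≤
      n.factorial * (2 * Real.pi) ^ n * (1 + |μ.im|⁻¹) ^ (n + 1) := by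
  rw [norm_iteratedFDeriv_eq_norm_iteratedDeriv, iteratedDeriv_inv_sub_two_pi hμ]
  have h : ‖(μ - 2 * Real.pi * ξ)⁻¹‖ ≤ 1 + |μ.im|⁻¹ := by
    rw [norm_inv]
    have h1 : 0 < |μ.im| := abs_pos.2 hμ
    calc ‖μ - 2 * Real.pi * ξ‖⁻¹ ≤ |μ.im|⁻¹ := by
          gcongr; exact abs_im_le_norm_sub_two_pi μ ξ
      _ ≤ _ := by linarith
  simp only [norm_mul, norm_pow, Complex.norm_natCast, Complex.norm_ofNat, Complex.norm_real,
    Real.norm_of_nonneg Real.pi_pos.le]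
  gcongr

theorem hasTemperateGrowth_inv_sub_two_pi {μ : ℂ} (hμ : μ.im ≠ 0) :
    Function.HasTemperateGrowth (fun ξ : ℝ => (μ - 2 * Real.pi * ξ)⁻¹) :=
  ⟨contDiff_inv_sub_two_pi hμ, fun n => ⟨0, _, fun ξ => by
    simpa using norm_iteratedFDeriv_inv_sub_two_pi_le hμ n ξ⟩⟩

/-- The resolvent `(μ + i d/dx)⁻¹`, `μ ∉ ℝ`. -/
def resolvent (μ : ℂ) (φ : 𝓢(ℝ, ℂ)) : 𝓢(ℝ, ℂ) :=
  FourierTransform.fourierInv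
    (SchwartzMap.smulLeftCLM ℂ (fun ξ : ℝ => (μ - 2 * Real.pi * ξ)⁻¹) (FourierTransform.fourier φ))

theorem derivCLM_fourierInv (f : 𝓢(ℝ, ℂ)) :
    SchwartzMap.derivCLM ℂ ℂ (FourierTransform.fourierInv f) = FourierTransform.fourierInv
      ((2 * Real.pi * Complex.I) • SchwartzMap.smulLeftCLM ℂ (fun ξ : ℝ => (ξ : ℂ)) f) := by
  have h := SchwartzMap.lineDerivOp_fourierInv_eq f (1 : ℝ)
  have h2 : SchwartzMap.derivCLM ℂ ℂ (FourierTransform.fourierInv f) =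
      LineDeriv.lineDerivOp (1 : ℝ) (FourierTransform.fourierInv f : 𝓢(ℝ, ℂ)) := by
    ext x
    rw [SchwartzMap.derivCLM_apply, SchwartzMap.lineDerivOp_apply_eq_fderiv]
    exact (fderiv_apply_one_eq_deriv).symm
  rw [h2, h]
  congr 2
  ext x
  rw [SchwartzMap.smulLeftCLM_apply_apply (by fun_prop), SchwartzMap.smulLeftCLM_apply_apply
    Function.Complex.hasTemperateGrowth_ofReal]
  simp

/-- On the Fourier side, with `k = 2πξ`, this is `i k / (μ - k) = i μ / (μ - k) - i`. -/
theorem derivCLM_resolvent {μ : ℂ} (hμ : μ.im ≠ 0) (φ : 𝓢(ℝ, ℂ)) :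
    SchwartzMap.derivCLM ℂ ℂ (resolvent μ φ) =
      (Complex.I * μ) • resolvent μ φ - Complex.I • φ := by
  have hφ : φ = FourierTransform.fourierInv (FourierTransform.fourier φ) :=
    (FourierTransform.fourierInv_fourier_eq φ).symm
  conv_rhs => rw [hφ]
  simp only [resolvent]
  rw [FourierTransform.fourier_fourierInv_eq, derivCLM_fourierInv,
    ← FourierTransform.fourierInv_smul, ← FourierTransform.fourierInv_smul,
    sub_eq_add_neg, ← FourierTransform.fourierInv_neg, ← FourierTransform.fourierInv_add]
  congr 1
  ext ξ
  simp only [smul_apply, add_apply, neg_apply]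
  rw [SchwartzMap.smulLeftCLM_apply_apply Function.Complex.hasTemperateGrowth_ofReal,
    SchwartzMap.smulLeftCLM_apply_apply (hasTemperateGrowth_inv_sub_two_pi hμ)]
  have h0 := sub_two_pi_ne_zero hμ ξ
  simp only [smul_eq_mul]
  field_simp
  ring

/-- Leibniz rule; the point is that `C` does not depend on `μ`. -/
theorem exists_seminorm_smulLeftCLM_le (f : 𝓢(ℝ, ℂ)) (k n : ℕ) :
    ∃ C : ℝ, 0 ≤ C ∧ ∀ μ : ℂ, μ.im ≠ 0 →
      SchwartzMap.seminorm ℂ k n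
        (SchwartzMap.smulLeftCLM ℂ (fun ξ : ℝ => (μ - 2 * Real.pi * ξ)⁻¹) f) ≤
      C * (1 + |μ.im|⁻¹) ^ (n + 1) := by
  refine ⟨∑ i ∈ Finset.range (n + 1), (n.choose i : ℝ) * (i.factorial * (2 * Real.pi) ^ i) *
    SchwartzMap.seminorm ℂ k (n - i) f, ?_, fun μ hμ => ?_⟩
  · positivity
  have hb : (1 : ℝ) ≤ 1 + |μ.im|⁻¹ := by
    have : 0 ≤ |μ.im|⁻¹ := by positivity
    linarith
  refine SchwartzMap.seminorm_le_bound ℂ k n _ (by positivity) fun x => ?_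
  have h1 := norm_iteratedFDeriv_mul_le (N := n) (contDiff_inv_sub_two_pi hμ) (f.smooth n) x
    (n := n) le_rfl
  have h2 : (SchwartzMap.smulLeftCLM ℂ (fun ξ : ℝ => (μ - 2 * Real.pi * ξ)⁻¹) f : ℝ → ℂ) =
      fun ξ : ℝ => (μ - 2 * Real.pi * ξ)⁻¹ * f ξ := by
    rw [SchwartzMap.smulLeftCLM_apply (hasTemperateGrowth_inv_sub_two_pi hμ)]
    rfl
  rw [h2]
  calc ‖x‖ ^ k * ‖iteratedFDeriv ℝ n (fun ξ : ℝ => (μ - 2 * Real.pi * ξ)⁻¹ * f ξ) x‖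
      ≤ ‖x‖ ^ k * ∑ i ∈ Finset.range (n + 1), (n.choose i : ℝ) *
        ‖iteratedFDeriv ℝ i (fun ξ : ℝ => (μ - 2 * Real.pi * ξ)⁻¹) x‖ *
        ‖iteratedFDeriv ℝ (n - i) f x‖ := by gcongr
    _ = ∑ i ∈ Finset.range (n + 1), (n.choose i : ℝ) *
        ‖iteratedFDeriv ℝ i (fun ξ : ℝ => (μ - 2 * Real.pi * ξ)⁻¹) x‖ *
        (‖x‖ ^ k * ‖iteratedFDeriv ℝ (n - i) f x‖) := by
        rw [Finset.mul_sum]; exact Finset.sum_congr rfl fun i _ => by ring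
    _ ≤ ∑ i ∈ Finset.range (n + 1), (n.choose i : ℝ) *
        (i.factorial * (2 * Real.pi) ^ i * (1 + |μ.im|⁻¹) ^ (n + 1)) *
        SchwartzMap.seminorm ℂ k (n - i) f := by
        refine Finset.sum_le_sum fun i hi => ?_
        have hi' : i + 1 ≤ n + 1 := Finset.mem_range.1 hi
        gcongr
        · refine (norm_iteratedFDeriv_inv_sub_two_pi_le hμ i x).trans ?_
          gcongr
        · exact SchwartzMap.le_seminorm ℂ k (n - i) f x
    _ = _ := by
        rw [Finset.sum_mul]; exact Finset.sum_congr rfl fun i _ => by ring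

/-- By continuity a tempered distribution is controlled by finitely many Schwartz seminorms, each of
which grows at most like a power of `1 + |Im μ|⁻¹`. -/
theorem exists_norm_resolvent_le (Λ : 𝓢'(ℝ, ℂ)) (φ : 𝓢(ℝ, ℂ)) :
    ∃ (C : ℝ) (K : ℕ), 0 ≤ C ∧ ∀ μ : ℂ, μ.im ≠ 0 → ‖Λ (resolvent μ φ)‖ ≤ C * (1 + |μ.im|⁻¹) ^ K := by
  -- `Λ` is moved to the Fourier side, where the resolvent is multiplication by its symbol.
  let q : Seminorm ℂ 𝓢(ℝ, ℂ) := (normSeminorm ℂ ℂ).comp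
    ((FourierTransform.fourierInv Λ : 𝓢'(ℝ, ℂ)) : 𝓢(ℝ, ℂ) →ₗ[ℂ] ℂ)
  have hq : Continuous q := by
    have : Continuous fun f : 𝓢(ℝ, ℂ) => ‖(FourierTransform.fourierInv Λ : 𝓢'(ℝ, ℂ)) f‖ :=
      (ContinuousLinearMap.continuous (FourierTransform.fourierInv Λ : 𝓢'(ℝ, ℂ))).norm
    exact this
  obtain ⟨s, C, -, hC⟩ := Seminorm.bound_of_continuous (schwartz_withSeminorms ℂ ℝ ℂ) q hq
  set f : 𝓢(ℝ, ℂ) := FourierTransform.fourier φ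
  have hs : ∃ (C : ℝ) (K : ℕ), 0 ≤ C ∧ ∀ μ : ℂ, μ.im ≠ 0 → (s.sup (schwartzSeminormFamily ℂ ℝ ℂ))
      (SchwartzMap.smulLeftCLM ℂ (fun ξ : ℝ => (μ - 2 * Real.pi * ξ)⁻¹) f) ≤
      C * (1 + |μ.im|⁻¹) ^ K := by
    clear hC
    induction s using Finset.induction_on with
    | empty => exact ⟨0, 0, le_rfl, fun μ hμ => by simp⟩
    | insert a s _ ih =>
      obtain ⟨C1, K, hC1, h1⟩ := ih
      obtain ⟨C2, hC2, h2⟩ := exists_seminorm_smulLeftCLM_le f a.1 a.2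
      refine ⟨C1 + C2, max K (a.2 + 1), by positivity, fun μ hμ => ?_⟩
      have hb : (1 : ℝ) ≤ 1 + |μ.im|⁻¹ := by
        have : 0 ≤ |μ.im|⁻¹ := by positivity
        linarith
      rw [Finset.sup_insert, Seminorm.sup_apply, add_mul]
      refine max_le ?_ ?_
      · refine (h2 μ hμ).trans (le_add_of_nonneg_of_le (by positivity) ?_)
        gcongr
        exact le_max_right _ _
      · refine (h1 μ hμ).trans (le_add_of_le_of_nonneg ?_ (by positivity))
        gcongr
        exact le_max_left _ _
  obtain ⟨D, K, hD, h⟩ := hs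
  refine ⟨C * D, K, by positivity, fun μ hμ => ?_⟩
  calc ‖Λ (resolvent μ φ)‖
      = q (SchwartzMap.smulLeftCLM ℂ (fun ξ : ℝ => (μ - 2 * Real.pi * ξ)⁻¹) f) := rfl
    _ ≤ C * (s.sup (schwartzSeminormFamily ℂ ℝ ℂ))
        (SchwartzMap.smulLeftCLM ℂ (fun ξ : ℝ => (μ - 2 * Real.pi * ξ)⁻¹) f) := hC _
    _ ≤ C * (D * (1 + |μ.im|⁻¹) ^ K) := by gcongr; exact h μ hμ
    _ = _ := by ring

/-- The resolvent `(μ² + d²/dx²)⁻¹`, `μ ∉ ℝ`. -/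
def resolventSq (μ : ℂ) (φ : 𝓢(ℝ, ℂ)) : 𝓢(ℝ, ℂ) :=
  (2 * μ)⁻¹ • (resolvent μ φ - resolvent (-μ) φ)

/-- Partial fractions: with `k = 2πξ`, `1/(μ - k) - 1/(-μ - k) = 2μ / (μ² - k²)`, and the second
derivative has symbol `-k²`. -/
theorem derivCLM_derivCLM_resolventSq {μ : ℂ} (hμ : μ.im ≠ 0) (φ : 𝓢(ℝ, ℂ)) :
    SchwartzMap.derivCLM ℂ ℂ (SchwartzMap.derivCLM ℂ ℂ (resolventSq μ φ)) =
      φ - μ ^ 2 • resolventSq μ φ := by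
  have h1 := derivCLM_resolvent hμ φ
  have h2 := derivCLM_resolvent (μ := -μ) (by simpa) φ
  have h0 : μ ≠ 0 := by rintro rfl; simp at hμ
  simp only [resolventSq, map_smul, map_sub, h1, h2]
  ext x
  simp only [smul_apply, sub_apply, smul_eq_mul]
  field_simp
  ring_nf
  simp only [Complex.I_sq]
  ring

/-- The factor `(2μ)⁻¹` supplies the extra `|Im μ|⁻¹`; this decay is what rules out nonzero
constants in the Liouville theorem. -/
theorem exists_norm_resolventSq_le (Λ : 𝓢'(ℝ, ℂ)) (φ : 𝓢(ℝ, ℂ)) :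
    ∃ (C : ℝ) (K : ℕ), 0 ≤ C ∧ ∀ μ : ℂ, μ.im ≠ 0 →
      ‖Λ (resolventSq μ φ)‖ ≤ C * |μ.im|⁻¹ * (1 + |μ.im|⁻¹) ^ K := by
  obtain ⟨C, K, hC, h⟩ := exists_norm_resolvent_le Λ φ
  refine ⟨C, K, hC, fun μ hμ => ?_⟩
  have h1 := h μ hμ
  have h2 := h (-μ) (by simpa)
  rw [Complex.neg_im, abs_neg] at h2
  have h3 : 0 < |μ.im| := abs_pos.2 hμ
  rw [resolventSq, map_smul, map_sub, smul_eq_mul, norm_mul, norm_inv, norm_mul, Complex.norm_ofNat]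
  calc (2 * ‖μ‖)⁻¹ * ‖Λ (resolvent μ φ) - Λ (resolvent (-μ) φ)‖
      ≤ (2 * |μ.im|)⁻¹ * (C * (1 + |μ.im|⁻¹) ^ K + C * (1 + |μ.im|⁻¹) ^ K) := by
        gcongr
        · exact Complex.abs_im_le_norm μ
        · exact (norm_sub_le _ _).trans (add_le_add h1 h2)
    _ = _ := by rw [mul_inv]; ring

/-! ### A Liouville theorem -/

/-- An entire function which off the real axis is bounded by a power of the inverse distance to the
real axis, with some decay, vanishes. -/
theorem eq_zero_of_norm_le_abs_im {H : ℂ → ℂ} (hH : Differentiable ℂ H) {C : ℝ} {K : ℕ}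
    (hC : 0 ≤ C) (h : ∀ μ : ℂ, μ.im ≠ 0 → ‖H μ‖ ≤ C * |μ.im|⁻¹ * (1 + |μ.im|⁻¹) ^ K) (μ : ℂ) :
    H μ = 0 := by
  have key : ∀ ρ : ℝ, 1 ≤ ρ → 2 * ‖μ‖ ≤ ρ → ‖H μ‖ ≤ C * (16 / 3) ^ (K + 1) * ρ⁻¹ := by
    intro ρ hρ hμρ
    have hρ0 : 0 < ρ := by linarith
    -- On the circle `|z| = ρ` one has `z² - ρ² = z (z - z̄) = 2 i z Im z`. The factor therefore
    -- cancels the possible blow-up of the bound on `H` near the points `±ρ`, and the maximum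
    -- principle applies to `G`.
    set G : ℂ → ℂ := fun z => H z * (z ^ 2 - (ρ : ℂ) ^ 2) ^ (K + 1) with hG
    have hGd : Differentiable ℂ G := by
      exact hH.mul (((differentiable_id.pow 2).sub_const _).pow _)
    have hfr : ∀ z ∈ frontier (Metric.ball (0 : ℂ) ρ),
        ‖G z‖ ≤ C * (2 * ρ) ^ (K + 1) * (2 * ρ) ^ K := by
      intro z hz
      rw [frontier_ball _ hρ0.ne', mem_sphere_zero_iff_norm] at hz
      have hid : z ^ 2 - (ρ : ℂ) ^ 2 = z * (2 * z.im * Complex.I) := by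
        have h1 : ((ρ : ℂ)) ^ 2 = z * (starRingEnd ℂ) z := by
          rw [Complex.mul_conj, Complex.normSq_eq_norm_sq, hz]; push_cast; ring
        have h2 : z - (starRingEnd ℂ) z = 2 * z.im * Complex.I := by
          rw [Complex.sub_conj]; push_cast; ring
        rw [h1, ← h2]; ring
      have hnorm : ‖z ^ 2 - (ρ : ℂ) ^ 2‖ = 2 * ρ * |z.im| := by
        rw [hid]; simp [hz]; ring
      by_cases hzi : z.im = 0
      · simp only [hG, norm_mul, norm_pow, hnorm, hzi]
        simp
        positivity
      · have hp : 0 < |z.im| := abs_pos.2 hzi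
        have hle : |z.im| ≤ ρ := hz ▸ Complex.abs_im_le_norm z
        simp only [hG, norm_mul, norm_pow, hnorm]
        calc ‖H z‖ * (2 * ρ * |z.im|) ^ (K + 1)
            ≤ C * |z.im|⁻¹ * (1 + |z.im|⁻¹) ^ K * (2 * ρ * |z.im|) ^ (K + 1) := by
              gcongr; exact h z hzi
          _ = C * (2 * ρ) ^ (K + 1) * ((1 + |z.im|⁻¹) * |z.im|) ^ K := by
              rw [mul_pow (2 * ρ) |z.im|, mul_pow _ |z.im| K, pow_succ |z.im| K]
              field_simp
          _ ≤ _ := by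
              have : (1 + |z.im|⁻¹) * |z.im| ≤ 2 * ρ := by
                rw [add_mul, inv_mul_cancel₀ hp.ne']; linarith
              gcongr
    have hmem : μ ∈ closure (Metric.ball (0 : ℂ) ρ) := by
      refine subset_closure ?_
      rw [mem_ball_zero_iff]
      have := norm_nonneg μ
      rcases eq_or_lt_of_le this with h0 | h0 <;> linarith
    have hmax := Complex.norm_le_of_forall_mem_frontier_norm_le Metric.isBounded_ball
      hGd.diffContOnCl hfr hmem
    -- Here `‖μ‖ ≤ ρ / 2` is used.
    have hlow : 3 / 4 * ρ ^ 2 ≤ ‖μ ^ 2 - (ρ : ℂ) ^ 2‖ := by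
      have h1 : ‖(ρ : ℂ) ^ 2‖ - ‖μ ^ 2‖ ≤ ‖μ ^ 2 - (ρ : ℂ) ^ 2‖ := by
        rw [norm_sub_rev]; exact norm_sub_norm_le _ _
      rw [norm_pow, norm_pow, Complex.norm_real, Real.norm_of_nonneg hρ0.le] at h1
      nlinarith [norm_nonneg μ]
    have h2 : ‖H μ‖ * (3 / 4 * ρ ^ 2) ^ (K + 1) ≤ C * (2 * ρ) ^ (K + 1) * (2 * ρ) ^ K := by
      refine le_trans ?_ hmax
      simp only [hG, norm_mul, norm_pow]
      gcongr
    -- Power count: `ρ ^ (2K+1)` from the circle against `ρ ^ (2K+2)` at `μ` leaves `ρ⁻¹`; the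
    -- constant is `16/3 = 4 / (3/4)`.
    have h3 : C * (2 * ρ) ^ (K + 1) * (2 * ρ) ^ K =
        C * (16 / 3) ^ (K + 1) * (2 * ρ)⁻¹ * (3 / 4 * ρ ^ 2) ^ (K + 1) := by
      have e : (16 / 3 : ℝ) ^ (K + 1) * (3 / 4 * ρ ^ 2) ^ (K + 1) =
          (2 * ρ) ^ (K + 1) * (2 * ρ) ^ (K + 1) := by
        rw [← mul_pow, ← mul_pow]; congr 1; ring
      calc _ = C * ((2 * ρ) ^ (K + 1) * (2 * ρ) ^ (K + 1)) * (2 * ρ)⁻¹ := by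
            rw [pow_succ (2 * ρ) K]; field_simp
        _ = _ := by rw [← e]; ring
    rw [h3] at h2
    have h4 := le_of_mul_le_mul_right h2 (by positivity)
    refine h4.trans ?_
    gcongr
    linarith
  have hlim : Tendsto (fun ρ : ℝ => C * (16 / 3) ^ (K + 1) * ρ⁻¹) atTop (𝓝 0) := by
    simpa using tendsto_inv_atTop_zero.const_mul (C * (16 / 3) ^ (K + 1))
  have hle : ‖H μ‖ ≤ 0 := by
    refine ge_of_tendsto hlim ?_
    filter_upwards [eventually_ge_atTop 1, eventually_ge_atTop (2 * ‖μ‖)] with ρ h1 h2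
    exact key ρ h1 h2
  simpa using hle

/-! ### Uniqueness -/

/-- The Neumann series of the scalar equation, stopped after `N + 1` terms. -/
theorem Volterra.eq_sum {γ t : ℝ} {l : ℂ} {d e : ℝ → ℂ} (hγ : 0 < γ) (hd : LocBdd d) (he : LocBdd e)
    (h : ∀ s, 0 < s → e s = fracInt γ d s - l * fracInt γ e s) (ht : 0 < t) (N : ℕ) :
    e t = ∑ n ∈ Finset.range (N + 1), (-l) ^ n * fracInt (γ * (n + 1)) d t +
      (-l) ^ (N + 1) * fracInt (γ * (N + 1)) e t := by
  induction N with
  | zero => rw [h t ht]; simp; ring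
  | succ N ih =>
    have hN : 0 < γ * ((N : ℝ) + 1) := by positivity
    have h1 : fracInt (γ * (N + 1)) e t =
        fracInt (γ * (N + 1)) (fun s => fracInt γ d s + (-l) * fracInt γ e s) t :=
      fracInt_congr ht.le fun z hz => by rw [h z hz.1]; ring
    rw [(hd.fracInt hγ).fracInt_add ((he.fracInt hγ).const_mul _) hN ht, fracInt_const_mul,
      hd.fracInt_fracInt hN hγ ht, he.fracInt_fracInt hN hγ ht] at h1
    have e1 : γ * ((N : ℝ) + 1) + γ = γ * ((N + 1 : ℕ) + 1) := by push_cast; ring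
    rw [e1] at h1
    rw [Finset.sum_range_succ, ih, h1]
    push_cast
    ring

theorem exists_norm_fracInt_le {γ t : ℝ} {d : ℝ → ℂ} (hγ : 0 < γ) (hd : LocBdd d) (ht : 0 < t)
    {r : ℝ} (hr : 0 ≤ r) : ∃ C : ℝ, 0 ≤ C ∧ ∀ n : ℕ,
      r ^ (n + 1) * ‖fracInt (γ * (n + 1)) d t‖ ≤ C * (1 / 2) ^ n := by
  obtain ⟨M, hM0, hM⟩ := hd.bdd t ht
  obtain ⟨C, hC0, hC⟩ := pow_div_Gamma_le hγ (y := r * t ^ γ) (by positivity)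
  refine ⟨M * C, by positivity, fun n => ?_⟩
  have h1 := LocBdd.norm_fracInt_le (a := γ * (n + 1)) (by positivity) ht hM
  have h2 := hC (n + 1)
  have h3 : (r * t ^ γ) ^ (n + 1) = r ^ (n + 1) * t ^ (γ * ((n : ℝ) + 1)) := by
    rw [mul_pow, ← Real.rpow_natCast (t ^ γ), ← Real.rpow_mul ht.le]; push_cast; rfl
  rw [h3] at h2
  push_cast at h2
  calc r ^ (n + 1) * ‖fracInt (γ * (n + 1)) d t‖
      ≤ r ^ (n + 1) * (M * (t ^ (γ * ((n : ℝ) + 1)) / Real.Gamma (γ * (n + 1) + 1))) := by gcongr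
    _ = M * (r ^ (n + 1) * t ^ (γ * ((n : ℝ) + 1)) / Real.Gamma (γ * (n + 1) + 1)) := by ring
    _ ≤ M * (C * (1 / 2) ^ (n + 1)) := by gcongr
    _ ≤ M * (C * (1 / 2) ^ n) := by
        gcongr ?_ * (?_ * ?_)
        exact pow_le_pow_of_le_one (by norm_num) (by norm_num) (Nat.le_succ n)
    _ = _ := by ring

/-- The Neumann series of `Λ_t` on the resolvent of `φ` converges for every `μ`, since Gamma factors
beat geometric growth. It is an entire function bounded by powers of `1/|Im μ|`, hence zero. -/
theorem eq_zero_of_volterra {γ : ℝ} (hγ : 0 < γ) (Λ : ℝ → 𝓢'(ℝ, ℂ))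
    (hb : ∀ φ : 𝓢(ℝ, ℂ), LocBdd fun t => Λ t φ)
    (hv : ∀ φ : 𝓢(ℝ, ℂ), ∀ t, 0 < t → Λ t φ = fracInt γ
      (fun s => Λ s (SchwartzMap.derivCLM ℂ ℂ (SchwartzMap.derivCLM ℂ ℂ φ))) t)
    {t : ℝ} (ht : 0 < t) (φ : 𝓢(ℝ, ℂ)) : Λ t φ = 0 := by
  -- The value `Λ_t(φ)` is such a fractional integral, taken for `φ''`.
  suffices h : ∀ φ : 𝓢(ℝ, ℂ), fracInt γ (fun s => Λ s φ) t = 0 by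
    rw [hv φ t ht, h]
  intro φ
  set d : ℝ → ℂ := fun s => Λ s φ with hd
  set a : ℕ → ℂ := fun n => fracInt (γ * (n + 1)) d t with ha
  set H : ℂ → ℂ := fun μ => ∑' n : ℕ, (-μ ^ 2) ^ n * a n with hH
  have hsb : ∀ R : ℝ, 0 ≤ R → ∃ u : ℕ → ℝ, Summable u ∧ ∀ n, ∀ μ : ℂ, ‖μ‖ ≤ R →
      ‖(-μ ^ 2) ^ n * a n‖ ≤ u n := by
    intro R hR
    -- `R² + 1` dominates `‖μ²‖` and is at least `1`, so the exponent `n` may be raised to `n + 1`.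
    obtain ⟨C, hC0, hC⟩ := exists_norm_fracInt_le hγ (hb φ) ht (r := R ^ 2 + 1) (by positivity)
    refine ⟨fun n => C * (1 / 2) ^ n,
      (summable_geometric_of_lt_one (by norm_num) (by norm_num)).mul_left C, fun n μ hμ => ?_⟩
    refine le_trans ?_ (hC n)
    rw [norm_mul, norm_pow, norm_neg, norm_pow]
    gcongr
    calc (‖μ‖ ^ 2) ^ n ≤ (R ^ 2 + 1) ^ n := by
          gcongr
          have := pow_le_pow_left₀ (norm_nonneg μ) hμ 2
          linarith
      _ ≤ (R ^ 2 + 1) ^ (n + 1) := pow_le_pow_right₀ (by nlinarith) (Nat.le_succ n)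
  have hdiff : Differentiable ℂ H := by
    intro μ
    obtain ⟨u, hu, hle⟩ := hsb (‖μ‖ + 1) (by positivity)
    have := Complex.differentiableOn_tsum_of_summable_norm hu (F := fun n (μ : ℂ) => (-μ ^ 2) ^ n * a n)
      (U := Metric.ball 0 (‖μ‖ + 1)) (fun n => by fun_prop) Metric.isOpen_ball
      (fun n w hw => hle n w (mem_ball_zero_iff.1 hw).le)
    exact this.differentiableAt (Metric.isOpen_ball.mem_nhds (by simp))
  obtain ⟨C, K, hC, hbound⟩ := exists_norm_resolventSq_le (Λ t) φ
  -- Off the real axis the sum is the pairing with an actual Schwartz function, which brings in the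
  -- resolvent bound.
  have hval : ∀ μ : ℂ, μ.im ≠ 0 → H μ = Λ t (resolventSq μ φ) := by
    intro μ hμ
    set e : ℝ → ℂ := fun s => Λ s (resolventSq μ φ) with he
    have hvol : ∀ s, 0 < s → e s = fracInt γ d s - μ ^ 2 * fracInt γ e s := by
      intro s hs
      rw [he]
      simp only
      rw [hv _ s hs, derivCLM_derivCLM_resolventSq hμ, sub_eq_add_neg (fracInt γ d s), ← neg_mul,
        ← fracInt_const_mul, ← (hb φ).fracInt_add ((hb (resolventSq μ φ)).const_mul _) hγ hs]
      refine fracInt_congr hs.le fun z _ => ?_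
      rw [map_sub, map_smul, smul_eq_mul]; ring
    have hsum := Volterra.eq_sum hγ (hb φ) (hb (resolventSq μ φ)) hvol ht
    obtain ⟨u, hu, hle⟩ := hsb ‖μ‖ (norm_nonneg μ)
    have hs : Summable fun n : ℕ => (-μ ^ 2) ^ n * a n :=
      Summable.of_norm_bounded hu fun n => hle n μ le_rfl
    have h1 := hs.hasSum.tendsto_sum_nat.comp (tendsto_add_atTop_nat 1)
    obtain ⟨D, hD0, hD⟩ := exists_norm_fracInt_le hγ (hb (resolventSq μ φ)) ht (r := ‖μ ^ 2‖)
      (norm_nonneg _)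
    have h2 : Tendsto (fun N : ℕ => (-μ ^ 2) ^ (N + 1) * fracInt (γ * (N + 1)) e t) atTop (𝓝 0) := by
      refine squeeze_zero_norm (a := fun N => D * (1 / 2) ^ N) (fun N => ?_) ?_
      · rw [norm_mul, norm_pow, norm_neg]; exact hD N
      · simpa using (tendsto_pow_atTop_nhds_zero_of_lt_one (r := (1 / 2 : ℝ)) (by norm_num)
          (by norm_num)).const_mul D
    have h3 := h1.add h2
    rw [add_zero] at h3
    refine tendsto_nhds_unique h3 ?_
    refine tendsto_const_nhds.congr fun N => ?_
    exact hsum N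
  -- Only the value at `μ = 0`, a point of the real axis, is needed: there just the term `n = 0`
  -- survives.
  have h0 := eq_zero_of_norm_le_abs_im hdiff hC (fun μ hμ => (hval μ hμ) ▸ hbound μ hμ) 0
  have h1 : H 0 = a 0 := by
    rw [hH]
    simp only
    rw [tsum_eq_single 0 (fun n hn => by simp [hn])]
    simp
  rw [h1, ha] at h0
  simpa using h0

theorem LocBdd.of_tendsto {f : ℝ → ℂ} {c : ℂ} (hf : ContinuousOn f (Ioi 0))
    (h0 : Tendsto f (𝓝[>] 0) (𝓝 c)) : LocBdd f := by
  refine ⟨hf, fun T hT => ?_⟩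
  have h1 : ∀ᶠ z in 𝓝[>] (0 : ℝ), ‖f z‖ < ‖c‖ + 1 := h0.norm.eventually_lt_const (by linarith)
  obtain ⟨δ, hδ, hδ'⟩ := mem_nhdsGT_iff_exists_Ioc_subset.1 h1
  have hδ0 : (0 : ℝ) < δ := hδ
  obtain ⟨M, hM⟩ := (isCompact_Icc (a := δ) (b := T)).exists_bound_of_continuousOn
    (hf.mono fun z hz => lt_of_lt_of_le hδ0 hz.1)
  refine ⟨max (‖c‖ + 1) M, le_max_of_le_left (by positivity), fun z hz => ?_⟩
  rcases le_or_gt z δ with h | h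
  · exact (le_of_lt (hδ' ⟨hz.1, h⟩)).trans (le_max_left _ _)
  · exact (hM z ⟨h.le, hz.2⟩).trans (le_max_right _ _)

theorem IsFundamentalSolution.locBdd {γ : ℝ} {u : ℝ → 𝓢'(ℝ, ℂ)} (h : IsFundamentalSolution γ u)
    (φ : 𝓢(ℝ, ℂ)) : LocBdd fun t => u t φ :=
  LocBdd.of_tendsto (h.regular φ).contDiffOn.continuousOn (h.initial φ)

theorem IsFundamentalSolution.volterra {γ : ℝ} (hγ0 : 0 < γ) (hγ2 : γ ≤ 2) {u : ℝ → 𝓢'(ℝ, ℂ)}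
    (h : IsFundamentalSolution γ u) (φ : 𝓢(ℝ, ℂ)) {t : ℝ} (ht : 0 < t) :
    u t φ = (Measure.dirac (0 : ℝ)).toTemperedDistribution φ + fracInt γ
      (fun s => u s (SchwartzMap.derivCLM ℂ ℂ (SchwartzMap.derivCLM ℂ ℂ φ))) t := by
  have := (h.regular φ).eq_add_fracInt_caputoDeriv hγ0 hγ2 (h.initial φ)
    (fun h1 => h.initial_velocity h1 φ) ht
  rw [this]
  congr 1
  refine fracInt_congr ht.le fun s hs => ?_
  rw [h.equation φ s hs.1]
  -- The two sign changes from moving both derivatives to the test function cancel.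
  simp

theorem IsFundamentalSolution.unique {γ : ℝ} (hγ0 : 0 < γ) (hγ2 : γ ≤ 2) {u w : ℝ → 𝓢'(ℝ, ℂ)}
    (hu : IsFundamentalSolution γ u) (hw : IsFundamentalSolution γ w) {t : ℝ} (ht : 0 < t) :
    w t = u t := by
  have key := eq_zero_of_volterra hγ0 (fun t => w t - u t)
    (fun φ => by simpa [sub_eq_add_neg] using (hw.locBdd φ).add ((hu.locBdd φ).const_mul (-1)))
    (fun φ s hs => by
      have h1 := hw.volterra hγ0 hγ2 φ hs
      have h2 := hu.volterra hγ0 hγ2 φ hs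
      set ψ := SchwartzMap.derivCLM ℂ ℂ (SchwartzMap.derivCLM ℂ ℂ φ)
      have h3 := (hw.locBdd ψ).fracInt_add ((hu.locBdd ψ).const_mul (-1)) hγ0 hs
      rw [fracInt_const_mul] at h3
      have h4 : (fun s => (w s - u s) ψ) = fun s => w s ψ + -1 * u s ψ := by
        ext s; rw [sub_apply]; ring
      rw [h4, h3, sub_apply, h1, h2]
      ring) ht
  ext φ
  have := key φ
  rw [sub_apply] at this
  exact sub_eq_zero.1 this

/-! ### The scalar fractional equation for the characteristic function -/

/-- The law `σ` on the line has the characteristic function `y ↦ ∑ₙ (-y²)ⁿ / Γ(γ n + 1)`. -/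
def HasMittagLefflerCharFun (γ : ℝ) (σ : Measure ℝ) : Prop :=
  ∀ y : ℝ, HasSum (fun n : ℕ => (((-(y ^ 2)) ^ n / Real.Gamma (γ * n + 1) : ℝ) : ℂ)) (charFun σ y)

theorem HasMittagLefflerCharFun.hasSum_powKer {γ : ℝ} {σ : Measure ℝ}
    (h : HasMittagLefflerCharFun γ σ) (ξ : ℝ) {t : ℝ} (ht : 0 < t) :
    HasSum (fun n : ℕ => ((-(ξ ^ 2) : ℝ) : ℂ) ^ n * powKer (γ * n) t)
      (charFun σ (ξ * t ^ (γ / 2))) := by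
  refine (h (ξ * t ^ (γ / 2))).congr_fun fun n => ?_
  rw [powKer, ← Complex.ofReal_pow, ← Complex.ofReal_mul]
  congr 1
  have : t ^ (γ * n) = ((t ^ (γ / 2)) ^ 2) ^ n := by
    rw [← pow_mul, ← Real.rpow_natCast, ← Real.rpow_mul ht.le]
    congr 1; push_cast; ring
  rw [this, mul_pow, neg_mul_eq_neg_mul, mul_pow]
  ring

theorem norm_powKer {b t : ℝ} (hb : -1 < b) (ht : 0 < t) :
    ‖powKer b t‖ = t ^ b / Real.Gamma (b + 1) := by
  have hG : 0 < Real.Gamma (b + 1) := Real.Gamma_pos_of_pos (by linarith)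
  rw [powKer, Complex.norm_real, Real.norm_of_nonneg (by positivity)]

theorem intervalIntegrable_kernel_powKer {a b t : ℝ} (ha : 0 < a) (hb : -1 < b) (ht : 0 < t) :
    IntervalIntegrable (fun z => (t - z) ^ (a - 1) • powKer b z) volume 0 t := by
  have h := ((intervalIntegrable_beta ha (b := b + 1) (by linarith) ht).div_const
    (Real.Gamma (b + 1)))
  have h' : IntervalIntegrable (fun z => (((t - z) ^ (a - 1) * z ^ (b + 1 - 1) /
    Real.Gamma (b + 1) : ℝ) : ℂ)) volume 0 t := ⟨h.1.ofReal, h.2.ofReal⟩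
  refine h'.congr fun z _ => ?_
  simp only [powKer, add_sub_cancel_right, Complex.real_smul]
  push_cast; ring

/-- `I^γ` sends `t^(γ n) / Γ(γ n + 1)` to the same expression with `n + 1`, so it shifts the
Mittag-Leffler series by one term; the term lost is the constant `1`. -/
theorem HasMittagLefflerCharFun.eq_one_sub {γ : ℝ} (hγ : 0 < γ) {σ : Measure ℝ}
    (h : HasMittagLefflerCharFun γ σ) (ξ : ℝ) {t : ℝ} (ht : 0 < t) :
    charFun σ (ξ * t ^ (γ / 2)) =
      1 - ξ ^ 2 * fracInt γ (fun z => charFun σ (ξ * z ^ (γ / 2))) t := by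
  set l : ℂ := ((-(ξ ^ 2) : ℝ) : ℂ) with hl
  set F : ℕ → ℝ → ℂ := fun n z => (t - z) ^ (γ - 1) • (l ^ n * powKer (γ * n) z) with hF
  have hbn : ∀ n : ℕ, -1 < γ * (n : ℝ) := fun n => by
    have : 0 ≤ γ * (n : ℝ) := by positivity
    linarith
  have hFi : ∀ n, IntervalIntegrable (F n) volume 0 t := by
    intro n
    refine ((intervalIntegrable_kernel_powKer hγ (hbn n) ht).const_mul (l ^ n)).congr fun z _ => ?_
    simp only [hF, Complex.real_smul]; ring
  have hval : ∀ n : ℕ, fracInt γ (fun z => l ^ n * powKer (γ * n) z) t =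
      l ^ n * powKer (γ * (n + 1)) t := by
    intro n
    rw [fracInt_const_mul, fracInt_powKer hγ (hbn n) ht]
    congr 2; ring
  have hG : 0 < Real.Gamma γ := Real.Gamma_pos_of_pos hγ
  have hnorm : ∀ n : ℕ, ∫ z in Ioc 0 t, ‖F n z‖ =
      Real.Gamma γ * (‖l‖ ^ n * (t ^ (γ * ((n : ℝ) + 1)) / Real.Gamma (γ * (n + 1) + 1))) := by
    intro n
    have h1 := fracInt_powKer hγ (hbn n) ht
    have h2 : ∫ z in Ioc 0 t, ‖F n z‖ = ‖l‖ ^ n * ∫ z in (0 : ℝ)..t, (t - z) ^ (γ - 1) *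
        (z ^ (γ * (n : ℝ) + 1 - 1)) / Real.Gamma (γ * n + 1) := by
      rw [intervalIntegral.integral_of_le ht.le, ← integral_const_mul]
      refine setIntegral_congr_fun measurableSet_Ioc fun z hz => ?_
      have h0 : 0 ≤ t - z := by linarith [hz.2]
      simp only [hF]
      rw [norm_smul, norm_mul, norm_powKer (hbn n) hz.1, norm_pow, Real.norm_of_nonneg
        (by positivity), add_sub_cancel_right]
      ring
    have hGn : 0 < Real.Gamma (γ * n + 1) := Real.Gamma_pos_of_pos (by linarith [hbn n])
    rw [h2, intervalIntegral.integral_div, integral_beta hγ (by linarith [hbn n]) ht,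
      show γ + (γ * (n : ℝ) + 1) - 1 = γ * (n + 1) by ring,
      show γ + (γ * (n : ℝ) + 1) = γ * (n + 1) + 1 by ring]
    field_simp
  -- Summability of the `L¹` norms justifies integrating the series term by term.
  have hsummable : Summable fun n : ℕ => ∫ z in Ioc 0 t, ‖F n z‖ := by
    have h1 := (summable_nat_add_iff 1).2 (summable_pow_div_Gamma hγ
      (y := (‖l‖ + 1) * t ^ γ) (by positivity))
    refine Summable.of_nonneg_of_le (fun n => integral_nonneg fun _ => norm_nonneg _)
      (fun n => ?_) (h1.mul_left (Real.Gamma γ))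
    have hGn : 0 < Real.Gamma (γ * (n + 1) + 1) := Real.Gamma_pos_of_pos (by positivity)
    rw [hnorm]
    push_cast
    have h3 : t ^ (γ * ((n : ℝ) + 1)) = (t ^ γ) ^ (n + 1) := by
      rw [← Real.rpow_natCast (t ^ γ), ← Real.rpow_mul ht.le]; push_cast; rfl
    rw [h3, mul_pow, ← mul_div_assoc]
    gcongr
    calc ‖l‖ ^ n ≤ (‖l‖ + 1) ^ n := by gcongr; linarith
      _ ≤ (‖l‖ + 1) ^ (n + 1) := pow_le_pow_right₀ (by linarith [norm_nonneg l]) (Nat.le_succ n)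
  have hsum := hasSum_integral_of_summable_integral_norm
    (fun n => (intervalIntegrable_iff_integrableOn_Ioc_of_le ht.le).1 (hFi n)) hsummable
  have hpt : ∫ z in Ioc 0 t, ∑' n, F n z =
      ∫ z in (0 : ℝ)..t, (t - z) ^ (γ - 1) • charFun σ (ξ * z ^ (γ / 2)) := by
    rw [intervalIntegral.integral_of_le ht.le]
    refine setIntegral_congr_fun measurableSet_Ioc fun z hz => ?_
    exact ((h.hasSum_powKer ξ hz.1).const_smul _).tsum_eq
  rw [hpt] at hsum
  have hsum2 : HasSum (fun n : ℕ => l ^ n * powKer (γ * (n + 1)) t)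
      (fracInt γ (fun z => charFun σ (ξ * z ^ (γ / 2))) t) := by
    refine (hsum.const_smul (Real.Gamma γ)⁻¹).congr_fun fun n => ?_
    rw [← hval n, fracInt, intervalIntegral.integral_of_le ht.le]
  have hA := h.hasSum_powKer ξ ht
  have hB := (hasSum_nat_add_iff' 1).2 hA
  have hC := hsum2.mul_left l
  have : (fun n : ℕ => l * (l ^ n * powKer (γ * (n + 1)) t)) =
      fun n : ℕ => l ^ (n + 1) * powKer (γ * ((n + 1 : ℕ) : ℝ)) t := by
    ext n; push_cast; ring
  rw [this] at hC
  have hD := hC.unique hB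
  have h0 : powKer 0 t = 1 := by simp [powKer]
  simp only [Finset.range_one, Finset.sum_singleton, pow_zero, Nat.cast_zero, mul_zero, h0,
    mul_one] at hD
  have hl' : l = -(ξ : ℂ) ^ 2 := by rw [hl]; push_cast; ring
  rw [hl'] at hD
  linear_combination (-1 : ℂ) * hD

/-! ### Dilated laws and the Volterra equation for test functions -/

/-- The second derivative on Schwartz functions. -/
abbrev secondDeriv (φ : 𝓢(ℝ, ℂ)) : 𝓢(ℝ, ℂ) :=
  SchwartzMap.derivCLM ℂ ℂ (SchwartzMap.derivCLM ℂ ℂ φ)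

/-- The pairing of `φ` with the image of `σ` under dilation by `t ^ (γ / 2)`. -/
def scaledMean (γ : ℝ) (σ : Measure ℝ) (φ : 𝓢(ℝ, ℂ)) (t : ℝ) : ℂ :=
  ∫ x, φ (t ^ (γ / 2) * x) ∂σ

theorem exists_norm_schwartz_le (φ : 𝓢(ℝ, ℂ)) : ∃ C : ℝ, 0 ≤ C ∧ ∀ x, ‖φ x‖ ≤ C :=
  ⟨SchwartzMap.seminorm ℂ 0 0 φ, apply_nonneg _ _, fun x => by
    simpa using SchwartzMap.norm_le_seminorm ℂ φ x⟩

theorem continuous_scaledMean {γ : ℝ} (hγ : 0 < γ) (σ : Measure ℝ) [IsProbabilityMeasure σ]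
    (φ : 𝓢(ℝ, ℂ)) : Continuous (scaledMean γ σ φ) := by
  obtain ⟨C, hC0, hC⟩ := exists_norm_schwartz_le φ
  refine continuous_of_dominated (bound := fun _ => C) (fun t => ?_) (fun t => ?_)
    (integrable_const C) ?_
  · exact (φ.continuous.comp (continuous_const.mul continuous_id)).aestronglyMeasurable
  · exact Eventually.of_forall fun x => hC _
  · refine Eventually.of_forall fun x => φ.continuous.comp ?_
    exact (Real.continuous_rpow_const (by positivity)).mul continuous_const

theorem locBdd_scaledMean {γ : ℝ} (hγ : 0 < γ) (σ : Measure ℝ) [IsProbabilityMeasure σ]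
    (φ : 𝓢(ℝ, ℂ)) : LocBdd (scaledMean γ σ φ) :=
  LocBdd.of_tendsto (continuous_scaledMean hγ σ φ).continuousOn
    ((continuous_scaledMean hγ σ φ).continuousAt.tendsto.mono_left nhdsWithin_le_nhds)

theorem scaledMean_zero {γ : ℝ} (hγ : 0 < γ) (σ : Measure ℝ) [IsProbabilityMeasure σ]
    (φ : 𝓢(ℝ, ℂ)) : scaledMean γ σ φ 0 = φ 0 := by
  simp [scaledMean, Real.zero_rpow (by positivity : γ / 2 ≠ 0)]

theorem fourierInv_apply_eq (ψ : 𝓢(ℝ, ℂ)) (y : ℝ) :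
    (FourierTransform.fourierInv ψ : 𝓢(ℝ, ℂ)) y =
      ∫ ξ : ℝ, Complex.exp (((2 * Real.pi * ξ * y : ℝ) : ℂ) * Complex.I) * ψ ξ := by
  rw [SchwartzMap.fourierInv_coe, Real.fourierInv_eq']
  refine integral_congr_ae (Eventually.of_forall fun ξ => ?_)
  simp only [smul_eq_mul, RCLike.inner_apply, conj_trivial]
  congr 3
  congr 1
  ring

/-- Fubini; a Schwartz function is seen by the dilated law only through the characteristic function.
-/
theorem scaledMean_fourierInv (γ : ℝ) (σ : Measure ℝ) [IsProbabilityMeasure σ] (ψ : 𝓢(ℝ, ℂ))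
    (t : ℝ) : scaledMean γ σ (FourierTransform.fourierInv ψ) t =
      ∫ ξ : ℝ, ψ ξ * charFun σ (2 * Real.pi * ξ * t ^ (γ / 2)) := by
  simp only [scaledMean, fourierInv_apply_eq]
  rw [integral_integral_swap]
  · refine integral_congr_ae (Eventually.of_forall fun ξ => ?_)
    simp only
    rw [integral_mul_const, mul_comm, charFun_apply_real]
    congr 1
    refine integral_congr_ae (Eventually.of_forall fun x => ?_)
    simp only
    congr 1
    push_cast; ring
  · have h1 : Integrable (fun p : ℝ × ℝ => ψ p.2) (σ.prod volume) :=
      (ψ.integrable (μ := volume)).comp_snd σ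
    refine (h1.bdd_mul (c := 1)
      (f := fun p : ℝ × ℝ => Complex.exp (((2 * Real.pi * p.2 * (t ^ (γ / 2) * p.1) : ℝ) : ℂ) *
      Complex.I)) ?_ ?_)
    · exact (by fun_prop : Continuous _).aestronglyMeasurable
    · exact Eventually.of_forall fun p => by rw [Complex.norm_exp_ofReal_mul_I]

theorem secondDeriv_fourierInv (ψ : 𝓢(ℝ, ℂ)) :
    ∃ ψ' : 𝓢(ℝ, ℂ), secondDeriv (FourierTransform.fourierInv ψ) = FourierTransform.fourierInv ψ' ∧
      ∀ ξ, ψ' ξ = -((2 * Real.pi * ξ) ^ 2) * ψ ξ := by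
  refine ⟨_, by rw [secondDeriv, derivCLM_fourierInv, derivCLM_fourierInv], fun ξ => ?_⟩
  have h := Function.Complex.hasTemperateGrowth_ofReal
  simp only [smul_apply, SchwartzMap.smulLeftCLM_apply_apply h, smul_eq_mul]
  linear_combination (2 * Real.pi * ξ) ^ 2 * ψ ξ * Complex.I_sq

/-- Fourier inversion writes `φ` as a superposition of exponentials. The mode `ξ` satisfies the
scalar equation with parameter `2πξ`, and `-(2πξ)²` is the symbol of the second derivative. -/
theorem HasMittagLefflerCharFun.scaledMean_eq {γ : ℝ} (hγ : 0 < γ) {σ : Measure ℝ}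
    [IsProbabilityMeasure σ] (h : HasMittagLefflerCharFun γ σ) (φ : 𝓢(ℝ, ℂ)) {t : ℝ} (ht : 0 < t) :
    scaledMean γ σ φ t = φ 0 + fracInt γ (scaledMean γ σ (secondDeriv φ)) t := by
  obtain ⟨ψ, rfl⟩ : ∃ ψ : 𝓢(ℝ, ℂ), φ = FourierTransform.fourierInv ψ :=
    ⟨_, (FourierTransform.fourierInv_fourier_eq φ).symm⟩
  obtain ⟨ψ', h1, h2⟩ := secondDeriv_fourierInv ψ
  have hcm : Measurable (charFun σ) := measurable_charFun
  rw [h1, fourierInv_apply_eq]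
  simp only [mul_zero, Complex.ofReal_zero, zero_mul, Complex.exp_zero, one_mul]
  have hswap : fracInt γ (scaledMean γ σ (FourierTransform.fourierInv ψ')) t =
      ∫ ξ : ℝ, ψ' ξ * fracInt γ (fun z => charFun σ (2 * Real.pi * ξ * z ^ (γ / 2))) t := by
    simp only [fracInt, scaledMean_fourierInv, intervalIntegral.integral_of_le ht.le,
      Complex.real_smul]
    rw [← integral_const_mul]
    simp only [← integral_const_mul]
    rw [integral_integral_swap]
    · congr 1; ext ξ; congr 1; ext z; ring
    · have hk : Integrable (fun z : ℝ => (((t - z) ^ (γ - 1) : ℝ) : ℂ))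
          (volume.restrict (Ioc 0 t)) := by
        have := (intervalIntegrable_beta hγ one_pos ht).1
        simp only [sub_self, Real.rpow_zero, mul_one] at this
        exact this.ofReal
      have hp := ((hk.mul_prod (ψ'.integrable (μ := volume))).bdd_mul (c := 1)
        (f := fun p : ℝ × ℝ => charFun σ (2 * Real.pi * p.2 * p.1 ^ (γ / 2))) ?_ ?_).const_mul
        (((Real.Gamma γ)⁻¹ : ℝ) : ℂ)
      · refine hp.congr (Eventually.of_forall fun p => ?_)
        simp only [Function.uncurry]
        ring
      · exact (hcm.comp (by fun_prop)).aestronglyMeasurable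
      · exact Eventually.of_forall fun p => norm_charFun_le_one _
  have hbi : ∀ (χ : 𝓢(ℝ, ℂ)), Integrable
      (fun ξ : ℝ => χ ξ * charFun σ (2 * Real.pi * ξ * t ^ (γ / 2))) := fun χ =>
    χ.integrable.mul_bdd (c := 1) (hcm.comp (by fun_prop)).aestronglyMeasurable
      (Eventually.of_forall fun p => norm_charFun_le_one _)
  rw [hswap, scaledMean_fourierInv]
  have e : ∀ ξ : ℝ, ψ' ξ * fracInt γ (fun z => charFun σ (2 * Real.pi * ξ * z ^ (γ / 2))) t =
      ψ ξ * charFun σ (2 * Real.pi * ξ * t ^ (γ / 2)) - ψ ξ := fun ξ => by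
    rw [h.eq_one_sub hγ _ ht, h2]; push_cast; ring
  simp only [e]
  rw [integral_sub (hbi ψ) ψ.integrable]
  ring

/-- A fractional Taylor expansion in time, by iterating the Volterra equation. For large `N` the
remainder is as smooth in `t` as desired, so differentiability need not be proved under the integral
sign. -/
theorem HasMittagLefflerCharFun.scaledMean_expansion {γ : ℝ} (hγ : 0 < γ) {σ : Measure ℝ}
    [IsProbabilityMeasure σ] (h : HasMittagLefflerCharFun γ σ) (φ : 𝓢(ℝ, ℂ)) {t : ℝ} (ht : 0 < t)
    (N : ℕ) : scaledMean γ σ φ t =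
      ∑ i ∈ Finset.range (N + 1), (secondDeriv^[i] φ) 0 * powKer (γ * i) t +
        fracInt (γ * (N + 1)) (scaledMean γ σ (secondDeriv^[N + 1] φ)) t := by
  induction N with
  | zero => simpa [powKer] using h.scaledMean_eq hγ φ ht
  | succ N ih =>
    have hN : 0 < γ * ((N : ℝ) + 1) := by positivity
    set χ := secondDeriv^[N + 1] φ with hχ
    have hl := locBdd_scaledMean hγ σ (secondDeriv χ)
    have e : fracInt (γ * (N + 1)) (scaledMean γ σ χ) t =
        fracInt (γ * (N + 1)) (fun s => χ 0 * 1 + fracInt γ (scaledMean γ σ (secondDeriv χ)) s) t :=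
      fracInt_congr ht.le fun s hs => by rw [h.scaledMean_eq hγ χ hs.1, mul_one]
    have e1 : fracInt (γ * (N + 1)) (fun _ => 1) t = powKer (γ * (N + 1)) t := by
      have := fracInt_powKer (a := γ * (N + 1)) (b := 0) hN (by norm_num) ht
      rw [add_zero] at this
      rw [← this]
      exact fracInt_congr ht.le fun z hz => by simp [powKer]
    rw [ih, e, LocBdd.fracInt_add (LocBdd.const _) (hl.fracInt hγ) hN ht, hl.fracInt_fracInt hN hγ ht,
      fracInt_const_mul, e1, Finset.sum_range_succ _ (N + 1), Function.iterate_succ_apply' _ (N + 1)]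
    push_cast
    rw [← hχ, show γ * ((N : ℝ) + 1) + γ = γ * (N + 1 + 1) by ring]
    ring

/-! ### Regularity and Caputo derivative of fractional power expansions -/

/-- The formal derivative of order `a` of `∑ cᵢ t^(γ i) / Γ(γ i + 1)` plus a remainder. -/
def powExpansion (γ : ℝ) (c : ℕ → ℂ) (h : ℝ → ℂ) (n : ℕ) (a t : ℝ) : ℂ :=
  ∑ i ∈ Finset.range n, c i * powKer (γ * i - a) t + fracInt (γ * n - a) h t

theorem hasDerivAt_powExpansion {γ : ℝ} {c : ℕ → ℂ} {h : ℝ → ℂ} (hh : LocBdd h) {n : ℕ} {a t : ℝ}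
    (ha : a + 1 < γ * n) (ht : 0 < t) :
    HasDerivAt (powExpansion γ c h n a) (powExpansion γ c h n (a + 1) t) t := by
  have h1 := hh.hasDerivAt_fracInt (a := γ * n - (a + 1)) (by linarith) ht
  rw [show γ * n - (a + 1) + 1 = γ * n - a by ring] at h1
  refine HasDerivAt.add (HasDerivAt.fun_sum fun i _ => ?_) h1
  have h2 := (hasDerivAt_powKer (b := γ * i - a) ht).const_mul (c i)
  rwa [show γ * (i : ℝ) - a - 1 = γ * i - (a + 1) by ring] at h2

theorem continuousOn_powExpansion {γ : ℝ} {c : ℕ → ℂ} {h : ℝ → ℂ} (hh : LocBdd h) {n : ℕ} {a : ℝ}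
    (ha : a < γ * n) : ContinuousOn (powExpansion γ c h n a) (Ioi 0) := by
  refine ContinuousOn.add (continuousOn_finsetSum _ fun i _ => ?_)
    (hh.continuousOn_fracInt (by linarith))
  exact continuousOn_const.mul fun t ht => (hasDerivAt_powKer ht).continuousAt.continuousWithinAt

section

variable {γ : ℝ} {c : ℕ → ℂ} {h f : ℝ → ℂ} {n : ℕ}

theorem deriv_eq_powExpansion (hh : LocBdd h) (hn : 2 < γ * n)
    (hf : ∀ t, 0 < t → f t = powExpansion γ c h n 0 t) {t : ℝ} (ht : 0 < t) :
    deriv f t = powExpansion γ c h n 1 t := by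
  have h1 := (hasDerivAt_powExpansion (γ := γ) (n := n) (a := 0) (c := c) hh (by linarith) ht)
  rw [zero_add] at h1
  refine (h1.congr_of_eventuallyEq ?_).deriv
  filter_upwards [Ioi_mem_nhds ht] with s hs using hf s hs

theorem deriv_deriv_eq_powExpansion (hh : LocBdd h) (hn : 2 < γ * n)
    (hf : ∀ t, 0 < t → f t = powExpansion γ c h n 0 t) {t : ℝ} (ht : 0 < t) :
    deriv (deriv f) t = powExpansion γ c h n 2 t := by
  have h1 := (hasDerivAt_powExpansion (γ := γ) (n := n) (a := 1) (c := c) hh (by linarith) ht)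
  rw [one_add_one_eq_two] at h1
  refine (h1.congr_of_eventuallyEq ?_).deriv
  filter_upwards [Ioi_mem_nhds ht] with s hs using deriv_eq_powExpansion hh hn hf hs

theorem iteratedDeriv_eq_powExpansion (hh : LocBdd h) (hn : 2 < γ * n)
    (hf : ∀ t, 0 < t → f t = powExpansion γ c h n 0 t) {m : ℕ} (hm : m = 1 ∨ m = 2) {t : ℝ}
    (ht : 0 < t) : iteratedDeriv m f t = powExpansion γ c h n m t := by
  rcases hm with rfl | rfl
  · rw [iteratedDeriv_one, deriv_eq_powExpansion hh hn hf ht, Nat.cast_one]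
  · rw [iteratedDeriv_succ, iteratedDeriv_one, deriv_deriv_eq_powExpansion hh hn hf ht,
      Nat.cast_ofNat]

theorem contDiffOn_of_eq_powExpansion (hh : LocBdd h) (hn : 2 < γ * n)
    (hf : ∀ t, 0 < t → f t = powExpansion γ c h n 0 t) : ContDiffOn ℝ 2 f (Ioi 0) := by
  have hd : ∀ t, 0 < t → HasDerivAt f (powExpansion γ c h n 1 t) t := fun t ht => by
    have h1 := (hasDerivAt_powExpansion (γ := γ) (n := n) (a := 0) (c := c) hh (by linarith) ht)
    rw [zero_add] at h1
    refine h1.congr_of_eventuallyEq ?_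
    filter_upwards [Ioi_mem_nhds ht] with s hs using hf s hs
  have hd2 : ∀ t, 0 < t → HasDerivAt (deriv f) (powExpansion γ c h n 2 t) t := fun t ht => by
    have h1 := (hasDerivAt_powExpansion (γ := γ) (n := n) (a := 1) (c := c) hh (by linarith) ht)
    rw [one_add_one_eq_two] at h1
    refine h1.congr_of_eventuallyEq ?_
    filter_upwards [Ioi_mem_nhds ht] with s hs using deriv_eq_powExpansion hh hn hf hs
  have h2 : (2 : WithTop ℕ∞) = 1 + 1 := by norm_num
  rw [h2, contDiffOn_succ_iff_deriv_of_isOpen isOpen_Ioi]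
  refine ⟨fun t ht => (hd t ht).differentiableAt.differentiableWithinAt, by simp, ?_⟩
  have h1 : (1 : WithTop ℕ∞) = 0 + 1 := by norm_num
  rw [h1, contDiffOn_succ_iff_deriv_of_isOpen isOpen_Ioi]
  refine ⟨fun t ht => (hd2 t ht).differentiableAt.differentiableWithinAt, by simp, ?_⟩
  rw [contDiffOn_zero]
  exact (continuousOn_powExpansion hh (by linarith)).congr fun t ht =>
    deriv_deriv_eq_powExpansion hh hn hf ht

/-- The constant term of an expansion disappears under differentiation because `1 / Γ` is zero at
`0` and `-1`. -/
theorem powKer_neg_nat {m : ℕ} (hm : m = 1 ∨ m = 2) (t : ℝ) : powKer (-m) t = 0 := by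
  rcases hm with rfl | rfl
  · simp [powKer]
  · have : Real.Gamma (-((2 : ℕ) : ℝ) + 1) = 0 := by
      have := Real.Gamma_neg_nat_eq_zero 1
      rw [← this]; congr 1; norm_num
    rw [powKer, this]; simp

/-- The expansion without its first term, which is annihilated by the derivative. -/
theorem powExpansion_succ_nat {m : ℕ} (hm : m = 1 ∨ m = 2) (t : ℝ) :
    powExpansion γ c h (n + 1) m t =
      ∑ i ∈ Finset.range n, c (i + 1) * powKer (γ * (i + 1) - m) t +
        fracInt (γ * (n + 1) - m) h t := by
  rw [powExpansion, Finset.sum_range_succ']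
  simp [powKer_neg_nat hm]

theorem caputoRegular_of_eq_powExpansion (hγ0 : 0 < γ) (hγ2 : γ ≤ 2) (hh : LocBdd h)
    (hn : 2 < γ * (n + 1 : ℕ)) (hf : ∀ t, 0 < t → f t = powExpansion γ c h (n + 1) 0 t) :
    CaputoRegular γ f := by
  have hm : ⌈γ⌉₊ = 1 ∨ ⌈γ⌉₊ = 2 := (le_or_gt γ 1).imp (ceil_eq_one hγ0) (ceil_eq_two · hγ2)
  have hm2 : (⌈γ⌉₊ : ℝ) ≤ 2 := by rcases hm with h | h <;> rw [h] <;> norm_num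
  have hlt : (⌈γ⌉₊ : ℝ) < γ + 1 := Nat.ceil_lt_add_one hγ0.le
  refine ⟨(contDiffOn_of_eq_powExpansion hh hn hf).of_le ?_, fun T hT => ?_⟩
  · exact_mod_cast hm2
  · have key : IntervalIntegrable (fun t => ∑ i ∈ Finset.range n,
        c (i + 1) * powKer (γ * (i + 1) - ⌈γ⌉₊) t + fracInt (γ * (n + 1) - ⌈γ⌉₊) h t)
        volume 0 T := by
      refine IntervalIntegrable.add ?_ ?_
      · have := IntervalIntegrable.sum (μ := volume) (a := 0) (b := T) (Finset.range n)
          (f := fun i t => c (i + 1) * powKer (γ * (i + 1) - ⌈γ⌉₊) t) fun i _ => ?_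
        · simpa only [Finset.sum_fn] using this
        · refine (intervalIntegrable_powKer ?_).const_mul _
          -- The exponent exceeds `-1` since `⌈γ⌉₊ < γ + 1`: this is where the loss of the constant
          -- term gives integrability at `0`.
          nlinarith [mul_nonneg hγ0.le (Nat.cast_nonneg (α := ℝ) i)]
      · refine (hh.fracInt ?_).intervalIntegrable hT
        push_cast at hn; linarith
    refine key.congr fun z hz => ?_
    rw [uIoc_of_le hT.le] at hz
    rw [iteratedDeriv_eq_powExpansion hh hn hf hm hz.1, powExpansion_succ_nat hm]

theorem fracInt_sum {ι : Type*} (s : Finset ι) {a t : ℝ} {g : ι → ℝ → ℂ}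
    (hg : ∀ i ∈ s, IntervalIntegrable (fun z => (t - z) ^ (a - 1) • g i z) volume 0 t) :
    fracInt a (fun z => ∑ i ∈ s, g i z) t = ∑ i ∈ s, fracInt a (g i) t := by
  simp only [fracInt, Finset.smul_sum]
  rw [intervalIntegral.integral_finsetSum hg, Finset.smul_sum]

theorem intervalIntegrable_kernel_finsetSum {ι : Type*} (s : Finset ι) {a t : ℝ} {g : ι → ℝ → ℂ}
    (hg : ∀ i ∈ s, IntervalIntegrable (fun z => (t - z) ^ (a - 1) • g i z) volume 0 t) :
    IntervalIntegrable (fun z => (t - z) ^ (a - 1) • ∑ i ∈ s, g i z) volume 0 t := by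
  have := IntervalIntegrable.sum (μ := volume) (a := 0) (b := t) s hg
  simpa only [Finset.sum_fn, Finset.smul_sum] using this

/-- Differentiating `m` times and applying `I^(m-γ)` lowers each exponent by `γ` and kills the
constant, so the expansion shifts by one index. For `γ = m` there is no integral to apply. -/
theorem caputoDeriv_of_eq_powExpansion (hγ0 : 0 < γ) (hγ2 : γ ≤ 2) (hh : LocBdd h)
    (hn : 2 < γ * (n + 1 : ℕ)) (hf : ∀ t, 0 < t → f t = powExpansion γ c h (n + 1) 0 t) {t : ℝ}
    (ht : 0 < t) : caputoDeriv γ f t =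
      ∑ i ∈ Finset.range n, c (i + 1) * powKer (γ * i) t + fracInt (γ * n) h t := by
  have hm : ⌈γ⌉₊ = 1 ∨ ⌈γ⌉₊ = 2 := (le_or_gt γ 1).imp (ceil_eq_one hγ0) (ceil_eq_two · hγ2)
  have hm2 : (⌈γ⌉₊ : ℝ) ≤ 2 := by rcases hm with h | h <;> rw [h] <;> norm_num
  have hlt : (⌈γ⌉₊ : ℝ) < γ + 1 := Nat.ceil_lt_add_one hγ0.le
  have hd : ∀ z, 0 < z → iteratedDeriv ⌈γ⌉₊ f z = ∑ i ∈ Finset.range n,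
      c (i + 1) * powKer (γ * (i + 1) - ⌈γ⌉₊) z + fracInt (γ * (n + 1) - ⌈γ⌉₊) h z :=
    fun z hz => by rw [iteratedDeriv_eq_powExpansion hh hn hf hm hz, powExpansion_succ_nat hm]
  by_cases hγm : (⌈γ⌉₊ : ℝ) = γ
  · rw [caputoDeriv, if_pos hγm, hd t ht, hγm]
    congr 2
    · ext i; congr 2; ring
    · ring
  · have ha : 0 < (⌈γ⌉₊ : ℝ) - γ := sub_pos.2 (lt_of_le_of_ne (Nat.le_ceil γ) (Ne.symm hγm))
    have hb : ∀ i : ℕ, -1 < γ * ((i : ℝ) + 1) - ⌈γ⌉₊ := fun i => by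
      nlinarith [mul_nonneg hγ0.le (Nat.cast_nonneg (α := ℝ) i)]
    have hpos : 0 < γ * ((n : ℝ) + 1) - ⌈γ⌉₊ := by push_cast at hn; linarith
    have hi : ∀ i ∈ Finset.range n, IntervalIntegrable (fun z => (t - z) ^ ((⌈γ⌉₊ : ℝ) - γ - 1) •
        (c (i + 1) * powKer (γ * (i + 1) - ⌈γ⌉₊) z)) volume 0 t := fun i _ => by
      refine ((intervalIntegrable_kernel_powKer ha (hb i) ht).const_mul (c (i + 1))).congr
        fun z _ => ?_
      simp only [Complex.real_smul]; ring
    rw [caputoDeriv_eq_fracInt hγm, fracInt_congr ht.le fun z hz => hd z hz.1,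
      fracInt_add_of_intervalIntegrable (intervalIntegrable_kernel_finsetSum _ hi)
        ((hh.fracInt hpos).intervalIntegrable_kernel ha ht), fracInt_sum _ hi,
      hh.fracInt_fracInt ha hpos ht]
    congr 2
    · ext i
      rw [fracInt_const_mul, fracInt_powKer ha (hb i) ht]
      congr 2; ring
    · ring

theorem tendsto_powKer {b : ℝ} (hb : 0 < b) : Tendsto (powKer b) (𝓝[>] 0) (𝓝 0) := by
  have h1 : Continuous (powKer b) := Complex.continuous_ofReal.comp
    ((Real.continuous_rpow_const hb.le).div_const _)
  have h2 := h1.tendsto 0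
  have h3 : powKer b 0 = 0 := by simp [powKer, Real.zero_rpow hb.ne']
  rw [h3] at h2
  exact h2.mono_left nhdsWithin_le_nhds

theorem LocBdd.tendsto_fracInt (hh : LocBdd h) {a : ℝ} (ha : 0 < a) :
    Tendsto (FracDiff.fracInt a h) (𝓝[>] 0) (𝓝 0) := by
  obtain ⟨C, hC0, hC⟩ := hh.bdd 1 one_pos
  have h1 : Tendsto (fun t => C * ‖powKer a t‖) (𝓝[>] 0) (𝓝 0) := by
    simpa using (tendsto_powKer ha).norm.const_mul C
  refine squeeze_zero_norm' ?_ h1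
  filter_upwards [Ioc_mem_nhdsGT (zero_lt_one (α := ℝ))] with t ht
  rw [norm_powKer (by linarith) ht.1]
  exact LocBdd.norm_fracInt_le ha ht.1 fun z hz => hC z ⟨hz.1, hz.2.trans ht.2⟩

theorem tendsto_deriv_of_eq_powExpansion (hγ1 : 1 < γ) (hh : LocBdd h)
    (hn : 2 < γ * (n + 1 : ℕ)) (hf : ∀ t, 0 < t → f t = powExpansion γ c h (n + 1) 0 t) :
    Tendsto (deriv f) (𝓝[>] 0) (𝓝 0) := by
  have key : Tendsto (fun t => ∑ i ∈ Finset.range n, c (i + 1) * powKer (γ * (i + 1) - 1) t +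
      fracInt (γ * (n + 1) - 1) h t) (𝓝[>] 0) (𝓝 0) := by
    have h1 : Tendsto (fun t => ∑ i ∈ Finset.range n, c (i + 1) * powKer (γ * (i + 1) - 1) t)
        (𝓝[>] 0) (𝓝 (∑ i ∈ Finset.range n, c (i + 1) * 0)) := by
      refine tendsto_finsetSum _ fun i _ => (tendsto_powKer ?_).const_mul _
      nlinarith [mul_nonneg (zero_le_one.trans hγ1.le) (Nat.cast_nonneg (α := ℝ) i)]
    have h2 := h1.add (hh.tendsto_fracInt (a := γ * (n + 1) - 1)
      (by push_cast at hn; linarith))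
    simpa using h2
  refine key.congr' ?_
  filter_upwards [self_mem_nhdsWithin] with t ht
  have := powExpansion_succ_nat (γ := γ) (c := c) (h := h) (n := n) (Or.inl rfl : 1 = 1 ∨ 1 = 2) t
  rw [Nat.cast_one] at this
  rw [deriv_eq_powExpansion hh hn hf ht, this]

end

/-! ### Dilated laws solve the Cauchy problem -/

/-- The image of `σ` under the dilation by `t ^ (γ / 2)`. -/
def dilate (γ : ℝ) (σ : ProbabilityMeasure ℝ) (t : ℝ) : ProbabilityMeasure ℝ :=
  σ.map (f := fun x => t ^ (γ / 2) * x) (by fun_prop)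

theorem toMeasure_dilate (γ : ℝ) (σ : ProbabilityMeasure ℝ) (t : ℝ) :
    (dilate γ σ t : Measure ℝ) = (σ : Measure ℝ).map (fun x => t ^ (γ / 2) * x) := rfl

theorem toTemperedDistribution_dilate (γ : ℝ) (σ : ProbabilityMeasure ℝ) (t : ℝ) (φ : 𝓢(ℝ, ℂ)) :
    (dilate γ σ t : Measure ℝ).toTemperedDistribution φ = scaledMean γ σ φ t := by
  change ∫ x, φ x ∂(dilate γ σ t : Measure ℝ) = _
  rw [toMeasure_dilate, scaledMean, integral_map (by fun_prop) φ.continuous.aestronglyMeasurable]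

theorem HasMittagLefflerCharFun.isTheFundamentalSolution {γ : ℝ} (hγ0 : 0 < γ) (hγ2 : γ ≤ 2)
    {σ : ProbabilityMeasure ℝ} (h : HasMittagLefflerCharFun γ σ) :
    IsTheFundamentalSolution γ (dilate γ σ) := by
  -- Enough terms are expanded for the remainder to be twice continuously differentiable in time.
  obtain ⟨N, hN⟩ := exists_nat_gt (2 / γ)
  have hN' : 2 < γ * (N + 1 + 1 : ℕ) := by
    rw [div_lt_iff₀ hγ0] at hN; push_cast; nlinarith
  have hexp : ∀ φ : 𝓢(ℝ, ℂ), ∀ t, 0 < t → scaledMean γ σ φ t =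
      powExpansion γ (fun i => (secondDeriv^[i] φ) 0)
        (scaledMean γ σ (secondDeriv^[N + 1 + 1] φ)) (N + 1 + 1) 0 t := fun φ t ht => by
    rw [h.scaledMean_expansion hγ0 φ ht (N + 1), powExpansion]
    push_cast
    simp only [sub_zero]
  have hl := fun φ => locBdd_scaledMean hγ0 (σ : Measure ℝ) φ
  have hsol : IsFundamentalSolution γ (fun t => (dilate γ σ t : Measure ℝ).toTemperedDistribution) := by
    refine ⟨fun φ => ?_, fun φ t ht => ?_, fun φ => ?_, fun hγ1 φ => ?_⟩
    · simp only [toTemperedDistribution_dilate]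
      exact caputoRegular_of_eq_powExpansion hγ0 hγ2 (hl _) hN' (hexp φ)
    · simp only [toTemperedDistribution_dilate]
      rw [caputoDeriv_of_eq_powExpansion hγ0 hγ2 (hl _) hN' (hexp φ) ht]
      have e : TemperedDistribution.derivCLM ℂ (TemperedDistribution.derivCLM ℂ
          (dilate γ σ t : Measure ℝ).toTemperedDistribution) φ =
          scaledMean γ σ (secondDeriv φ) t := by
        rw [← toTemperedDistribution_dilate]
        simp
      -- The shifted expansion for `φ` is the expansion for `φ''` with one term fewer, with the same
      -- remainder.
      rw [e, h.scaledMean_expansion hγ0 _ ht N]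
      push_cast
      simp only [Function.iterate_succ_apply]
    · simp only [toTemperedDistribution_dilate]
      have := (continuous_scaledMean hγ0 (σ : Measure ℝ) φ).tendsto 0
      rw [scaledMean_zero hγ0] at this
      simpa using this.mono_left nhdsWithin_le_nhds
    · simp only [toTemperedDistribution_dilate]
      exact tendsto_deriv_of_eq_powExpansion hγ1 (hl _) hN' (hexp φ)
  exact ⟨hsol, fun w hw t ht => hsol.unique hγ0 hγ2 hw ht⟩

/-! ### The integral defining the exponent of the stable law -/

section

variable {p s : ℝ}

theorem one_sub_exp_neg_nonneg {y : ℝ} (hy : 0 ≤ y) : 0 ≤ 1 - Real.exp (-y) := by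
  have := Real.exp_le_one_iff.2 (neg_nonpos.2 hy); linarith

theorem one_sub_exp_neg_le (y : ℝ) : 1 - Real.exp (-y) ≤ y := by
  have := Real.one_sub_le_exp_neg y; linarith

theorem integrableOn_one_sub_exp_mul_rpow (hp0 : 0 < p) (hp1 : p < 1) (hs : 0 ≤ s) :
    IntegrableOn (fun x : ℝ => (1 - Real.exp (-(s * x))) * x ^ (-p - 1)) (Ioi 0) := by
  rw [← Ioc_union_Ioi_eq_Ioi zero_le_one]
  have hm : Measurable fun x : ℝ => (1 - Real.exp (-(s * x))) * x ^ (-p - 1) := by fun_prop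
  refine IntegrableOn.union ?_ ?_
  · have h1 := ((intervalIntegral.intervalIntegrable_rpow' (a := 0) (b := 1) (r := -p)
      (by linarith)).const_mul s).1
    refine Integrable.mono' h1 hm.aestronglyMeasurable ?_
    filter_upwards [ae_restrict_mem measurableSet_Ioc] with x hx
    have hsx : 0 ≤ s * x := mul_nonneg hs hx.1.le
    have hx' : 0 ≤ x ^ (-p - 1) := Real.rpow_nonneg hx.1.le _
    rw [Real.norm_of_nonneg (mul_nonneg (one_sub_exp_neg_nonneg hsx) hx')]
    calc (1 - Real.exp (-(s * x))) * x ^ (-p - 1) ≤ s * x * x ^ (-p - 1) :=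
          mul_le_mul_of_nonneg_right (one_sub_exp_neg_le _) hx'
      _ = s * x ^ (-p) := by
          rw [mul_assoc, Real.rpow_sub_one hx.1.ne']; field_simp [hx.1.ne']
  · have h1 := integrableOn_Ioi_rpow_of_lt (a := -p - 1) (by linarith) (zero_lt_one (α := ℝ))
    refine Integrable.mono' h1 hm.aestronglyMeasurable ?_
    filter_upwards [ae_restrict_mem measurableSet_Ioi] with x hx
    have hx0 : 0 < x := zero_lt_one.trans hx
    have hsx : 0 ≤ s * x := mul_nonneg hs hx0.le
    have hx' : 0 ≤ x ^ (-p - 1) := Real.rpow_nonneg hx0.le _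
    rw [Real.norm_of_nonneg (mul_nonneg (one_sub_exp_neg_nonneg hsx) hx')]
    exact mul_le_of_le_one_left hx' (by linarith [Real.exp_pos (-(s * x))])

theorem integrableOn_rpow_mul_exp_neg_mul {a : ℝ} (ha : 0 < a) (hs : 0 < s) :
    IntegrableOn (fun x : ℝ => x ^ (a - 1) * Real.exp (-(s * x))) (Ioi 0) := by
  have h := integrableOn_rpow_mul_exp_neg_mul_rpow (p := 1) (s := a - 1) (b := s) (by linarith)
    one_pos hs
  refine h.congr_fun (fun x _ => ?_) measurableSet_Ioi
  simp

/-- Integration by parts: `(1 - exp(-s x)) x^(-p)` tends to `0` at both ends, and one part of its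
derivative is a Gamma integral of order `1 - p`. -/
theorem integral_one_sub_exp_mul_rpow (hp0 : 0 < p) (hp1 : p < 1) (hs : 0 < s) :
    ∫ x in Ioi (0 : ℝ), (1 - Real.exp (-(s * x))) * x ^ (-p - 1) =
      s ^ p * (Real.Gamma (1 - p) / p) := by
  have hI := integrableOn_one_sub_exp_mul_rpow hp0 hp1 hs.le
  have hJ := integrableOn_rpow_mul_exp_neg_mul (a := 1 - p) (by linarith) hs
  have hb : ∀ x : ℝ, 0 ≤ x → |(1 - Real.exp (-(s * x))) * x ^ (-p)| ≤ s * x ^ (1 - p) := by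
    intro x hx
    have h0 := one_sub_exp_neg_nonneg (mul_nonneg hs.le hx)
    rw [abs_of_nonneg (mul_nonneg h0 (Real.rpow_nonneg hx _))]
    calc (1 - Real.exp (-(s * x))) * x ^ (-p) ≤ s * x * x ^ (-p) :=
          mul_le_mul_of_nonneg_right (one_sub_exp_neg_le _) (Real.rpow_nonneg hx _)
      _ = s * x ^ (1 - p) := by
          rcases hx.eq_or_lt with rfl | hx
          · simp [Real.zero_rpow (by linarith : (1 - p) ≠ 0)]
          · rw [sub_eq_add_neg, Real.rpow_add hx, Real.rpow_one, mul_assoc]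
  have hF := integral_Ioi_of_hasDerivAt_of_tendsto (a := 0) (m := 0)
    (f := fun x : ℝ => (1 - Real.exp (-(s * x))) * x ^ (-p))
    (f' := fun x => s * (x ^ (1 - p - 1) * Real.exp (-(s * x))) -
      p * ((1 - Real.exp (-(s * x))) * x ^ (-p - 1))) ?_ ?_ ?_ ?_
  · rw [integral_sub (hJ.const_mul s) (hI.const_mul p), integral_const_mul, integral_const_mul,
      Real.integral_rpow_mul_exp_neg_mul_Ioi (by linarith) hs] at hF
    simp only [mul_zero, neg_zero, Real.exp_zero, sub_self, zero_mul] at hF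
    have e : s * ((1 / s) ^ (1 - p) * Real.Gamma (1 - p)) = s ^ p * Real.Gamma (1 - p) := by
      rw [one_div, Real.inv_rpow hs.le, Real.rpow_sub hs, Real.rpow_one]
      field_simp
    rw [e] at hF
    field_simp
    linarith
  · have h0 : (1 - Real.exp (-(s * 0))) * 0 ^ (-p) = 0 := by simp
    rw [ContinuousWithinAt, h0]
    have h1 : Tendsto (fun x : ℝ => s * x ^ (1 - p)) (𝓝[≥] 0) (𝓝 0) := by
      have e : s * (0 : ℝ) ^ (1 - p) = 0 := by
        rw [Real.zero_rpow (sub_pos.2 hp1).ne', mul_zero]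
      exact (((continuous_const (y := s)).mul (Real.continuous_rpow_const
        (sub_pos.2 hp1).le)).tendsto' 0 0 e).mono_left nhdsWithin_le_nhds
    refine squeeze_zero_norm' ?_ h1
    filter_upwards [self_mem_nhdsWithin] with x hx using hb x hx
  · intro x hx
    have hx0 : (0 : ℝ) < x := hx
    have h1 : HasDerivAt (fun x : ℝ => 1 - Real.exp (-(s * x))) (s * Real.exp (-(s * x))) x := by
      have := (((hasDerivAt_id x).const_mul s).neg.exp).const_sub 1
      convert! this using 1
      simp; ring
    convert! h1.mul (Real.hasDerivAt_rpow_const (p := -p) (Or.inl hx0.ne')) using 1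
    rw [show 1 - p - 1 = -p by ring]
    ring
  · exact (hJ.const_mul s).sub (hI.const_mul p)
  · have h1 : Tendsto (fun x : ℝ => x ^ (-p)) atTop (𝓝 0) := tendsto_rpow_neg_atTop hp0
    refine squeeze_zero_norm' ?_ h1
    filter_upwards [eventually_ge_atTop 0] with x hx
    have h0 := one_sub_exp_neg_nonneg (mul_nonneg hs.le hx)
    rw [Real.norm_of_nonneg (mul_nonneg h0 (Real.rpow_nonneg hx _))]
    exact mul_le_of_le_one_left (Real.rpow_nonneg hx _) (by linarith [Real.exp_pos (-(s * x))])

end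

/-! ### Construction of the one-sided stable law -/

/-- The Laplace transform of a law on the half-line. -/
def laplace (μ : Measure ℝ≥0) (s : ℝ) : ℝ := ∫ x : ℝ≥0, Real.exp (-(s * x)) ∂μ

theorem integrable_exp_neg_mul {s : ℝ} (hs : 0 ≤ s) (μ : Measure ℝ≥0) [IsFiniteMeasure μ] :
    Integrable (fun x : ℝ≥0 => Real.exp (-(s * x))) μ := by
  refine Integrable.of_bound (C := 1) (by fun_prop) (Eventually.of_forall fun x => ?_)
  rw [Real.norm_of_nonneg (Real.exp_nonneg _), Real.exp_le_one_iff, neg_nonpos]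
  positivity

/-- The convolution powers of `ρ`, that is, laws of sums of independent copies. -/
theorem exists_laplace_eq_pow (ρ : ProbabilityMeasure ℝ≥0) (k : ℕ) :
    ∃ μ : ProbabilityMeasure ℝ≥0, ∀ s : ℝ, laplace μ s = laplace ρ s ^ k := by
  induction k with
  | zero => exact ⟨⟨Measure.dirac 0, inferInstance⟩, fun s => by simp [laplace]⟩
  | succ k ih =>
    obtain ⟨μ, hμ⟩ := ih
    refine ⟨(μ.prod ρ).map (f := fun p => p.1 + p.2) (by fun_prop), fun s => ?_⟩
    have : (((μ.prod ρ).map (f := fun p : ℝ≥0 × ℝ≥0 => p.1 + p.2) (by fun_prop) :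
        ProbabilityMeasure ℝ≥0) : Measure ℝ≥0) =
        ((μ : Measure ℝ≥0).prod ρ).map (fun p => p.1 + p.2) := rfl
    rw [laplace, this, integral_map (by fun_prop) (by fun_prop), pow_succ, ← hμ, laplace, laplace,
      ← integral_prod_mul]
    refine integral_congr_ae (Eventually.of_forall fun p => ?_)
    simp only [NNReal.coe_add]
    rw [← Real.exp_add]
    congr 1; ring

/-- A Pareto law is the normalized truncation at `ε` of the Lévy measure `x^(-ν-1) dx`, so it
produces the truncated exponent. -/
theorem laplace_map_pareto {ν ε s : ℝ} (hν : 0 < ν) (hε : 0 < ε) (hs : 0 ≤ s) :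
    laplace ((paretoMeasure ε ν).map Real.toNNReal) s =
      1 - ν * ε ^ ν * ∫ x in Ioi ε, (1 - Real.exp (-(s * x))) * x ^ (-ν - 1) := by
  have := isProbabilityMeasure_paretoMeasure hε hν
  have hi : Integrable (fun x : ℝ => Real.exp (-(s * x.toNNReal))) (paretoMeasure ε ν) := by
    have := integrable_exp_neg_mul hs ((paretoMeasure ε ν).map Real.toNNReal)
    exact this.comp_measurable (by fun_prop)
  have h1 : ∫ x : ℝ, (1 - Real.exp (-(s * x.toNNReal))) ∂(paretoMeasure ε ν) =
      ν * ε ^ ν * ∫ x in Ioi ε, (1 - Real.exp (-(s * x))) * x ^ (-ν - 1) := by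
    rw [paretoMeasure, integral_withDensity_eq_integral_toReal_smul
      (f := paretoPDF ε ν) (measurable_paretoPDFReal ε ν).ennreal_ofReal
      (Eventually.of_forall fun x => ENNReal.ofReal_lt_top), ← integral_Ici_eq_integral_Ioi,
      ← integral_const_mul, ← integral_indicator measurableSet_Ici]
    refine integral_congr_ae (Eventually.of_forall fun x => ?_)
    simp only [paretoPDF, smul_eq_mul]
    rw [ENNReal.toReal_ofReal (paretoPDFReal_nonneg hε.le hν.le x)]
    by_cases hx : ε ≤ x
    · rw [indicator_of_mem (mem_Ici.2 hx), paretoPDFReal, if_pos hx,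
        Real.coe_toNNReal _ (hε.le.trans hx), neg_add']
      ring
    · rw [indicator_of_notMem (by simpa using hx), paretoPDFReal, if_neg hx, zero_mul]
  rw [integral_sub (integrable_const _) hi] at h1
  rw [laplace, integral_map (by fun_prop) (by fun_prop), ← h1]
  simp

/-- An approximation of the one-sided stable law. -/
theorem exists_laplace_eq_one_sub_div_pow {ν : ℝ} (hν0 : 0 < ν) (hν1 : ν < 1) (n : ℕ)
    (hn : 0 < n) : ∃ μ : ProbabilityMeasure ℝ≥0, ∀ s : ℝ, 0 ≤ s →
      laplace μ s = (1 + -(ν / Real.Gamma (1 - ν) * ∫ x in Ioi ((n * Real.Gamma (1 - ν)) ^ (-ν⁻¹)),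
        (1 - Real.exp (-(s * x))) * x ^ (-ν - 1)) / n) ^ n := by
  have hG : 0 < Real.Gamma (1 - ν) := Real.Gamma_pos_of_pos (by linarith)
  have hn' : (0 : ℝ) < n := by exact_mod_cast hn
  -- With this cut-off the prefactor `ν ε^ν` equals `ν / (n Γ(1-ν))`, so each of the `n` summands
  -- carries one `n`-th of the truncated exponent.
  set ε : ℝ := (n * Real.Gamma (1 - ν)) ^ (-ν⁻¹) with hεdef
  have hε : 0 < ε := by positivity
  have hεν : ε ^ ν = (n * Real.Gamma (1 - ν))⁻¹ := by
    rw [hεdef, ← Real.rpow_mul (by positivity), neg_mul, inv_mul_cancel₀ hν0.ne', Real.rpow_neg_one]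
  have := isProbabilityMeasure_paretoMeasure hε hν0
  obtain ⟨μ, hμ⟩ := exists_laplace_eq_pow
    ⟨(paretoMeasure ε ν).map Real.toNNReal, Measure.isProbabilityMeasure_map (by fun_prop)⟩ n
  refine ⟨μ, fun s hs => ?_⟩
  rw [hμ, ProbabilityMeasure.coe_mk, laplace_map_pareto hν0 hε hs, hεν]
  congr 1
  field_simp
  ring

/-- Markov's inequality for `1 - exp(-x/R)`, which is at least `1 - exp(-1)` when `x > R`. It turns
control of the Laplace transform near `0` into tightness. -/
theorem measure_lt_le_laplace (μ : ProbabilityMeasure ℝ≥0) {R : ℝ≥0} (hR : 0 < R) :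
    (μ : Measure ℝ≥0).real (Ioi R) ≤
      (1 - laplace μ (R : ℝ)⁻¹) / (1 - Real.exp (-1)) := by
  have he : 0 < 1 - Real.exp (-1) := by
    have := Real.exp_lt_exp.2 (show (-1 : ℝ) < 0 by norm_num); rw [Real.exp_zero] at this; linarith
  have hR' : (0 : ℝ) ≤ (R : ℝ)⁻¹ := by positivity
  have hi := integrable_exp_neg_mul hR' (μ : Measure ℝ≥0)
  have h1 : 1 - laplace μ (R : ℝ)⁻¹ = ∫ x : ℝ≥0, (1 - Real.exp (-((R : ℝ)⁻¹ * x))) ∂μ := by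
    rw [integral_sub (integrable_const _) hi, laplace]; simp
  rw [le_div_iff₀ he, h1, mul_comm]
  have h2 : (1 - Real.exp (-1)) * (μ : Measure ℝ≥0).real (Ioi R) =
      ∫ x : ℝ≥0, (Ioi R).indicator (fun _ => 1 - Real.exp (-1)) x ∂μ := by
    rw [integral_indicator measurableSet_Ioi, setIntegral_const, smul_eq_mul, mul_comm]
  rw [h2]
  refine integral_mono ((integrable_const _).indicator measurableSet_Ioi)
    ((integrable_const _).sub hi) fun x => ?_
  by_cases hx : x ∈ Ioi R
  · rw [indicator_of_mem hx]
    have hxR : (R : ℝ) < x := by exact_mod_cast hx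
    have hR0 : (0 : ℝ) < R := by exact_mod_cast hR
    have : 1 ≤ (R : ℝ)⁻¹ * x := by
      rw [inv_mul_eq_div, le_div_iff₀ hR0]; linarith
    simp only
    gcongr
  · rw [indicator_of_notMem hx]
    exact one_sub_exp_neg_nonneg (by positivity)

theorem continuous_laplace_apply {s : ℝ} (hs : 0 ≤ s) :
    Continuous fun μ : ProbabilityMeasure ℝ≥0 => laplace μ s := by
  rw [continuous_iff_continuousAt]
  intro μ
  let f : BoundedContinuousFunction ℝ≥0 ℝ := BoundedContinuousFunction.ofNormedAddCommGroup
    (fun x : ℝ≥0 => Real.exp (-(s * x))) (by fun_prop) 1 (fun x => by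
      rw [Real.norm_of_nonneg (Real.exp_nonneg _), Real.exp_le_one_iff, neg_nonpos]
      positivity)
  exact (ProbabilityMeasure.tendsto_iff_forall_integral_tendsto.1 tendsto_id) f

/-- The one-sided stable law. -/
theorem exists_stable {ν : ℝ} (hν0 : 0 < ν) (hν1 : ν < 1) :
    ∃ μ : ProbabilityMeasure ℝ≥0, ∀ s : ℝ, 0 ≤ s → laplace μ s = Real.exp (-s ^ ν) := by
  have hG : 0 < Real.Gamma (1 - ν) := Real.Gamma_pos_of_pos (by linarith)
  choose μ hμ using fun n : ℕ => exists_laplace_eq_one_sub_div_pow hν0 hν1 (n + 1) n.succ_pos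
  set ε : ℕ → ℝ := fun n => (((n + 1 : ℕ) : ℝ) * Real.Gamma (1 - ν)) ^ (-ν⁻¹) with hεdef
  have hε0 : ∀ n, 0 < ε n := fun n => by positivity
  set a : ℕ → ℝ → ℝ := fun n s => ν / Real.Gamma (1 - ν) * ∫ x in Ioi (ε n),
    (1 - Real.exp (-(s * x))) * x ^ (-ν - 1) with hadef
  have hε : Tendsto ε atTop (𝓝 0) := by
    refine (tendsto_rpow_neg_atTop (y := ν⁻¹) (by positivity)).comp ?_
    refine Tendsto.atTop_mul_const hG ?_
    exact tendsto_natCast_atTop_atTop.comp (tendsto_add_atTop_nat 1)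
  have ha0 : ∀ n s, 0 ≤ s → 0 ≤ a n s := fun n s hs => by
    refine mul_nonneg (by positivity) (setIntegral_nonneg measurableSet_Ioi fun x hx => ?_)
    have hx0 : 0 < x := (hε0 n).trans hx
    exact mul_nonneg (one_sub_exp_neg_nonneg (by positivity)) (by positivity)
  have hfull : ∀ s, 0 ≤ s → ν / Real.Gamma (1 - ν) * ∫ x in Ioi (0 : ℝ),
      (1 - Real.exp (-(s * x))) * x ^ (-ν - 1) = s ^ ν := fun s hs => by
    rcases hs.eq_or_lt with rfl | hs
    · simp [Real.zero_rpow hν0.ne']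
    · rw [integral_one_sub_exp_mul_rpow hν0 hν1 hs]; field_simp
  have ha1 : ∀ n s, 0 ≤ s → a n s ≤ s ^ ν := fun n s hs => by
    rw [← hfull s hs]
    refine mul_le_mul_of_nonneg_left ?_ (by positivity)
    refine setIntegral_mono_set (integrableOn_one_sub_exp_mul_rpow hν0 hν1 hs) ?_
      (Ioi_subset_Ioi (hε0 n).le).eventuallyLE
    filter_upwards [ae_restrict_mem measurableSet_Ioi] with x hx
    have hx0 : 0 < x := hx
    exact mul_nonneg (one_sub_exp_neg_nonneg (by positivity)) (by positivity)
  have halim : ∀ s, 0 ≤ s → Tendsto (fun n => a n s) atTop (𝓝 (s ^ ν)) := fun s hs => by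
    rw [← hfull s hs]
    refine Tendsto.const_mul _ ?_
    simp only [← integral_indicator (measurableSet_Ioi)]
    refine tendsto_integral_of_dominated_convergence
      (fun x => ‖(Ioi (0 : ℝ)).indicator
        (fun x => (1 - Real.exp (-(s * x))) * x ^ (-ν - 1)) x‖) (fun n => ?_)
      ((integrableOn_one_sub_exp_mul_rpow hν0 hν1 hs).integrable_indicator
        measurableSet_Ioi).norm (fun n => ?_) ?_
    · exact (Measurable.indicator (by fun_prop) measurableSet_Ioi).aestronglyMeasurable
    · refine Eventually.of_forall fun x => ?_
      refine norm_indicator_le_of_subset (Ioi_subset_Ioi (hε0 n).le) _ _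
    · refine Eventually.of_forall fun x => ?_
      by_cases hx : 0 < x
      · refine tendsto_const_nhds.congr' ?_
        filter_upwards [hε.eventually_lt_const hx] with n hn
        rw [indicator_of_mem (mem_Ioi.2 hx), indicator_of_mem (mem_Ioi.2 hn)]
      · refine tendsto_const_nhds.congr fun n => ?_
        rw [indicator_of_notMem (by simpa using hx), indicator_of_notMem]
        have := hε0 n
        simp only [mem_Ioi, not_lt] at hx ⊢
        linarith
  have hlim : ∀ s, 0 ≤ s → Tendsto (fun n => laplace (μ n) s) atTop (𝓝 (Real.exp (-s ^ ν))) := by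
    intro s hs
    -- The index is shifted because `μ n` is built from `n + 1` summands.
    have h1 : Tendsto (fun n : ℕ => (n : ℝ) * (-(a (n - 1) s) / n)) atTop (𝓝 (-s ^ ν)) := by
      have h2 : Tendsto (fun n => -(a (n - 1) s)) atTop (𝓝 (-s ^ ν)) :=
        ((halim s hs).comp (tendsto_sub_atTop_nat 1)).neg
      refine h2.congr' ?_
      filter_upwards [eventually_gt_atTop 0] with n hn
      have : (n : ℝ) ≠ 0 := by exact_mod_cast hn.ne'
      field_simp
    have h3 := (Real.tendsto_one_add_pow_exp_of_tendsto h1).comp (tendsto_add_atTop_nat 1)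
    refine h3.congr fun n => ?_
    simp only [Function.comp_apply, Nat.add_sub_cancel]
    rw [hμ n s hs]
  -- Bernoulli's inequality, uniformly in `n`; `s ≤ 1` keeps `a n s ≤ 1`, hence the base in its
  -- range of validity.
  have hlow : ∀ n s, 0 ≤ s → s ≤ 1 → 1 - laplace (μ n) s ≤ s ^ ν := fun n s hs hs1 => by
    have h1 := ha1 n s hs
    have hn : (0 : ℝ) < (n + 1 : ℕ) := by positivity
    have h0 := Real.rpow_le_one hs hs1 hν0.le
    have h2 : -2 ≤ -(a n s) / (n + 1 : ℕ) := by
      rw [le_div_iff₀ hn]; push_cast; nlinarith [ha0 n s hs, Nat.cast_nonneg (α := ℝ) n]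
    have h3 := one_add_mul_le_pow h2 (n + 1)
    rw [hμ n s hs]
    have h4 : ((n + 1 : ℕ) : ℝ) * (-(a n s) / (n + 1 : ℕ)) = -(a n s) := by field_simp
    rw [h4] at h3
    linarith
  have htight : IsTightMeasureSet {((m : ProbabilityMeasure ℝ≥0) : Measure ℝ≥0) | m ∈ range μ} := by
    rw [isTightMeasureSet_iff_exists_isCompact_measure_compl_le]
    intro e he
    have h1 : Tendsto (fun R : ℝ => ENNReal.ofReal (R ^ (-ν) / (1 - Real.exp (-1)))) atTop (𝓝 0) := by
      rw [← ENNReal.ofReal_zero]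
      refine ENNReal.tendsto_ofReal ?_
      simpa using (tendsto_rpow_neg_atTop hν0).div_const (1 - Real.exp (-1))
    obtain ⟨R, hR1, hR⟩ := ((eventually_ge_atTop 1).and (h1.eventually_lt_const he)).exists
    refine ⟨Icc 0 R.toNNReal, isCompact_Icc, ?_⟩
    rintro _ ⟨_, ⟨n, rfl⟩, rfl⟩
    have hc : (Icc 0 R.toNNReal)ᶜ = Ioi R.toNNReal := by
      ext x; simp
    have hR0 : 0 < R := by linarith
    have h2 := measure_lt_le_laplace (μ n) (R := R.toNNReal) (by simpa using hR0)
    rw [Real.coe_toNNReal _ hR0.le] at h2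
    have h3 := hlow n R⁻¹ (by positivity) (inv_le_one_of_one_le₀ hR1)
    have he1 : 0 < 1 - Real.exp (-1) := by
      have := Real.exp_lt_exp.2 (show (-1 : ℝ) < 0 by norm_num); rw [Real.exp_zero] at this; linarith
    rw [hc, ← ofReal_measureReal]
    refine le_trans (ENNReal.ofReal_le_ofReal ?_) hR.le
    refine h2.trans ?_
    rw [Real.inv_rpow hR0.le, ← Real.rpow_neg hR0.le] at h3
    gcongr
  have hcomp := isCompact_closure_of_isTightMeasureSet htight
  -- Convergence along an ultrafilter replaces a subsequence: the Laplace transforms converge along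
  -- the full sequence, so their limit is the one along the ultrafilter.
  obtain ⟨m, -, hm⟩ := hcomp.ultrafilter_le_nhds ((hyperfilter ℕ).map μ) (by
    rw [le_principal_iff, Ultrafilter.mem_coe, Ultrafilter.mem_map]
    exact univ_mem' fun n => subset_closure (mem_range_self n))
  refine ⟨m, fun s hs => ?_⟩
  have h1 : Tendsto (fun n => laplace (μ n) s) (hyperfilter ℕ) (𝓝 (laplace m s)) :=
    ((continuous_laplace_apply hs).tendsto m).comp (tendsto_id'.2 hm)
  exact tendsto_nhds_unique h1 ((hlim s hs).mono_left Nat.hyperfilter_le_atTop)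

/-- Tonelli in the form used for fractional moments: a power of `x` is an integral over `s` of
kernels whose `μ`-means are known. The origin must be null because the formula for `A` holds only
for positive `x`. -/
theorem integrable_and_integral_eq_of_nonneg {μ : Measure ℝ≥0} [IsFiniteMeasure μ]
    {k : ℝ → ℝ≥0 → ℝ} {A : ℝ≥0 → ℝ} {B : ℝ → ℝ} (hk : Measurable (Function.uncurry k))
    (h0 : μ {0} = 0) (hk0 : ∀ s, 0 < s → ∀ x, 0 ≤ k s x)
    (hA : ∀ x, 0 < x → ∫ s in Ioi (0 : ℝ), k s x = A x)
    (hBi : ∀ s, 0 < s → Integrable (k s) μ) (hB : ∀ s, 0 < s → ∫ x, k s x ∂μ = B s)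
    (hBI : IntegrableOn B (Ioi 0)) :
    Integrable A μ ∧ ∫ x, A x ∂μ = ∫ s in Ioi (0 : ℝ), B s := by
  have hpos : ∀ᵐ x ∂μ, 0 < x := by
    rw [ae_iff]
    convert h0 using 2
    ext x; simp
  have hint : Integrable (Function.uncurry k) ((volume.restrict (Ioi (0 : ℝ))).prod μ) := by
    rw [integrable_prod_iff hk.aestronglyMeasurable]
    constructor
    · filter_upwards [ae_restrict_mem measurableSet_Ioi] with s hs using hBi s hs
    · refine hBI.congr ?_
      filter_upwards [ae_restrict_mem measurableSet_Ioi] with s hs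
      rw [← hB s hs]
      refine integral_congr_ae (Eventually.of_forall fun x => ?_)
      exact (Real.norm_of_nonneg (hk0 s hs x)).symm
  have hAe : (fun x => ∫ s in Ioi (0 : ℝ), k s x) =ᵐ[μ] A := by
    filter_upwards [hpos] with x hx using hA x hx
  refine ⟨hint.integral_prod_right.congr hAe, ?_⟩
  rw [← integral_congr_ae hAe, ← integral_integral_swap hint]
  exact setIntegral_congr_fun measurableSet_Ioi fun s hs => hB s hs

/-! ### Moments of the stable law -/

section

variable {ν : ℝ} {μ : ProbabilityMeasure ℝ≥0}

theorem measure_zero_of_laplace (hν0 : 0 < ν)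
    (h : ∀ s : ℝ, 0 ≤ s → laplace μ s = Real.exp (-s ^ ν)) : (μ : Measure ℝ≥0) {0} = 0 := by
  have h1 : ∀ s : ℝ, 0 ≤ s → (μ : Measure ℝ≥0).real {0} ≤ Real.exp (-s ^ ν) := fun s hs => by
    rw [← h s hs, laplace, ← integral_indicator_one (measurableSet_singleton 0)]
    refine integral_mono ((integrable_const _).indicator (measurableSet_singleton 0))
      (integrable_exp_neg_mul hs _) fun x => ?_
    by_cases hx : x = 0
    · simp [hx]
    · rw [indicator_of_notMem (by simpa using hx)]; positivity
  have h2 : Tendsto (fun s : ℝ => Real.exp (-s ^ ν)) atTop (𝓝 0) :=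
    Real.tendsto_exp_atBot.comp (tendsto_neg_atTop_atBot.comp (tendsto_rpow_atTop hν0))
  have h3 : (μ : Measure ℝ≥0).real {0} ≤ 0 :=
    ge_of_tendsto h2 ((eventually_ge_atTop 0).mono fun s hs => h1 s hs)
  rw [← measureReal_eq_zero_iff]
  exact le_antisymm h3 measureReal_nonneg

/-- From `Γ(a) x^(-a) = ∫ s^(a-1) exp(-s x) ds`. -/
theorem inverse_moment_of_laplace (hν0 : 0 < ν)
    (h : ∀ s : ℝ, 0 ≤ s → laplace μ s = Real.exp (-s ^ ν)) {a : ℝ} (ha : 0 < a) :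
    Integrable (fun x : ℝ≥0 => (x : ℝ) ^ (-a)) μ ∧
      ∫ x : ℝ≥0, (x : ℝ) ^ (-a) ∂μ = Real.Gamma (a / ν + 1) / Real.Gamma (a + 1) := by
  have hG : 0 < Real.Gamma a := Real.Gamma_pos_of_pos ha
  obtain ⟨h1, h2⟩ := integrable_and_integral_eq_of_nonneg (μ := μ)
    (k := fun s x => s ^ (a - 1) * Real.exp (-(x * s)))
    (A := fun x => Real.Gamma a * (x : ℝ) ^ (-a)) (B := fun s => s ^ (a - 1) * Real.exp (-s ^ ν))
    (by simp only [Function.uncurry_def]; fun_prop) (measure_zero_of_laplace hν0 h)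
    (fun s hs x => by positivity)
    (fun x hx => by
      have hx' : (0 : ℝ) < x := hx
      rw [Real.integral_rpow_mul_exp_neg_mul_Ioi ha hx', mul_comm, one_div,
        Real.inv_rpow hx'.le, Real.rpow_neg hx'.le])
    (fun s hs => by
      simpa only [mul_comm s] using (integrable_exp_neg_mul hs.le (μ : Measure ℝ≥0)).const_mul _)
    (fun s hs => by
      rw [integral_const_mul, ← h s hs.le, laplace]
      simp only [mul_comm s])
    (integrableOn_rpow_mul_exp_neg_rpow (by linarith) hν0)
  have h3 := h1.const_mul (Real.Gamma a)⁻¹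
  have e : ∀ x : ℝ≥0, (Real.Gamma a)⁻¹ * (Real.Gamma a * (x : ℝ) ^ (-a)) = (x : ℝ) ^ (-a) :=
    fun x => by field_simp
  simp only [e] at h3
  refine ⟨h3, ?_⟩
  rw [integral_const_mul, integral_rpow_mul_exp_neg_rpow hν0 (by linarith), sub_add_cancel] at h2
  rw [Real.Gamma_add_one (by positivity), Real.Gamma_add_one ha.ne']
  field_simp at h2 ⊢
  linarith

/-- From `(Γ(1-p)/p) x^p = ∫ (1 - exp(-s x)) s^(-p-1) ds`. The mean of the right side is, by the
substitution `s ↦ s^ν`, an integral of the same kind with `p / ν` for `p`, whence `p < ν`. -/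
theorem moment_of_laplace (hν0 : 0 < ν) (hν1 : ν < 1)
    (h : ∀ s : ℝ, 0 ≤ s → laplace μ s = Real.exp (-s ^ ν)) {p : ℝ} (hp0 : 0 < p) (hp : p < ν) :
    Integrable (fun x : ℝ≥0 => (x : ℝ) ^ p) μ ∧
      ∫ x : ℝ≥0, (x : ℝ) ^ p ∂μ = Real.Gamma (1 - p / ν) / Real.Gamma (1 - p) := by
  have hG : 0 < Real.Gamma (1 - p) := Real.Gamma_pos_of_pos (by linarith)
  have hpν : p / ν < 1 := (div_lt_one hν0).2 hp
  have hB := integrableOn_one_sub_exp_mul_rpow (p := p / ν) (s := 1) (by positivity) hpν zero_le_one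
  have hBI := (integrableOn_Ioi_comp_rpow_iff _ hν0.ne').2 hB
  have hBv := integral_comp_rpow_Ioi
    (fun x : ℝ => (1 - Real.exp (-(1 * x))) * x ^ (-(p / ν) - 1)) hν0.ne'
  rw [integral_one_sub_exp_mul_rpow (by positivity) hpν one_pos] at hBv
  have e1 : ∀ s ∈ Ioi (0 : ℝ), (|ν| * s ^ (ν - 1)) •
      ((1 - Real.exp (-(1 * s ^ ν))) * (s ^ ν) ^ (-(p / ν) - 1)) =
      ν * ((1 - Real.exp (-s ^ ν)) * s ^ (-p - 1)) := fun s hs => by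
    have hs0 : (0 : ℝ) < s := hs
    have : s ^ (-p - 1) = s ^ (ν - 1) * (s ^ ν) ^ (-(p / ν) - 1) := by
      rw [← Real.rpow_mul hs0.le, ← Real.rpow_add hs0]
      congr 1; field_simp; ring
    rw [this, abs_of_pos hν0, one_mul, smul_eq_mul]; ring
  rw [setIntegral_congr_fun measurableSet_Ioi e1, integral_const_mul] at hBv
  have hBI2 : IntegrableOn (fun s : ℝ => (1 - Real.exp (-s ^ ν)) * s ^ (-p - 1)) (Ioi 0) := by
    have := hBI.congr_fun e1 measurableSet_Ioi
    have := this.const_mul ν⁻¹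
    refine this.congr (Eventually.of_forall fun s => ?_)
    simp only; field_simp
  obtain ⟨h1, h2⟩ := integrable_and_integral_eq_of_nonneg (μ := μ)
    (k := fun s x => (1 - Real.exp (-(x * s))) * s ^ (-p - 1))
    (A := fun x => (x : ℝ) ^ p * (Real.Gamma (1 - p) / p))
    (B := fun s => (1 - Real.exp (-s ^ ν)) * s ^ (-p - 1))
    (by simp only [Function.uncurry_def]; fun_prop) (measure_zero_of_laplace hν0 h)
    (fun s hs x => mul_nonneg (one_sub_exp_neg_nonneg (by positivity)) (by positivity))
    (fun x hx => integral_one_sub_exp_mul_rpow hp0 (by linarith) (by exact_mod_cast hx))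
    (fun s hs => by
      simpa only [mul_comm s, Pi.sub_apply] using ((integrable_const (1 : ℝ)).sub
        (integrable_exp_neg_mul hs.le (μ : Measure ℝ≥0))).mul_const _)
    (fun s hs => by
      have := integrable_exp_neg_mul hs.le (μ : Measure ℝ≥0)
      rw [integral_mul_const, ← h s hs.le, laplace]
      simp only [mul_comm s] at this ⊢
      rw [integral_sub (integrable_const _) this]
      simp) hBI2
  have h3 := h1.mul_const (Real.Gamma (1 - p) / p)⁻¹
  have e : ∀ x : ℝ≥0, (x : ℝ) ^ p * (Real.Gamma (1 - p) / p) * (Real.Gamma (1 - p) / p)⁻¹ =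
      (x : ℝ) ^ p := fun x => by field_simp
  simp only [e] at h3
  refine ⟨h3, ?_⟩
  rw [integral_mul_const] at h2
  rw [← h2, Real.one_rpow] at hBv
  field_simp at hBv ⊢
  linarith

end

/-! ### The Mittag-Leffler law -/

/-- The Mittag-Leffler law: `τ` is a law on `(0, ∞)` with moments `Γ(q + 1) / Γ(ν q + 1)`. -/
structure IsMittagLefflerLaw (ν : ℝ) (τ : Measure ℝ) : Prop where
  ae_pos : ∀ᵐ u ∂τ, 0 < u
  moment : ∀ n : ℕ, Integrable (fun u => u ^ n) τ ∧
    ∫ u, u ^ n ∂τ = n.factorial / Real.Gamma (ν * n + 1)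
  neg_moment : ∀ q : ℝ, -1 < q → q < 0 → Integrable (fun u => u ^ q) τ ∧
    ∫ u, u ^ q ∂τ = Real.Gamma (q + 1) / Real.Gamma (ν * q + 1)

/-- For `ν < 1` this is the law of `S^(-ν)` with `S` stable: its positive moments are inverse
moments of `S`, its negative ones are moments of `S` of order below `ν`. For `ν = 1` it degenerates
to the point mass at `1`. -/
theorem exists_isMittagLefflerLaw {ν : ℝ} (hν0 : 0 < ν) (hν1 : ν ≤ 1) :
    ∃ τ : ProbabilityMeasure ℝ, IsMittagLefflerLaw ν τ ∧
      (ν = 1 → (τ : Measure ℝ) = Measure.dirac 1) := by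
  rcases hν1.eq_or_lt with rfl | hν1
  · refine ⟨⟨Measure.dirac 1, inferInstance⟩, ⟨?_, fun n => ⟨?_, ?_⟩, fun q hq1 hq => ⟨?_, ?_⟩⟩,
      fun _ => rfl⟩
    · simp [ae_dirac_eq]
    · exact integrable_dirac (by simp)
    · have : (n.factorial : ℝ) ≠ 0 := by positivity
      simp [Real.Gamma_nat_eq_factorial, this]
    · exact integrable_dirac (by simp)
    · have : Real.Gamma (q + 1) ≠ 0 := (Real.Gamma_pos_of_pos (by linarith)).ne'
      simp [this]
  · obtain ⟨μ, hμ⟩ := exists_stable hν0 hν1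
    have hpos : ∀ᵐ x ∂(μ : Measure ℝ≥0), 0 < x := by
      rw [ae_iff]
      convert measure_zero_of_laplace hν0 hμ using 2
      ext x; simp
    have hm : Measurable fun x : ℝ≥0 => (x : ℝ) ^ (-ν) := by fun_prop
    refine ⟨μ.map hm.aemeasurable, ⟨?_, fun n => ?_, fun q hq1 hq => ?_⟩, fun h => absurd h hν1.ne⟩
    · change ∀ᵐ u ∂((μ : Measure ℝ≥0).map _), 0 < u
      rw [ae_map_iff hm.aemeasurable measurableSet_Ioi]
      filter_upwards [hpos] with x hx
      exact Real.rpow_pos_of_pos hx _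
    · change Integrable _ ((μ : Measure ℝ≥0).map _) ∧ ∫ _, _ ∂((μ : Measure ℝ≥0).map _) = _
      rw [integrable_map_measure (by fun_prop) hm.aemeasurable,
        integral_map hm.aemeasurable (by fun_prop)]
      rcases n.eq_zero_or_pos with rfl | hn
      · simp [Function.comp_def]
      · have hn' : (0 : ℝ) < n := by exact_mod_cast hn
        obtain ⟨h1, h2⟩ := inverse_moment_of_laplace hν0 hμ (a := ν * n) (by positivity)
        have e : ∀ x : ℝ≥0, ((x : ℝ) ^ (-ν)) ^ n = (x : ℝ) ^ (-(ν * n)) := fun x => by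
          rw [← Real.rpow_natCast, ← Real.rpow_mul x.coe_nonneg]; congr 1; ring
        simp only [Function.comp_def, e]
        refine ⟨h1, h2.trans ?_⟩
        rw [mul_div_cancel_left₀ _ hν0.ne', Real.Gamma_nat_eq_factorial]
    · change Integrable _ ((μ : Measure ℝ≥0).map _) ∧ ∫ _, _ ∂((μ : Measure ℝ≥0).map _) = _
      rw [integrable_map_measure (by fun_prop) hm.aemeasurable,
        integral_map hm.aemeasurable (by fun_prop)]
      obtain ⟨h1, h2⟩ := moment_of_laplace hν0 hν1 hμ (p := -(ν * q)) (by nlinarith) (by nlinarith)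
      have e : ∀ x : ℝ≥0, ((x : ℝ) ^ (-ν)) ^ q = (x : ℝ) ^ (-(ν * q)) := fun x => by
        rw [← Real.rpow_mul x.coe_nonneg]; congr 1; ring
      simp only [Function.comp_def, e]
      refine ⟨h1, h2.trans ?_⟩
      rw [neg_div, mul_div_cancel_left₀ _ hν0.ne']
      congr 2 <;> ring

/-! ### The Wright function as an integral along a ray -/

/-- Analytic functions on a vertical strip which agree near a real point agree. -/
theorem eqOn_of_eventually_eq_ofReal {f g : ℂ → ℂ} {I : Set ℝ} (hI : Convex ℝ I)
    (hf : AnalyticOnNhd ℂ f {z | z.re ∈ I}) (hg : AnalyticOnNhd ℂ g {z | z.re ∈ I}) {t : ℝ}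
    (ht : t ∈ I) (h : ∀ᶠ x : ℝ in 𝓝 t, f x = g x) : EqOn f g {z | z.re ∈ I} := by
  refine AnalyticOnNhd.eqOn_of_preconnected_of_frequently_eq hf hg
    (hI.linear_preimage Complex.reLm).isPreconnected (z₀ := (t : ℂ)) (by simpa using ht) ?_
  have h_real : ∃ᶠ x : ℝ in 𝓝[≠] t, f x = g x :=
    (h.filter_mono nhdsWithin_le_nhds).frequently
  rw [frequently_iff_seq_forall] at h_real ⊢
  obtain ⟨xs, hx_tendsto, hx_eq⟩ := h_real
  refine ⟨fun n => xs n, ?_, fun n => hx_eq n⟩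
  rw [tendsto_nhdsWithin_iff] at hx_tendsto ⊢
  refine ⟨?_, by simpa using hx_tendsto.2⟩
  exact (Complex.continuous_ofReal.tendsto t).comp hx_tendsto.1

/-- The Gamma integral along a ray. -/
theorem integral_rpow_mul_exp_ray {b R θ : ℝ} (hb : 0 < b) (hR : 0 < R) (hθ : |θ| < Real.pi / 2) :
    ∫ t in Ioi (0 : ℝ), ((t ^ (b - 1) : ℝ) : ℂ) * Complex.exp (-(R * Complex.exp (θ * Complex.I) * t)) =
      ((Real.Gamma b * R ^ (-b) : ℝ) : ℂ) * Complex.exp (-(θ * b * Complex.I)) := by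
  have hcos : 0 < Real.cos θ := Real.cos_pos_of_mem_Ioo (abs_lt.1 hθ)
  have hre : 0 < (R * Complex.exp (θ * Complex.I)).re := by
    rw [Complex.re_ofReal_mul, Complex.exp_ofReal_mul_I_re]; positivity
  -- The integral is the complex moment generating function of `t^(b-1) dt`, analytic for `Re z <
  -- 0`. It equals `Γ(b) (-z)^(-b)` on the negative reals, hence on the whole half-plane.
  set μ : Measure ℝ := (volume.restrict (Ioi (0 : ℝ))).withDensity
    (fun t => ENNReal.ofReal (t ^ (b - 1))) with hμ
  have hm : Measurable fun t : ℝ => ENNReal.ofReal (t ^ (b - 1)) := by fun_prop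
  have hsub : Iio (0 : ℝ) ⊆ integrableExpSet id μ := fun s hs => by
    have hs0 : 0 < -s := neg_pos.2 hs
    change Integrable _ μ
    rw [hμ, integrable_withDensity_iff_integrable_smul' hm
      (Eventually.of_forall fun _ => ENNReal.ofReal_lt_top)]
    refine (integrableOn_rpow_mul_exp_neg_mul hb hs0).congr_fun (fun t ht => ?_) measurableSet_Ioi
    have ht0 : (0 : ℝ) < t := ht
    simp only [id, smul_eq_mul]
    rw [ENNReal.toReal_ofReal (by positivity)]
    congr 2; ring
  have hval : ∀ z : ℂ, complexMGF id μ z =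
      ∫ t in Ioi (0 : ℝ), ((t ^ (b - 1) : ℝ) : ℂ) * Complex.exp (z * t) := fun z => by
    rw [complexMGF, hμ, integral_withDensity_eq_integral_toReal_smul hm
      (Eventually.of_forall fun _ => ENNReal.ofReal_lt_top)]
    refine setIntegral_congr_fun measurableSet_Ioi fun t ht => ?_
    have ht0 : (0 : ℝ) < t := ht
    simp only [id]
    rw [ENNReal.toReal_ofReal (by positivity), Complex.real_smul]
  have han : AnalyticOnNhd ℂ (complexMGF id μ) {z | z.re ∈ Iio (0 : ℝ)} :=
    analyticOnNhd_complexMGF.mono fun z hz =>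
      interior_maximal hsub isOpen_Iio hz
  have han2 : AnalyticOnNhd ℂ (fun z : ℂ => Real.Gamma b * (-z) ^ (-b : ℂ))
      {z | z.re ∈ Iio (0 : ℝ)} := fun z hz => by
    refine analyticAt_const.mul (analyticAt_id.neg.cpow analyticAt_const ?_)
    refine Or.inl ?_
    have : z.re < 0 := hz
    simpa using this
  have hEq := eqOn_of_eventually_eq_ofReal (convex_Iio 0) han han2 (t := -1) (by simp) (by
    filter_upwards [Iio_mem_nhds (show (-1 : ℝ) < 0 by norm_num)] with x hx
    have hx0 : 0 < -x := neg_pos.2 hx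
    have h1 := Real.integral_rpow_mul_exp_neg_mul_Ioi hb hx0
    rw [hval, ← Complex.ofReal_neg, ← Complex.ofReal_neg, ← Complex.ofReal_cpow hx0.le,
      ← Complex.ofReal_mul, Real.rpow_neg hx0.le, ← Real.inv_rpow hx0.le, ← one_div, mul_comm, ← h1,
      ← integral_complex_ofReal]
    refine setIntegral_congr_fun measurableSet_Ioi fun t _ => ?_
    push_cast
    congr 2; ring)
  have hz : (-(R * Complex.exp (θ * Complex.I)) : ℂ) ∈ {z : ℂ | z.re ∈ Iio (0 : ℝ)} := by
    simpa using hre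
  have h : complexMGF id μ (-(R * Complex.exp (θ * Complex.I))) =
    Real.Gamma b * (- -(R * Complex.exp (θ * Complex.I))) ^ (-b : ℂ) := hEq hz
  have hpow : (R * Complex.exp (θ * Complex.I)) ^ (-b : ℂ) =
      ((R ^ (-b) : ℝ) : ℂ) * Complex.exp (-(θ * b * Complex.I)) := by
    have e1 : R * Complex.exp (θ * Complex.I) =
        Complex.exp (((Real.log R : ℝ) : ℂ) + θ * Complex.I) := by
      rw [Complex.exp_add, ← Complex.ofReal_exp, Real.exp_log hR]
    have hπ := Real.pi_pos
    rw [e1, Complex.cpow_def_of_ne_zero (Complex.exp_ne_zero _), Complex.log_exp,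
      Real.rpow_def_of_pos hR, Complex.ofReal_exp, ← Complex.exp_add]
    · congr 1; push_cast; ring
    · simp; linarith [(abs_lt.1 hθ).1]
    · simp; linarith [(abs_lt.1 hθ).2]
  rw [neg_neg, hpow, hval] at h
  rw [Complex.ofReal_mul, mul_assoc, ← h]
  refine setIntegral_congr_fun measurableSet_Ioi fun t _ => ?_
  rw [neg_mul]

/-- The integrand of the representation of the Wright function as an integral along a ray. -/
def rayIntegrand (ν φ u r : ℝ) : ℂ :=
  Complex.exp ((ν * φ : ℝ) * Complex.I) * ((r ^ (ν - 1) : ℝ) : ℂ) *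
    Complex.exp (r * Complex.exp (φ * Complex.I) -
      u * ((r ^ ν : ℝ) : ℂ) * Complex.exp ((ν * φ : ℝ) * Complex.I))

theorem norm_rayIntegrand {ν φ u r : ℝ} (hr : 0 < r) :
    ‖rayIntegrand ν φ u r‖ = r ^ (ν - 1) *
      Real.exp (r * Real.cos φ - u * r ^ ν * Real.cos (ν * φ)) := by
  rw [rayIntegrand, norm_mul, norm_mul, Complex.norm_exp_ofReal_mul_I, one_mul, Complex.norm_real,
    Real.norm_of_nonneg (by positivity), Complex.norm_exp]
  congr 2
  rw [Complex.sub_re, Complex.re_ofReal_mul, Complex.exp_ofReal_mul_I_re, ← Complex.ofReal_mul,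
    Complex.re_ofReal_mul, Complex.exp_ofReal_mul_I_re]

theorem measurable_rayIntegrand (ν φ : ℝ) :
    Measurable (Function.uncurry (rayIntegrand ν φ)) := by
  simp only [Function.uncurry_def, rayIntegrand]
  fun_prop

theorem exists_mul_rpow_le {ν : ℝ} (hν0 : 0 < ν) (hν1 : ν < 1) {u c : ℝ} (hu : 0 ≤ u) (hc : 0 < c) :
    ∃ C : ℝ, ∀ r : ℝ, 0 < r → u * r ^ ν ≤ c * r + C := by
  -- `R` is the point at which `u r^ν = c r`; beyond it the linear term dominates.
  set R : ℝ := (u / c) ^ (1 - ν)⁻¹ with hR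
  have hR0 : 0 ≤ R := by positivity
  have hRp : R ^ (1 - ν) = u / c := by
    rw [hR, ← Real.rpow_mul (by positivity), inv_mul_cancel₀ (by linarith), Real.rpow_one]
  refine ⟨u * R ^ ν, fun r hr => ?_⟩
  rcases le_or_gt r R with h | h
  · have h1 : r ^ ν ≤ R ^ ν := Real.rpow_le_rpow hr.le h hν0.le
    have := mul_le_mul_of_nonneg_left h1 hu
    nlinarith [mul_pos hc hr]
  · have h1 : R ^ (1 - ν) ≤ r ^ (1 - ν) := Real.rpow_le_rpow hR0 h.le (by linarith)
    rw [hRp, div_le_iff₀ hc] at h1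
    have h2 : u * r ^ ν ≤ r ^ (1 - ν) * c * r ^ ν :=
      mul_le_mul_of_nonneg_right h1 (by positivity)
    have h3 : r ^ (1 - ν) * c * r ^ ν = c * r := by
      rw [mul_right_comm, ← Real.rpow_add hr, sub_add_cancel, Real.rpow_one, mul_comm]
    have : 0 ≤ u * R ^ ν := by positivity
    linarith

/-- Euler's reflection formula in a form that survives at integers `b`, where both sides are zero.
-/
theorem Gamma_mul_sin_div_pi {b : ℝ} (hb : 0 < b) :
    Real.Gamma b * Real.sin (Real.pi * b) / Real.pi = (Real.Gamma (1 - b))⁻¹ := by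
  have hG := Real.Gamma_pos_of_pos hb
  have h := Real.Gamma_mul_Gamma_one_sub b
  have hπ := Real.pi_pos
  rcases eq_or_ne (Real.sin (Real.pi * b)) 0 with h0 | h0
  · rw [h0, div_zero] at h
    have : Real.Gamma (1 - b) = 0 := (mul_eq_zero.1 h).resolve_left hG.ne'
    rw [h0, this]; simp
  · have h1 : Real.Gamma (1 - b) ≠ 0 := by
      intro h1
      rw [h1, mul_zero] at h
      exact (div_ne_zero hπ.ne' h0) h.symm
    rw [eq_div_iff h0] at h
    rw [← one_div, div_eq_div_iff hπ.ne' h1]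
    linarith

section

variable {ν φ : ℝ}

/-- Writing `exp(iφ) = -exp(i(φ - π))` with `|φ - π| < π/2` gives a Gamma integral along a ray. The
result does not depend on `φ`. -/
theorem integral_ray_term (hφ0 : Real.pi / 2 < φ) (hφ1 : φ < Real.pi) {b : ℝ} (hb : 0 < b) :
    ∫ r in Ioi (0 : ℝ), Complex.exp ((b * φ : ℝ) * Complex.I) * (((r ^ (b - 1) : ℝ) : ℂ) *
      Complex.exp (r * Complex.exp (φ * Complex.I))) =
      Real.Gamma b * Complex.exp ((Real.pi * b : ℝ) * Complex.I) := by
  have h := integral_rpow_mul_exp_ray (R := 1) (θ := φ - Real.pi) hb one_pos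
    (by rw [abs_lt]; constructor <;> linarith)
  rw [integral_const_mul]
  have e : ∀ t : ℝ, -(((1 : ℝ) : ℂ) * Complex.exp (((φ - Real.pi : ℝ) : ℂ) * Complex.I) * t) =
      t * Complex.exp (φ * Complex.I) := fun t => by
    have : Complex.exp (((φ - Real.pi : ℝ) : ℂ) * Complex.I) = -Complex.exp (φ * Complex.I) := by
      rw [Complex.ofReal_sub, sub_mul, Complex.exp_sub, Complex.exp_pi_mul_I, div_neg, div_one]
    rw [this]; push_cast; ring
  simp only [e] at h
  rw [h, Real.one_rpow, mul_one, mul_left_comm, ← Complex.exp_add]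
  congr 2; push_cast; ring

theorem cos_neg_of_ray (hφ0 : Real.pi / 2 < φ) (hφ1 : φ < Real.pi) : Real.cos φ < 0 :=
  Real.cos_neg_of_pi_div_two_lt_of_lt hφ0 (by linarith [Real.pi_pos])

theorem integrableOn_ray_bound (hν0 : 0 < ν) (hν1 : ν < 1) (hφ0 : Real.pi / 2 < φ)
    (hφ1 : φ < Real.pi) {u : ℝ} (hu : 0 ≤ u) :
    IntegrableOn (fun r : ℝ => r ^ (ν - 1) * Real.exp (r * Real.cos φ) * Real.exp (u * r ^ ν))
      (Ioi 0) := by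
  have hc := cos_neg_of_ray hφ0 hφ1
  obtain ⟨C, hC⟩ := exists_mul_rpow_le hν0 hν1 hu (c := -Real.cos φ / 2) (by linarith)
  have h1 := (integrableOn_rpow_mul_exp_neg_mul hν0 (s := -Real.cos φ / 2) (by linarith)).const_mul
    (Real.exp C)
  refine Integrable.mono' h1 (by fun_prop) ?_
  filter_upwards [ae_restrict_mem measurableSet_Ioi] with r hr
  have hr0 : (0 : ℝ) < r := hr
  rw [Real.norm_of_nonneg (by positivity), mul_left_comm, ← Real.exp_add, mul_assoc, ← Real.exp_add]
  refine mul_le_mul_of_nonneg_left (Real.exp_le_exp.2 ?_) (by positivity)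
  have := hC r hr0
  linarith

/-- The factor containing `u` is expanded and integrated term by term. Since `cos φ < 0` and `ν <
1`, the decay `exp(r cos φ)` absorbs `exp(|u| r^ν)`, so all real `u` are allowed. -/
theorem hasSum_integral_ray (hν0 : 0 < ν) (hν1 : ν < 1) (hφ0 : Real.pi / 2 < φ)
    (hφ1 : φ < Real.pi) (u : ℝ) :
    HasSum (fun k : ℕ => ((-u) ^ k / k.factorial : ℂ) * (Real.Gamma (ν * (k + 1)) *
      Complex.exp ((Real.pi * (ν * (k + 1)) : ℝ) * Complex.I)))
      (∫ r in Ioi (0 : ℝ), rayIntegrand ν φ u r) := by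
  have h := hasSum_integral_of_dominated_convergence (μ := volume.restrict (Ioi (0 : ℝ)))
    (F := fun (k : ℕ) (r : ℝ) => ((-u) ^ k / k.factorial : ℂ) *
      (Complex.exp ((ν * (k + 1) * φ : ℝ) * Complex.I) * (((r ^ (ν * (k + 1) - 1) : ℝ) : ℂ) *
      Complex.exp (r * Complex.exp (φ * Complex.I)))))
    (f := rayIntegrand ν φ u)
    (fun k r => r ^ (ν - 1) * Real.exp (r * Real.cos φ) * ((|u| * r ^ ν) ^ k / k.factorial))
    (fun k => by fun_prop) (fun k => ?_) (Eventually.of_forall fun r => ?_) ?_ ?_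
  · refine h.congr_fun fun k => ?_
    rw [integral_const_mul, integral_ray_term hφ0 hφ1 (by positivity)]
  · filter_upwards [ae_restrict_mem measurableSet_Ioi] with r hr
    have hr0 : (0 : ℝ) < r := hr
    have e : r ^ (ν * ((k : ℝ) + 1) - 1) = r ^ (ν - 1) * (r ^ ν) ^ k := by
      rw [← Real.rpow_natCast, ← Real.rpow_mul hr0.le, ← Real.rpow_add hr0]
      congr 1; ring
    rw [norm_mul, norm_mul, norm_mul, Complex.norm_exp_ofReal_mul_I, one_mul, Complex.norm_real,
      Real.norm_of_nonneg (by positivity), Complex.norm_exp, Complex.re_ofReal_mul,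
      Complex.exp_ofReal_mul_I_re, norm_div, norm_pow, norm_neg, Complex.norm_real, e, mul_pow,
      Complex.norm_natCast, Real.norm_eq_abs]
    apply le_of_eq; ring
  · exact (Real.summable_pow_div_factorial _).mul_left _
  · have h1 := integrableOn_ray_bound hν0 hν1 hφ0 hφ1 (abs_nonneg u)
    refine h1.congr (Eventually.of_forall fun r => ?_)
    simp only
    rw [tsum_mul_left, Real.exp_eq_exp_ℝ, NormedSpace.exp_eq_tsum_div]
  · filter_upwards [ae_restrict_mem measurableSet_Ioi] with r hr
    have hr0 : (0 : ℝ) < r := hr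
    set w : ℂ := Complex.exp ((ν * φ : ℝ) * Complex.I) with hw
    have h2 := (NormedSpace.expSeries_div_hasSum_exp (𝔸 := ℂ)
      (-(u * ((r ^ ν : ℝ) : ℂ) * w))).mul_left
      (w * ((r ^ (ν - 1) : ℝ) : ℂ) * Complex.exp (r * Complex.exp (φ * Complex.I)))
    rw [← Complex.exp_eq_exp_ℂ] at h2
    have e0 : rayIntegrand ν φ u r = w * ((r ^ (ν - 1) : ℝ) : ℂ) *
        Complex.exp (r * Complex.exp (φ * Complex.I)) *
        Complex.exp (-(u * ((r ^ ν : ℝ) : ℂ) * w)) := by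
      rw [rayIntegrand, ← hw, sub_eq_add_neg (r * Complex.exp _ : ℂ), Complex.exp_add]; ring
    rw [e0]
    refine h2.congr_fun fun k => ?_
    have e : r ^ (ν * ((k : ℝ) + 1) - 1) = r ^ (ν - 1) * (r ^ ν) ^ k := by
      rw [← Real.rpow_natCast, ← Real.rpow_mul hr0.le, ← Real.rpow_add hr0]
      congr 1; ring
    have ew : Complex.exp ((ν * (k + 1) * φ : ℝ) * Complex.I) = w * w ^ k := by
      rw [hw, ← Complex.exp_nat_mul, ← Complex.exp_add]
      congr 1; push_cast; ring
    rw [e, ew]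
    push_cast
    ring

/-- The function `M(u) = W(-u; -ν, 1 - ν)`. -/
def wrightM (ν u : ℝ) : ℝ := wright (-u) (-ν) (1 - ν)

/-- The Hankel contour integral of `σ^(ν-1) exp(σ - u σ^ν) / (2πi)`, folded onto its upper ray `σ =
r exp(iφ)`: the lower ray contributes the conjugate, leaving the imaginary part. Termwise, the
reflection formula converts `Γ(b) sin(πb)` into `1 / Γ(1-b)`. -/
theorem wrightM_eq_integral (hν0 : 0 < ν) (hν1 : ν < 1) (hφ0 : Real.pi / 2 < φ)
    (hφ1 : φ < Real.pi) (u : ℝ) :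
    wrightM ν u = (∫ r in Ioi (0 : ℝ), rayIntegrand ν φ u r).im / Real.pi := by
  have h := (Complex.hasSum_im (hasSum_integral_ray hν0 hν1 hφ0 hφ1 u)).div_const Real.pi
  rw [← h.tsum_eq, wrightM, wright]
  congr 1; ext k
  have e : ((-u) ^ k / k.factorial : ℂ) * (Real.Gamma (ν * (k + 1)) *
      Complex.exp ((Real.pi * (ν * (k + 1)) : ℝ) * Complex.I)) =
      (((-u) ^ k / k.factorial * Real.Gamma (ν * (k + 1)) : ℝ) : ℂ) *
      Complex.exp ((Real.pi * (ν * (k + 1)) : ℝ) * Complex.I) := by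
    push_cast; ring
  have h2 := Gamma_mul_sin_div_pi (b := ν * ((k : ℝ) + 1)) (by positivity)
  rw [e, Complex.im_ofReal_mul, Complex.exp_ofReal_mul_I_im, mul_assoc, mul_div_assoc, h2,
    show 1 - ν * ((k : ℝ) + 1) = -ν * k + (1 - ν) by ring]
  rw [div_mul_eq_div_div, div_eq_mul_inv (_ / _) (Real.Gamma _)]

end

/-- Such an angle makes both `exp(r exp(iφ))` and, for `u > 0`, `exp(-u r^ν exp(iνφ))` decay; there
is room for it because `ν < 1`. -/
theorem exists_ray_angle {ν : ℝ} (hν0 : 0 < ν) (hν1 : ν < 1) :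
    ∃ φ : ℝ, Real.pi / 2 < φ ∧ φ < Real.pi ∧ ν * φ < Real.pi / 2 := by
  have hπ := Real.pi_pos
  have h : Real.pi / 2 < min Real.pi (Real.pi / 2 / ν) :=
    lt_min (by linarith) (by rw [lt_div_iff₀ hν0]; nlinarith)
  obtain ⟨φ, h1, h2⟩ := exists_between h
  refine ⟨φ, h1, h2.trans_le (min_le_left _ _), ?_⟩
  have := h2.trans_le (min_le_right _ _)
  rw [lt_div_iff₀ hν0] at this
  linarith

theorem cos_pos_of_ray {ν φ : ℝ} (hν0 : 0 < ν) (hφ0 : Real.pi / 2 < φ)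
    (hφ2 : ν * φ < Real.pi / 2) : 0 < Real.cos (ν * φ) := by
  have hπ := Real.pi_pos
  have : 0 < ν * φ := mul_pos hν0 (by linarith)
  exact Real.cos_pos_of_mem_Ioo ⟨by linarith, hφ2⟩

section

variable {ν : ℝ}

theorem measurable_wrightM (hν0 : 0 < ν) (hν1 : ν < 1) : Measurable (wrightM ν) := by
  obtain ⟨φ, hφ0, hφ1, -⟩ := exists_ray_angle hν0 hν1
  have h : StronglyMeasurable fun u => ∫ r in Ioi (0 : ℝ), rayIntegrand ν φ u r :=
    (measurable_rayIntegrand ν φ).stronglyMeasurable.integral_prod_right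
  have h2 : wrightM ν = fun u => (∫ r in Ioi (0 : ℝ), rayIntegrand ν φ u r).im / Real.pi := by
    ext u; exact wrightM_eq_integral hν0 hν1 hφ0 hφ1 u
  rw [h2]
  exact (Complex.measurable_im.comp h.measurable).div_const _

theorem continuousOn_wrightM (hν0 : 0 < ν) (hν1 : ν < 1) : ContinuousOn (wrightM ν) (Ici 0) := by
  obtain ⟨φ, hφ0, hφ1, hφ2⟩ := exists_ray_angle hν0 hν1
  have hd := cos_pos_of_ray hν0 hφ0 hφ2
  have h2 : wrightM ν = fun u => (∫ r in Ioi (0 : ℝ), rayIntegrand ν φ u r).im / Real.pi := by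
    ext u; exact wrightM_eq_integral hν0 hν1 hφ0 hφ1 u
  rw [h2]
  refine (Complex.continuous_im.comp_continuousOn ?_).div_const _
  refine continuousOn_of_dominated (bound := fun r => r ^ (ν - 1) * Real.exp (-(-Real.cos φ * r)))
    (fun u _ => ?_) (fun u hu => ?_)
    (integrableOn_rpow_mul_exp_neg_mul hν0 (by linarith [cos_neg_of_ray hφ0 hφ1])) ?_
  · exact ((measurable_rayIntegrand ν φ).comp measurable_prodMk_left).aestronglyMeasurable
  · filter_upwards [ae_restrict_mem measurableSet_Ioi] with r hr
    have hr0 : (0 : ℝ) < r := hr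
    have hu0 : 0 ≤ u := hu
    rw [norm_rayIntegrand hr0]
    refine mul_le_mul_of_nonneg_left (Real.exp_le_exp.2 ?_) (by positivity)
    have : 0 ≤ u * r ^ ν * Real.cos (ν * φ) := by positivity
    linarith
  · refine Eventually.of_forall fun r => Continuous.continuousOn ?_
    unfold rayIntegrand
    fun_prop

/-- The factor `exp(r cos φ) ≤ 1` is discarded, and what remains is integrated exactly. -/
theorem exists_abs_wrightM_le (hν0 : 0 < ν) (hν1 : ν < 1) :
    ∃ C : ℝ, ∀ u : ℝ, 0 < u → |wrightM ν u| ≤ C / u := by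
  obtain ⟨φ, hφ0, hφ1, hφ2⟩ := exists_ray_angle hν0 hν1
  have hd := cos_pos_of_ray hν0 hφ0 hφ2
  have hc := cos_neg_of_ray hφ0 hφ1
  have hπ := Real.pi_pos
  refine ⟨(Real.cos (ν * φ))⁻¹ * (1 / ν) / Real.pi, fun u hu => ?_⟩
  rw [wrightM_eq_integral hν0 hν1 hφ0 hφ1, abs_div, abs_of_pos hπ, div_div, mul_comm Real.pi,
    ← div_div]
  gcongr
  have hb : 0 < u * Real.cos (ν * φ) := by positivity
  have h1 := integral_rpow_mul_exp_neg_mul_rpow hν0 (q := ν - 1) (by linarith) hb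
  have h2 := integrableOn_rpow_mul_exp_neg_mul_rpow (s := ν - 1) (by linarith) hν0 hb
  have e : (Real.cos (ν * φ))⁻¹ * (1 / ν) / u = ∫ r in Ioi (0 : ℝ), r ^ (ν - 1) *
      Real.exp (-(u * Real.cos (ν * φ)) * r ^ ν) := by
    rw [h1, sub_add_cancel, neg_div, div_self hν0.ne', Real.Gamma_one, Real.rpow_neg_one]
    field_simp
  rw [e]
  refine (Complex.abs_im_le_norm _).trans (norm_integral_le_of_norm_le h2 ?_)
  filter_upwards [ae_restrict_mem measurableSet_Ioi] with r hr
  have hr0 : (0 : ℝ) < r := hr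
  rw [norm_rayIntegrand hr0]
  refine mul_le_mul_of_nonneg_left (Real.exp_le_exp.2 ?_) (by positivity)
  nlinarith [mul_neg_of_pos_of_neg hr0 hc]

/-- Fubini in `u` and `r`. The `u`-integral is a Gamma integral along a ray and leaves another one
in `r`, of order `ν(1-z)`; the reflection formula finishes. Convergence needs `z > 0` for the first
and `z < 1` for the second. -/
theorem mellin_wrightM (hν0 : 0 < ν) (hν1 : ν < 1) {z : ℝ} (hz0 : 0 < z) (hz1 : z < 1) :
    IntegrableOn (fun u => u ^ (z - 1) * wrightM ν u) (Ioi 0) ∧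
      ∫ u in Ioi (0 : ℝ), u ^ (z - 1) * wrightM ν u =
        Real.Gamma z / Real.Gamma (ν * (z - 1) + 1) := by
  obtain ⟨φ, hφ0, hφ1, hφ2⟩ := exists_ray_angle hν0 hν1
  have hd := cos_pos_of_ray hν0 hφ0 hφ2
  have hc := cos_neg_of_ray hφ0 hφ1
  have hπ := Real.pi_pos
  have hb : 0 < ν * (1 - z) := mul_pos hν0 (by linarith)
  set d := Real.cos (ν * φ) with hddef
  set F : ℝ → ℝ → ℂ := fun u r => ((u ^ (z - 1) : ℝ) : ℂ) * rayIntegrand ν φ u r with hF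
  have hFm : Measurable (Function.uncurry F) := by
    have := measurable_rayIntegrand ν φ
    simp only [Function.uncurry_def, hF] at this ⊢
    fun_prop
  have hnorm : ∀ u r : ℝ, 0 < u → 0 < r → ‖F u r‖ =
      r ^ (ν - 1) * Real.exp (r * Real.cos φ) * (u ^ (z - 1) * Real.exp (-(r ^ ν * d * u))) := by
    intro u r hu hr
    rw [hF]
    simp only
    rw [norm_mul, norm_rayIntegrand hr, Complex.norm_real, Real.norm_of_nonneg (by positivity),
      sub_eq_add_neg (r * Real.cos φ), Real.exp_add, show u * r ^ ν * d = r ^ ν * d * u by ring]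
    ring
  have hint : Integrable (Function.uncurry F)
      ((volume.restrict (Ioi (0 : ℝ))).prod (volume.restrict (Ioi (0 : ℝ)))) := by
    rw [integrable_prod_iff' hFm.aestronglyMeasurable]
    constructor
    · filter_upwards [ae_restrict_mem measurableSet_Ioi] with r hr
      have hr0 : (0 : ℝ) < r := hr
      have h1 := (integrableOn_rpow_mul_exp_neg_mul hz0 (s := r ^ ν * d) (by positivity)).const_mul
        (r ^ (ν - 1) * Real.exp (r * Real.cos φ))
      refine Integrable.mono' h1 (hFm.comp measurable_prodMk_right).aestronglyMeasurable ?_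
      filter_upwards [ae_restrict_mem measurableSet_Ioi] with u hu
      exact (hnorm u r hu hr).le
    · have h1 := (integrableOn_rpow_mul_exp_neg_mul hb (s := -Real.cos φ) (by linarith)).const_mul
        (d ^ (-z) * Real.Gamma z)
      refine h1.congr ?_
      filter_upwards [ae_restrict_mem measurableSet_Ioi] with r hr
      have hr0 : (0 : ℝ) < r := hr
      have h2 := Real.integral_rpow_mul_exp_neg_mul_Ioi hz0 (r := r ^ ν * d) (by positivity)
      have h3 : ∫ u in Ioi (0 : ℝ), ‖Function.uncurry F (u, r)‖ =
          ∫ u in Ioi (0 : ℝ), r ^ (ν - 1) * Real.exp (r * Real.cos φ) *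
            (u ^ (z - 1) * Real.exp (-(r ^ ν * d * u))) :=
        setIntegral_congr_fun measurableSet_Ioi fun u hu => hnorm u r hu hr
      rw [h3, integral_const_mul, h2, one_div, Real.inv_rpow (by positivity),
        Real.mul_rpow (by positivity) hd.le, mul_inv, ← Real.rpow_neg hd.le,
        ← Real.rpow_mul hr0.le, ← Real.rpow_neg hr0.le,
        show ν * (1 - z) - 1 = (ν - 1) + -(ν * z) by ring, Real.rpow_add hr0,
        show -(-Real.cos φ * r) = r * Real.cos φ by ring]
      ring
  have hinner : ∀ r ∈ Ioi (0 : ℝ), ∫ u in Ioi (0 : ℝ), F u r = (Real.Gamma z : ℂ) *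
      (Complex.exp ((ν * (1 - z) * φ : ℝ) * Complex.I) * (((r ^ (ν * (1 - z) - 1) : ℝ) : ℂ) *
      Complex.exp (r * Complex.exp (φ * Complex.I)))) := by
    intro r hr
    have hr0 : (0 : ℝ) < r := hr
    have hθ : |ν * φ| < Real.pi / 2 := by
      rw [abs_of_pos (mul_pos hν0 (by linarith))]; exact hφ2
    have h1 := integral_rpow_mul_exp_ray (R := r ^ ν) (θ := ν * φ) hz0 (by positivity) hθ
    have e : ∀ u : ℝ, F u r = Complex.exp ((ν * φ : ℝ) * Complex.I) * ((r ^ (ν - 1) : ℝ) : ℂ) *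
        Complex.exp (r * Complex.exp (φ * Complex.I)) * (((u ^ (z - 1) : ℝ) : ℂ) *
        Complex.exp (-(((r ^ ν : ℝ) : ℂ) * Complex.exp ((ν * φ : ℝ) * Complex.I) * u))) := by
      intro u
      rw [hF]
      simp only [rayIntegrand]
      rw [sub_eq_add_neg (r * Complex.exp _ : ℂ), Complex.exp_add,
        show (u : ℂ) * ((r ^ ν : ℝ) : ℂ) * Complex.exp ((ν * φ : ℝ) * Complex.I) =
          ((r ^ ν : ℝ) : ℂ) * Complex.exp ((ν * φ : ℝ) * Complex.I) * u by ring]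
      ring
    have e2 : Complex.exp ((ν * (1 - z) * φ : ℝ) * Complex.I) =
        Complex.exp ((ν * φ : ℝ) * Complex.I) * Complex.exp (-((ν * φ : ℝ) * z * Complex.I)) := by
      rw [← Complex.exp_add]; congr 1; push_cast; ring
    have e3 : r ^ (ν * (1 - z) - 1) = r ^ (ν - 1) * (r ^ ν) ^ (-z) := by
      rw [← Real.rpow_mul hr0.le, ← Real.rpow_add hr0]; congr 1; ring
    simp only [e]
    rw [integral_const_mul, h1, e2, e3]
    push_cast
    ring
  have hswap := integral_integral_swap hint
  rw [setIntegral_congr_fun measurableSet_Ioi hinner, integral_const_mul,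
    integral_ray_term hφ0 hφ1 hb] at hswap
  have hleft := hint.integral_prod_left
  have eN : ∀ u : ℝ, u ^ (z - 1) * wrightM ν u =
      (∫ r in Ioi (0 : ℝ), F u r).im / Real.pi := fun u => by
    rw [hF]
    simp only
    rw [integral_const_mul, Complex.im_ofReal_mul, wrightM_eq_integral hν0 hν1 hφ0 hφ1]
    ring
  simp only [eN]
  refine ⟨hleft.im.div_const _, ?_⟩
  have him : ∫ u in Ioi (0 : ℝ), (∫ r in Ioi (0 : ℝ), F u r).im =
      (∫ u in Ioi (0 : ℝ), ∫ r in Ioi (0 : ℝ), F u r).im :=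
    integral_im hleft
  rw [integral_div, him, hswap, Complex.im_ofReal_mul, Complex.im_ofReal_mul,
    Complex.exp_ofReal_mul_I_im, mul_div_assoc, Gamma_mul_sin_div_pi hb, div_eq_mul_inv]
  congr 3; ring

end

/-! ### Identification of a density by its Mellin transform -/

/-- Finite measures with the same finite moment generating function near `0` agree. -/
theorem ext_of_mgf_eq_near_zero {A B : Measure ℝ} [IsFiniteMeasure A] [IsFiniteMeasure B] {ε : ℝ}
    (hε : 0 < ε) (hA : ∀ t, |t| < ε → Integrable (fun x => Real.exp (t * x)) A)
    (hB : ∀ t, |t| < ε → Integrable (fun x => Real.exp (t * x)) B)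
    (h : ∀ t, |t| < ε → ∫ x, Real.exp (t * x) ∂A = ∫ x, Real.exp (t * x) ∂B) : A = B := by
  have hI : ∀ t, t ∈ Ioo (-ε) ε ↔ |t| < ε := fun t => abs_lt.symm
  have han : ∀ (M : Measure ℝ), (∀ t, |t| < ε → Integrable (fun x => Real.exp (t * x)) M) →
      AnalyticOnNhd ℂ (complexMGF id M) {z | z.re ∈ Ioo (-ε) ε} := fun M hM =>
    analyticOnNhd_complexMGF.mono fun z hz =>
      interior_maximal (fun t ht => hM t ((hI t).1 ht)) isOpen_Ioo hz
  -- Analytic continuation from the real interval reaches the imaginary axis, where the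
  -- characteristic functions live.
  have key := eqOn_of_eventually_eq_ofReal (convex_Ioo (-ε) ε) (han A hA) (han B hB) (t := 0)
    (by simp [hε]) (by
      filter_upwards [Ioo_mem_nhds (neg_lt_zero.2 hε) hε] with t ht
      rw [complexMGF_ofReal, complexMGF_ofReal]
      exact congrArg _ (h t ((hI t).1 ht)))
  refine Measure.ext_of_charFun (funext fun t => ?_)
  rw [← complexMGF_id_mul_I, ← complexMGF_id_mul_I]
  exact key (by simp [hε])

/-- The logarithm turns Mellin transforms into moment generating functions. Since `ENNReal.ofReal`
discards negative values, only the positive part of `f` appears. -/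
theorem integrable_exp_map_log_withDensity {ρ : Measure ℝ} (hρ : ∀ᵐ u ∂ρ, 0 < u) {f : ℝ → ℝ}
    (hf : Measurable f) {t : ℝ} (hi : Integrable (fun u => u ^ t * f u) ρ) :
    Integrable (fun x => Real.exp (t * x))
      ((ρ.withDensity fun u => ENNReal.ofReal (f u)).map Real.log) ∧
    ∫ x, Real.exp (t * x) ∂((ρ.withDensity fun u => ENNReal.ofReal (f u)).map Real.log) =
      ∫ u, max (u ^ t * f u) 0 ∂ρ := by
  have hlt : ∀ᵐ u ∂ρ, ENNReal.ofReal (f u) < ∞ := Eventually.of_forall fun _ => ENNReal.ofReal_lt_top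
  have e : ∀ᵐ u ∂ρ, max (u ^ t * f u) 0 =
      (ENNReal.ofReal (f u)).toReal • Real.exp (t * Real.log u) := by
    filter_upwards [hρ] with u hu
    rw [ENNReal.toReal_ofReal', smul_eq_mul, Real.rpow_def_of_pos hu, max_mul_of_nonneg _ _
      (Real.exp_nonneg _), zero_mul, mul_comm (f u), mul_comm t]
  rw [integrable_map_measure (by fun_prop) (by fun_prop), integral_map (by fun_prop) (by fun_prop),
    integrable_withDensity_iff_integrable_smul' hf.ennreal_ofReal hlt,
    integral_withDensity_eq_integral_toReal_smul hf.ennreal_ofReal hlt]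
  exact ⟨hi.pos_part.congr e, (integral_congr_ae e).symm⟩

theorem map_log_injective {A B : Measure ℝ} (hA : ∀ᵐ u ∂A, 0 < u) (hB : ∀ᵐ u ∂B, 0 < u)
    (h : A.map Real.log = B.map Real.log) : A = B := by
  have key : ∀ M : Measure ℝ, (∀ᵐ u ∂M, 0 < u) → (M.map Real.log).map Real.exp = M := fun M hM => by
    rw [Measure.map_map (by fun_prop) (by fun_prop)]
    conv_rhs => rw [← Measure.map_id (μ := M)]
    refine Measure.map_congr ?_
    filter_upwards [hM] with u hu
    simp [Real.exp_log hu]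
  rw [← key A hA, ← key B hB, h]

/-- A measure on the half-line and a density with the same Mellin transform. -/
theorem eq_withDensity_of_mellin_eq {τ : Measure ℝ} [IsFiniteMeasure τ] (hτ : ∀ᵐ u ∂τ, 0 < u)
    {N : ℝ → ℝ} (hN : Measurable N)
    (hNi : ∀ z : ℝ, 0 < z → z < 1 → IntegrableOn (fun u => u ^ (z - 1) * N u) (Ioi 0))
    (hτi : ∀ z : ℝ, 0 < z → z < 1 → Integrable (fun u => u ^ (z - 1)) τ)
    (h : ∀ z : ℝ, 0 < z → z < 1 → ∫ u in Ioi (0 : ℝ), u ^ (z - 1) * N u = ∫ u, u ^ (z - 1) ∂τ) :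
    (∀ᵐ u ∂(volume.restrict (Ioi (0 : ℝ))), 0 ≤ N u) ∧
      τ = (volume.restrict (Ioi (0 : ℝ))).withDensity fun u => ENNReal.ofReal (N u) := by
  set l : Measure ℝ := volume.restrict (Ioi (0 : ℝ)) with hl
  have hlpos : ∀ᵐ u ∂l, 0 < u := ae_restrict_mem measurableSet_Ioi
  -- The weight `u^(-1/2)` moves the centre `1/2` of the strip `0 < z < 1` to `0`, giving finite
  -- measures with exponential moments for `|t| < 1/2`.
  set f : ℝ → ℝ := fun u => u ^ (-(1 / 2) : ℝ) * N u with hf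
  have hfm : Measurable f := by fun_prop
  have hnm : Measurable fun u => -f u := hfm.neg
  have hgm : Measurable fun u : ℝ => u ^ (-(1 / 2) : ℝ) := by fun_prop
  have hshift : ∀ t : ℝ, ∀ u : ℝ, 0 < u → u ^ t * u ^ (-(1 / 2) : ℝ) = u ^ (t + 1 / 2 - 1) :=
    fun t u hu => by rw [← Real.rpow_add hu]; congr 1; ring
  have hfi : ∀ t : ℝ, |t| < 1 / 2 → Integrable (fun u => u ^ t * f u) l := fun t ht => by
    rw [abs_lt] at ht
    refine (hNi (t + 1 / 2) (by linarith) (by linarith)).congr ?_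
    filter_upwards [hlpos] with u hu
    rw [hf, ← mul_assoc, hshift t u hu]
  have hgi : ∀ t : ℝ, |t| < 1 / 2 → Integrable (fun u => u ^ t * u ^ (-(1 / 2) : ℝ)) τ :=
    fun t ht => by
      rw [abs_lt] at ht
      refine (hτi (t + 1 / 2) (by linarith) (by linarith)).congr ?_
      filter_upwards [hτ] with u hu
      rw [hshift t u hu]
  have hnfi : ∀ t : ℝ, |t| < 1 / 2 → Integrable (fun u => u ^ t * -f u) l := fun t ht => by
    exact (hfi t ht).neg.congr (Eventually.of_forall fun u => by simp)
  have h00 : |(0 : ℝ)| < 1 / 2 := by norm_num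
  set A : Measure ℝ := l.withDensity fun u => ENNReal.ofReal (f u) with hA
  set B₁ : Measure ℝ := l.withDensity fun u => ENNReal.ofReal (-f u) with hB₁
  set B₂ : Measure ℝ := τ.withDensity fun u => ENNReal.ofReal (u ^ (-(1 / 2) : ℝ)) with hB₂
  have : IsFiniteMeasure A := isFiniteMeasure_withDensity_ofReal (by
    simpa using (hfi 0 h00).hasFiniteIntegral)
  have : IsFiniteMeasure B₁ := isFiniteMeasure_withDensity_ofReal (by
    simpa using (hnfi 0 h00).hasFiniteIntegral)
  have : IsFiniteMeasure B₂ := isFiniteMeasure_withDensity_ofReal (by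
    simpa using (hgi 0 h00).hasFiniteIntegral)
  have hApos : ∀ᵐ u ∂A, 0 < u := (withDensity_absolutelyContinuous _ _).ae_le hlpos
  have hB₁pos : ∀ᵐ u ∂B₁, 0 < u := (withDensity_absolutelyContinuous _ _).ae_le hlpos
  have hB₂pos : ∀ᵐ u ∂B₂, 0 < u := (withDensity_absolutelyContinuous _ _).ae_le hτ
  -- The sign of `N` is not known in advance, so its negative part is carried to the side of `τ` and
  -- two positive measures are compared.
  have hAB : A = B₁ + B₂ := by
    refine map_log_injective hApos (by rw [ae_add_measure_iff]; exact ⟨hB₁pos, hB₂pos⟩) ?_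
    rw [Measure.map_add _ _ Real.measurable_log]
    refine ext_of_mgf_eq_near_zero (ε := 1 / 2) (by norm_num)
      (fun t ht => (integrable_exp_map_log_withDensity hlpos hfm (hfi t ht)).1)
      (fun t ht => ((integrable_exp_map_log_withDensity hlpos hnm (hnfi t ht)).1).add_measure
        (integrable_exp_map_log_withDensity hτ hgm (hgi t ht)).1) fun t ht => ?_
    obtain ⟨-, a2⟩ := integrable_exp_map_log_withDensity hlpos hfm (hfi t ht)
    obtain ⟨b1, b2⟩ := integrable_exp_map_log_withDensity hlpos hnm (hnfi t ht)
    obtain ⟨c1, c2⟩ := integrable_exp_map_log_withDensity hτ hgm (hgi t ht)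
    refine a2.trans (Eq.trans ?_ (integral_add_measure b1 c1).symm)
    refine Eq.trans ?_ (congrArg₂ (· + ·) b2 c2).symm
    rw [← sub_eq_iff_eq_add', ← integral_sub (hfi t ht).pos_part (hnfi t ht).pos_part]
    have e1 : ∀ u, max (u ^ t * f u) 0 - max (u ^ t * -f u) 0 = u ^ t * f u := fun u => by
      rw [mul_neg, max_zero_sub_max_neg_zero_eq_self]
    have ht' := abs_lt.1 ht
    have hz := h (t + 1 / 2) (by linarith) (by linarith)
    calc ∫ u, (max (u ^ t * f u) 0 - max (u ^ t * -f u) 0) ∂l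
        = ∫ u, u ^ (t + 1 / 2 - 1) * N u ∂l := by
          refine integral_congr_ae ?_
          filter_upwards [hlpos] with u hu
          rw [e1, hf, ← mul_assoc, hshift t u hu]
      _ = ∫ u, u ^ (t + 1 / 2 - 1) ∂τ := hz
      _ = ∫ u, max (u ^ t * u ^ (-(1 / 2) : ℝ)) 0 ∂τ := by
          refine integral_congr_ae ?_
          filter_upwards [hτ] with u hu
          rw [hshift t u hu, max_eq_left (by positivity)]
  -- `A` does not charge the set where `N < 0`, so neither does `B₁`, which lives there; hence `N ≥
  -- 0` almost everywhere.
  have hB₁S : B₁ {u | N u < 0} = 0 := by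
    have h1 : A {u | N u < 0} = 0 := by
      rw [hA, withDensity_apply_eq_zero' hfm.ennreal_ofReal.aemeasurable]
      refine measure_mono_null ?_ (ae_iff.1 hlpos)
      rintro u ⟨h1, h2⟩ hu
      refine h1 (ENNReal.ofReal_eq_zero.2 ?_)
      exact mul_nonpos_of_nonneg_of_nonpos (Real.rpow_nonneg hu.le _) (le_of_lt h2)
    rw [hAB, Measure.add_apply, add_eq_zero] at h1
    exact h1.1
  have hNnn : ∀ᵐ u ∂l, 0 ≤ N u := by
    rw [hB₁, withDensity_apply_eq_zero' hnm.ennreal_ofReal.aemeasurable] at hB₁S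
    filter_upwards [measure_eq_zero_iff_ae_notMem.1 hB₁S, hlpos] with u hu hu0
    by_contra hneg
    push Not at hneg
    refine hu ⟨?_, hneg⟩
    simp only [ne_eq, ENNReal.ofReal_eq_zero, not_le, mem_ofPred_eq]
    exact neg_pos.2 (mul_neg_of_pos_of_neg (Real.rpow_pos_of_pos hu0 _) hneg)
  have hB₁0 : B₁ = 0 := by
    rw [hB₁, withDensity_congr_ae (g := 0), withDensity_zero]
    filter_upwards [hNnn, hlpos] with u hu hu0
    refine ENNReal.ofReal_eq_zero.2 (neg_nonpos.2 ?_)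
    exact mul_nonneg (Real.rpow_nonneg hu0.le _) hu
  rw [hB₁0, zero_add] at hAB
  refine ⟨hNnn, ?_⟩
  have hsm : Measurable fun u : ℝ => ENNReal.ofReal (u ^ (1 / 2 : ℝ)) := by fun_prop
  have hcancel : ∀ u : ℝ, 0 < u → u ^ (-(1 / 2) : ℝ) * u ^ (1 / 2 : ℝ) = 1 := fun u hu => by
    rw [← Real.rpow_add hu]; simp
  have e1 : τ = B₂.withDensity fun u => ENNReal.ofReal (u ^ (1 / 2 : ℝ)) := by
    rw [hB₂, ← withDensity_mul _ hgm.ennreal_ofReal hsm]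
    conv_lhs => rw [← withDensity_one (μ := τ)]
    refine withDensity_congr_ae ?_
    filter_upwards [hτ] with u hu
    rw [Pi.mul_apply, ← ENNReal.ofReal_mul (by positivity), hcancel u hu]
    simp
  have e2 : (l.withDensity fun u => ENNReal.ofReal (N u)) =
      A.withDensity fun u => ENNReal.ofReal (u ^ (1 / 2 : ℝ)) := by
    rw [hA, ← withDensity_mul _ hfm.ennreal_ofReal hsm]
    refine withDensity_congr_ae ?_
    filter_upwards [hlpos] with u hu
    rw [Pi.mul_apply, ← ENNReal.ofReal_mul' (by positivity), hf]
    simp only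
    rw [mul_right_comm, hcancel u hu, one_mul]
  rw [e2, hAB, ← e1]

theorem IsMittagLefflerLaw.eq_withDensity {ν : ℝ} (hν0 : 0 < ν) (hν1 : ν < 1) {τ : Measure ℝ}
    [IsFiniteMeasure τ] (h : IsMittagLefflerLaw ν τ) :
    (∀ u, 0 ≤ u → 0 ≤ wrightM ν u) ∧
      τ = (volume.restrict (Ioi (0 : ℝ))).withDensity fun u => ENNReal.ofReal (wrightM ν u) := by
  have hm : ∀ z : ℝ, 0 < z → z < 1 → Integrable (fun u => u ^ (z - 1)) τ ∧
      ∫ u, u ^ (z - 1) ∂τ = Real.Gamma z / Real.Gamma (ν * (z - 1) + 1) := fun z hz0 hz1 => by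
    simpa using h.neg_moment (z - 1) (by linarith) (by linarith)
  obtain ⟨h1, h2⟩ := eq_withDensity_of_mellin_eq h.ae_pos (measurable_wrightM hν0 hν1)
    (fun z hz0 hz1 => (mellin_wrightM hν0 hν1 hz0 hz1).1) (fun z hz0 hz1 => (hm z hz0 hz1).1)
    (fun z hz0 hz1 => by rw [(mellin_wrightM hν0 hν1 hz0 hz1).2, (hm z hz0 hz1).2])
  refine ⟨?_, h2⟩
  have hc := continuousOn_wrightM hν0 hν1
  -- Continuity upgrades almost everywhere to everywhere: a negative value would persist on an open
  -- set of positive measure.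
  have hpos : ∀ u, 0 < u → 0 ≤ wrightM ν u := by
    intro u hu
    by_contra hneg
    push Not at hneg
    have hopen : IsOpen (Ioi (0 : ℝ) ∩ wrightM ν ⁻¹' Iio 0) :=
      (hc.mono Ioi_subset_Ici_self).isOpen_inter_preimage isOpen_Ioi isOpen_Iio
    have hpos := hopen.measure_pos volume ⟨u, hu, hneg⟩
    refine hpos.ne' ?_
    rw [ae_restrict_iff' measurableSet_Ioi, ae_iff] at h1
    refine measure_mono_null (fun v hv => ?_) h1
    simpa using hv
  intro u hu
  rcases hu.eq_or_lt with rfl | hu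
  · have h3 : Tendsto (wrightM ν) (𝓝[>] 0) (𝓝 (wrightM ν 0)) :=
      (hc 0 self_mem_Ici).mono_left (nhdsWithin_mono _ Ioi_subset_Ici_self)
    refine ge_of_tendsto h3 ?_
    filter_upwards [self_mem_nhdsWithin] with v hv using hpos v hv
  · exact hpos u hu

/-! ### Symmetrization, folding and dilation -/

/-- The symmetrization of a law on the half-line. -/
def symmetrize (τ : Measure ℝ) : Measure ℝ := (2 : ℝ≥0∞)⁻¹ • (τ + τ.map (fun u => -u))

instance (τ : Measure ℝ) [IsProbabilityMeasure τ] : IsProbabilityMeasure (symmetrize τ) := by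
  have : IsProbabilityMeasure (τ.map fun u => -u) :=
    Measure.isProbabilityMeasure_map (by fun_prop)
  refine ⟨?_⟩
  rw [symmetrize, Measure.smul_apply, Measure.add_apply, measure_univ, measure_univ, smul_eq_mul,
    one_add_one_eq_two, ENNReal.inv_mul_cancel two_ne_zero ENNReal.ofNat_ne_top]

theorem charFun_symmetrize (τ : Measure ℝ) [IsProbabilityMeasure τ] (y : ℝ) :
    charFun (symmetrize τ) y = ((∫ u, Real.cos (y * u) ∂τ : ℝ) : ℂ) := by
  have hi : ∀ (M : Measure ℝ) [IsFiniteMeasure M], ∀ y : ℝ,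
      Integrable (fun u : ℝ => Complex.exp (y * u * Complex.I)) M := fun M _ y =>
    Integrable.of_bound (C := 1) (by fun_prop) (Eventually.of_forall fun u => by
      rw [← Complex.ofReal_mul, Complex.norm_exp_ofReal_mul_I])
  have : IsProbabilityMeasure (τ.map fun u => -u) :=
    Measure.isProbabilityMeasure_map (by fun_prop)
  rw [charFun_apply_real, symmetrize, integral_smul_measure, integral_add_measure (hi _ y) (hi _ y),
    integral_map (by fun_prop) (by fun_prop), ← integral_add (hi _ y) ?_, ← integral_complex_ofReal,
    ← integral_smul]
  · refine integral_congr_ae (Eventually.of_forall fun u => ?_)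
    simp only
    rw [Complex.real_smul, Complex.ofReal_cos, Complex.cos]
    simp only [ENNReal.toReal_inv, ENNReal.toReal_ofNat]
    push_cast
    rw [div_eq_inv_mul]
    congr 3
    ring_nf
  · have := hi τ (-y)
    refine this.congr (Eventually.of_forall fun u => ?_)
    simp only
    congr 2; push_cast; ring

/-- The factorials in the moments cancel those of the power series. The exponents `e n` are left
free to cover both the cosine and the exponential. -/
theorem IsMittagLefflerLaw.hasSum_integral {ν : ℝ} {τ : Measure ℝ} (h : IsMittagLefflerLaw ν τ)
    {c : ℕ → ℝ} {e : ℕ → ℕ} {g : ℝ → ℝ}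
    (hg : ∀ u : ℝ, HasSum (fun n => c n * (u ^ e n / (e n).factorial)) (g u))
    (hs : Summable fun n => |c n| / Real.Gamma (ν * e n + 1)) :
    HasSum (fun n => c n / Real.Gamma (ν * e n + 1)) (∫ u, g u ∂τ) := by
  have hfac : ∀ n, ((e n).factorial : ℝ) ≠ 0 := fun n => by positivity
  have hint : ∀ n, ∫ u, u ^ e n / (e n).factorial ∂τ = (Real.Gamma (ν * e n + 1))⁻¹ := fun n => by
    rw [integral_div, (h.moment (e n)).2, div_div, div_mul_eq_div_div_swap, div_self (hfac n),
      one_div]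
  have hint2 : ∀ n, ∫ u, ‖u ^ e n / (e n).factorial‖ ∂τ = (Real.Gamma (ν * e n + 1))⁻¹ := fun n => by
    rw [← hint n]
    refine integral_congr_ae ?_
    filter_upwards [h.ae_pos] with u hu
    exact Real.norm_of_nonneg (by positivity)
  have key := hasSum_integral_of_summable_integral_norm (μ := τ)
    (F := fun n u => c n * (u ^ e n / (e n).factorial))
    (fun n => ((h.moment (e n)).1.div_const _).const_mul _) (by
      refine hs.congr fun n => ?_
      simp only [norm_mul, integral_const_mul, hint2, Real.norm_eq_abs (c n)]
      rw [div_eq_mul_inv])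
  have e2 : (fun u => ∑' n, c n * (u ^ e n / (e n).factorial)) = g := funext fun u => (hg u).tsum_eq
  simp only [e2] at key
  refine key.congr_fun fun n => ?_
  rw [integral_const_mul, hint, div_eq_mul_inv]

theorem IsMittagLefflerLaw.hasMittagLefflerCharFun {ν : ℝ} (hν : 0 < ν) {τ : Measure ℝ}
    [IsProbabilityMeasure τ] (h : IsMittagLefflerLaw ν τ) :
    HasMittagLefflerCharFun (2 * ν) (symmetrize τ) := by
  intro y
  rw [charFun_symmetrize]
  have key := h.hasSum_integral (c := fun n => (-(y ^ 2)) ^ n) (e := fun n => 2 * n)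
    (g := fun u => Real.cos (y * u)) (fun u => by
      refine (Real.hasSum_cos (y * u)).congr_fun fun n => ?_
      rw [mul_pow, pow_mul y, neg_pow (y ^ 2)]; ring) (by
      refine (summable_pow_div_Gamma (ν := 2 * ν) (y := y ^ 2) (by positivity)
        (by positivity)).congr fun n => ?_
      rw [abs_pow, abs_neg, abs_of_nonneg (sq_nonneg y)]
      push_cast; congr 3; ring)
  refine (Complex.hasSum_ofReal.2 key).congr_fun fun n => ?_
  congr 2
  push_cast; congr 2; ring

theorem IsMittagLefflerLaw.hasSum_laplace {ν : ℝ} (hν : 0 < ν) {τ : Measure ℝ}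
    (h : IsMittagLefflerLaw ν τ) {s : ℝ} (hs : 0 ≤ s) :
    HasSum (fun n : ℕ => (-s) ^ n / Real.Gamma (ν * n + 1)) (∫ u, Real.exp (-(s * u)) ∂τ) := by
  refine h.hasSum_integral (c := fun n => (-s) ^ n) (e := fun n => n) (fun u => ?_) ?_
  · have := NormedSpace.expSeries_div_hasSum_exp (𝔸 := ℝ) (-(s * u))
    rw [← Real.exp_eq_exp_ℝ] at this
    refine this.congr_fun fun n => ?_
    rw [neg_mul_eq_neg_mul, mul_pow]; ring
  · refine (summable_pow_div_Gamma hν hs).congr fun n => ?_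
    rw [abs_pow, abs_neg, abs_of_nonneg hs]

theorem map_mul_symmetrize (τ : Measure ℝ) (c : ℝ) :
    (symmetrize τ).map (fun u => c * u) = symmetrize (τ.map fun u => c * u) := by
  rw [symmetrize, symmetrize, Measure.map_smul, Measure.map_add _ _ (by fun_prop),
    Measure.map_map (by fun_prop) (by fun_prop), Measure.map_map (by fun_prop) (by fun_prop)]
  congr 3
  ext u; simp

/-- Strict positivity matters: an atom at `0` would be counted twice. -/
theorem fold_symmetrize {τ : Measure ℝ} (h : ∀ᵐ u ∂τ, 0 < u) : fold (symmetrize τ) = τ := by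
  have h1 : τ.restrict (Ici 0) = τ :=
    Measure.restrict_eq_self_of_ae_mem (by filter_upwards [h] with u hu using hu.le)
  have h2 : (τ.map fun u => -u).restrict (Ici 0) = 0 := by
    rw [Measure.restrict_eq_zero, Measure.map_apply (by fun_prop) measurableSet_Ici]
    refine measure_mono_null (fun u hu => ?_) (ae_iff.1 h)
    simpa using hu
  rw [fold, symmetrize, Measure.restrict_smul, Measure.restrict_add, h1, h2, add_zero, smul_smul,
    ENNReal.mul_inv_cancel two_ne_zero ENNReal.ofNat_ne_top, one_smul]

theorem symmetrize_withDensity {g : ℝ → ℝ} (hg : Measurable g) :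
    symmetrize ((volume.restrict (Ioi (0 : ℝ))).withDensity fun u => ENNReal.ofReal (g u)) =
      volume.withDensity fun u => ENNReal.ofReal (g |u| / 2) := by
  have hm : Measurable fun u => ENNReal.ofReal (g u) := hg.ennreal_ofReal
  have hneg : (((volume.restrict (Ioi (0 : ℝ))).withDensity fun u => ENNReal.ofReal (g u)).map
      fun u => -u) = (volume.restrict (Iio (0 : ℝ))).withDensity fun u => ENNReal.ofReal (g (-u)) := by
    ext S hS
    rw [Measure.map_apply (by fun_prop) hS, withDensity_apply _ (hS.preimage (by fun_prop)),
      withDensity_apply _ hS, Measure.restrict_restrict (hS.preimage (by fun_prop)),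
      Measure.restrict_restrict hS]
    have := (Measure.measurePreserving_neg (volume : Measure ℝ)).setLIntegral_comp_preimage
      (hS.inter (measurableSet_Iio (a := (0 : ℝ)))) (f := fun u => ENNReal.ofReal (g (-u))) (by fun_prop)
    rw [← this]
    simp only [neg_neg]
    congr 2
    ext u; simp
  have hhalf : ∀ x : ℝ, ENNReal.ofReal (x / 2) = (2 : ℝ≥0∞)⁻¹ * ENNReal.ofReal x := fun x => by
    rw [div_eq_inv_mul, ENNReal.ofReal_mul (by norm_num), ENNReal.ofReal_inv_of_pos (by norm_num)]
    simp
  have hpos : ((volume.restrict (Ioi (0 : ℝ))).withDensity fun u => ENNReal.ofReal (g u)) =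
      (volume.restrict (Ioi (0 : ℝ))).withDensity fun u => ENNReal.ofReal (g |u|) := by
    refine withDensity_congr_ae ?_
    filter_upwards [ae_restrict_mem measurableSet_Ioi] with u hu
    rw [abs_of_pos hu]
  have hneg2 : ((volume.restrict (Iio (0 : ℝ))).withDensity fun u => ENNReal.ofReal (g (-u))) =
      (volume.restrict (Iio (0 : ℝ))).withDensity fun u => ENNReal.ofReal (g |u|) := by
    refine withDensity_congr_ae ?_
    filter_upwards [ae_restrict_mem measurableSet_Iio] with u hu
    rw [abs_of_neg hu]
  have hvol : volume.restrict (Ioi (0 : ℝ)) + volume.restrict (Iio (0 : ℝ)) = volume := by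
    rw [← Measure.restrict_union (by
      rw [Set.disjoint_left]; intro u h1 h2; exact lt_asymm (mem_Ioi.1 h1) h2) measurableSet_Iio]
    conv_rhs => rw [← Measure.restrict_univ (μ := (volume : Measure ℝ))]
    refine Measure.restrict_congr_set ?_
    have : (Ioi 0 ∪ Iio 0 : Set ℝ) = {0}ᶜ := by
      ext u; simp
    rw [this]
    exact ae_eq_univ.2 (by simp)
  have ha : Measurable fun u => ENNReal.ofReal (g |u|) := by fun_prop
  rw [symmetrize, hneg, hpos, hneg2, ← withDensity_add_measure, hvol]
  simp only [hhalf]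
  exact (withDensity_smul _ ha).symm

theorem map_mul_withDensity {g : ℝ → ℝ} (hg : Measurable g) {c : ℝ} (hc : 0 < c) :
    ((volume.restrict (Ioi (0 : ℝ))).withDensity fun u => ENNReal.ofReal (g u)).map
      (fun u => c * u) =
      (volume.restrict (Ioi (0 : ℝ))).withDensity fun u => ENNReal.ofReal (1 / c * g (u / c)) := by
  ext S hS
  have hmc : Measurable fun u : ℝ => c * u := by fun_prop
  rw [Measure.map_apply hmc hS, withDensity_apply _ (hS.preimage hmc),
    withDensity_apply _ hS, Measure.restrict_restrict (hS.preimage hmc),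
    Measure.restrict_restrict hS]
  have hvol := Real.smul_map_volume_mul_left hc.ne'
  conv_rhs => rw [← hvol]
  rw [Measure.restrict_smul, lintegral_smul_measure, Measure.restrict_map hmc
    (hS.inter measurableSet_Ioi), lintegral_map (by fun_prop) hmc, smul_eq_mul,
    ← lintegral_const_mul _ (by fun_prop)]
  have e : (fun u => c * u) ⁻¹' (S ∩ Ioi 0) = (fun u => c * u) ⁻¹' S ∩ Ioi 0 := by
    ext u; simp [hc]
  rw [e]
  refine lintegral_congr fun u => ?_
  rw [abs_of_pos hc, ← ENNReal.ofReal_mul hc.le, mul_div_cancel_left₀ _ hc.ne']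
  congr 1
  field_simp

/-! ### Gaussian mixtures -/

theorem charFun_brownianLaw {s : ℝ} (hs : 0 ≤ s) (y : ℝ) :
    charFun (brownianLaw s) y = ((Real.exp (-(s * y ^ 2)) : ℝ) : ℂ) := by
  rw [brownianLaw, charFun_gaussianReal, Real.coe_toNNReal _ (by positivity)]
  push_cast
  congr 1; ring

/-- Scaling one standard Gaussian realizes the mixture as the law of `√(2S) Z` with `S` and `Z`
independent. -/
theorem brownianLaw_eq_map (s : ℝ) :
    brownianLaw s = (gaussianReal 0 1).map (fun z => √(2 * s) * z) := by
  rw [gaussianReal_map_const_mul, brownianLaw]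
  congr 1
  · simp
  · ext
    simp only [Real.coe_toNNReal', mul_one, NNReal.coe_mk]
    exact Real.sq_sqrt'.symm

/-- A law is the mixture of the laws of Brownian motion as soon as this holds for the
characteristic functions. -/
theorem eq_lintegral_brownianLaw {m F : Measure ℝ} [IsProbabilityMeasure m] [IsProbabilityMeasure F]
    (hF : ∀ᵐ s ∂F, 0 < s)
    (h : ∀ y : ℝ, charFun m y = ((∫ s, Real.exp (-(s * y ^ 2)) ∂F : ℝ) : ℂ)) (A : Set ℝ)
    (hA : MeasurableSet A) : m A = ∫⁻ s, brownianLaw s A ∂F := by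
  have hmeas : Measurable fun p : ℝ × ℝ => √(2 * p.1) * p.2 := by fun_prop
  have : IsProbabilityMeasure ((F.prod (gaussianReal 0 1)).map fun p => √(2 * p.1) * p.2) :=
    Measure.isProbabilityMeasure_map hmeas.aemeasurable
  have key : m = (F.prod (gaussianReal 0 1)).map fun p => √(2 * p.1) * p.2 := by
    refine Measure.ext_of_charFun (funext fun y => ?_)
    rw [h, charFun_apply_real, integral_map hmeas.aemeasurable (by fun_prop), integral_prod,
      ← integral_complex_ofReal]
    · refine integral_congr_ae ?_
      filter_upwards [hF] with s hs
      rw [← charFun_brownianLaw hs.le, brownianLaw_eq_map, charFun_apply_real,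
        integral_map (by fun_prop) (by fun_prop)]
    · refine Integrable.of_bound (C := 1) (by fun_prop) (Eventually.of_forall fun p => ?_)
      rw [← Complex.ofReal_mul, Complex.norm_exp_ofReal_mul_I]
  rw [key, Measure.map_apply hmeas hA, Measure.prod_apply (hA.preimage hmeas)]
  refine lintegral_congr fun s => ?_
  rw [brownianLaw_eq_map, Measure.map_apply (by fun_prop) hA]
  rfl

/-! ### Brownian motion at an independent random time -/

section

variable {Ω : Type*} [MeasurableSpace Ω] {P : Measure Ω} [IsProbabilityMeasure P]
  {B : ℝ≥0 → Ω → ℝ} {T : Ω → ℝ≥0}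

/-- The index of the grid point below `t`. -/
def gridIndex (n : ℕ) (t : ℝ≥0) : ℕ := ⌊(t : ℝ) * (n + 1 : ℕ)⌋₊

/-- The grid point below `t`. -/
def gridPoint (n k : ℕ) : ℝ≥0 := (k : ℝ≥0) / (n + 1 : ℕ)

theorem measurable_gridIndex (n : ℕ) : Measurable (gridIndex n) :=
  Nat.measurable_floor.comp (by fun_prop)

theorem tendsto_gridPoint (t : ℝ≥0) :
    Tendsto (fun n => gridPoint n (gridIndex n t)) atTop (𝓝 t) := by
  rw [← NNReal.tendsto_coe]
  have h := (tendsto_nat_floor_mul_div_atTop (R := ℝ) t.coe_nonneg).comp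
    (tendsto_natCast_atTop_atTop.comp (tendsto_add_atTop_nat 1))
  refine h.congr fun n => ?_
  simp [gridPoint, gridIndex]

/-- Rounding the time to a grid leaves countably many values, so evaluating the path at the random
time is measurable without joint measurability of `B`. Conditioning on `T` then gives a Gaussian
characteristic function. -/
theorem charFun_grid (hB : IsPreBrownianReal B P) (hT : Measurable T)
    (hind : IndepFun T (fun ω s => B s ω) P) (n : ℕ) :
    AEMeasurable (fun ω => B (gridPoint n (gridIndex n (T ω))) ω) P ∧ ∀ y : ℝ,
      ∫ ω, Complex.exp (y * B (gridPoint n (gridIndex n (T ω))) ω * Complex.I) ∂P =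
        ∫ ω, ((Real.exp (-(gridPoint n (gridIndex n (T ω)) * y ^ 2 / 2)) : ℝ) : ℂ) ∂P := by
  set X : Ω → ℕ → ℝ := fun ω k => B (gridPoint n k) ω with hX
  have hXm : AEMeasurable X P := aemeasurable_pi_iff.2 fun k => hB.aemeasurable _
  have hindX : IndepFun T X P := hind.comp (φ := id)
    (ψ := fun (b : ℝ≥0 → ℝ) (k : ℕ) => b (gridPoint n k)) measurable_id (by fun_prop)
  have hlaw := (indepFun_iff_map_prod_eq_prod_map_map hT.aemeasurable hXm).1 hindX
  set ev : ℝ≥0 × (ℕ → ℝ) → ℝ := fun p => p.2 (gridIndex n p.1) with hev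
  have hevm : Measurable ev := by
    have h1 : Measurable fun q : ℕ × (ℕ → ℝ) => q.2 q.1 :=
      measurable_from_prod_countable_right fun k => measurable_pi_apply k
    exact h1.comp (((measurable_gridIndex n).comp measurable_fst).prodMk measurable_snd)
  have hTX : AEMeasurable (fun ω => (T ω, X ω)) P := hT.aemeasurable.prodMk hXm
  refine ⟨hevm.comp_aemeasurable hTX, fun y => ?_⟩
  have : IsProbabilityMeasure (P.map T) := Measure.isProbabilityMeasure_map hT.aemeasurable
  have : IsProbabilityMeasure (P.map X) := Measure.isProbabilityMeasure_map hXm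
  have h1 : ∫ ω, Complex.exp (y * B (gridPoint n (gridIndex n (T ω))) ω * Complex.I) ∂P =
      ∫ p, Complex.exp (y * ev p * Complex.I) ∂(P.map fun ω => (T ω, X ω)) := by
    rw [integral_map hTX (by fun_prop)]
  rw [h1, hlaw, integral_prod]
  · rw [integral_map hT.aemeasurable]
    · refine integral_congr_ae (Eventually.of_forall fun ω => ?_)
      set k := gridIndex n (T ω) with hk
      have hl := (hB.hasLaw_eval (gridPoint n k))
      have h2 : ∫ b, Complex.exp (y * ev (T ω, b) * Complex.I) ∂(P.map X) =
          charFun (P.map (B (gridPoint n k))) y := by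
        have hev2 : Measurable fun b => ev (T ω, b) := hevm.comp measurable_prodMk_left
        have hc : Measurable fun x : ℝ => Complex.exp (y * x * Complex.I) := by fun_prop
        rw [charFun_apply_real, integral_map hl.aemeasurable (by fun_prop)]
        exact integral_map hXm (hc.comp hev2).aestronglyMeasurable
      simp only
      rw [h2, hl.map_eq, charFun_gaussianReal]
      push_cast
      congr 1; ring
    · refine AEStronglyMeasurable.integral_prod_right' (f := fun p : ℝ≥0 × (ℕ → ℝ) =>
        Complex.exp (y * ev p * Complex.I)) (by fun_prop)
  · refine Integrable.of_bound (C := 1) (by fun_prop) (Eventually.of_forall fun p => ?_)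
    rw [← Complex.ofReal_mul, Complex.norm_exp_ofReal_mul_I]

/-- Brownian motion at an independent random time. -/
theorem map_brownian_randomTime (hB : IsBrownianReal B P) (hT : Measurable T)
    (hind : IndepFun T (fun ω s => B s ω) P) {m : Measure ℝ} [IsProbabilityMeasure m]
    (h : ∀ y : ℝ, charFun m y =
      ((∫ s, Real.exp (-(s * y ^ 2)) ∂(P.map fun ω => (T ω : ℝ)) : ℝ) : ℂ)) :
    AEMeasurable (fun ω => √2 * B (T ω) ω) P ∧ P.map (fun ω => √2 * B (T ω) ω) = m := by
  have hB' := hB.toIsPreBrownianReal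
  -- Path continuity removes the grid; measurability of `B (T ω) ω` is inherited from this limit.
  have hlim : ∀ᵐ ω ∂P, Tendsto (fun n => B (gridPoint n (gridIndex n (T ω))) ω) atTop
      (𝓝 (B (T ω) ω)) := by
    filter_upwards [hB.cont] with ω hω
    exact (hω.tendsto (T ω)).comp (tendsto_gridPoint (T ω))
  have hm0 : AEMeasurable (fun ω => B (T ω) ω) P :=
    aemeasurable_of_tendsto_metrizable_ae atTop (fun n => (charFun_grid hB' hT hind n).1) hlim
  have hm : AEMeasurable (fun ω => √2 * B (T ω) ω) P := hm0.const_mul _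
  refine ⟨hm, ?_⟩
  have : IsProbabilityMeasure (P.map fun ω => √2 * B (T ω) ω) := Measure.isProbabilityMeasure_map hm
  refine Measure.ext_of_charFun (funext fun y => ?_)
  rw [h, charFun_apply_real, integral_map hm (by fun_prop),
    integral_map (by fun_prop) (by fun_prop), ← integral_complex_ofReal]
  -- The factor `√2`, which changes variance `s` into `2 s`, is absorbed into the frequency `y √2`.
  have hl1 : Tendsto (fun n => ∫ ω, Complex.exp (((y * √2 : ℝ) : ℂ) *
      B (gridPoint n (gridIndex n (T ω))) ω * Complex.I) ∂P) atTop
      (𝓝 (∫ ω, Complex.exp (y * ((√2 * B (T ω) ω : ℝ) : ℂ) * Complex.I) ∂P)) := by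
    refine tendsto_integral_of_dominated_convergence (fun _ => 1) (fun n => ?_)
      (integrable_const 1) (fun n => Eventually.of_forall fun ω => ?_) ?_
    · have := (charFun_grid hB' hT hind n).1
      exact ((by fun_prop : Measurable fun b : ℝ => Complex.exp (((y * √2 : ℝ) : ℂ) * b *
        Complex.I)).comp_aemeasurable this).aestronglyMeasurable
    · rw [← Complex.ofReal_mul, Complex.norm_exp_ofReal_mul_I]
    · filter_upwards [hlim] with ω hω
      have hc : Continuous fun b : ℝ => Complex.exp (((y * √2 : ℝ) : ℂ) * b * Complex.I) := by
        fun_prop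
      have e : Complex.exp (y * ((√2 * B (T ω) ω : ℝ) : ℂ) * Complex.I) =
          Complex.exp (((y * √2 : ℝ) : ℂ) * B (T ω) ω * Complex.I) := by
        congr 1; push_cast; ring
      rw [e]
      exact (hc.tendsto _).comp hω
  have hl2 : Tendsto (fun n => ∫ ω, ((Real.exp (-(gridPoint n (gridIndex n (T ω)) *
      (y * √2) ^ 2 / 2)) : ℝ) : ℂ) ∂P) atTop
      (𝓝 (∫ ω, ((Real.exp (-((T ω : ℝ) * y ^ 2)) : ℝ) : ℂ) ∂P)) := by
    refine tendsto_integral_of_dominated_convergence (fun _ => 1) (fun n => ?_)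
      (integrable_const 1) (fun n => Eventually.of_forall fun ω => ?_)
      (Eventually.of_forall fun ω => ?_)
    · have h1 : Measurable fun ω => gridPoint n (gridIndex n (T ω)) :=
        (measurable_from_top (f := gridPoint n)).comp ((measurable_gridIndex n).comp hT)
      exact (by fun_prop : Measurable fun ω => ((Real.exp (-(gridPoint n (gridIndex n (T ω)) *
        (y * √2) ^ 2 / 2)) : ℝ) : ℂ)).aestronglyMeasurable
    · rw [Complex.norm_real, Real.norm_of_nonneg (Real.exp_nonneg _), Real.exp_le_one_iff]
      have := (gridPoint n (gridIndex n (T ω))).coe_nonneg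
      have : 0 ≤ (gridPoint n (gridIndex n (T ω)) : ℝ) * (y * √2) ^ 2 / 2 := by positivity
      linarith
    · have hc : Continuous fun s : ℝ≥0 => ((Real.exp (-((s : ℝ) * (y * √2) ^ 2 / 2)) : ℝ) : ℂ) := by
        fun_prop
      have e : -((T ω : ℝ) * y ^ 2) = -((T ω : ℝ) * (y * √2) ^ 2 / 2) := by
        rw [mul_pow, Real.sq_sqrt (by norm_num)]; ring
      rw [e]
      exact (hc.tendsto (T ω)).comp (tendsto_gridPoint (T ω))
  refine tendsto_nhds_unique hl1 (hl2.congr fun n => ?_)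
  exact ((charFun_grid hB' hT hind n).2 (y * √2)).symm

end

/-! ### The two solutions and the relation between them -/

/-- The symmetrization of a probability measure. -/
def symm (τ : ProbabilityMeasure ℝ) : ProbabilityMeasure ℝ := ⟨symmetrize τ, inferInstance⟩

theorem toMeasure_dilate_symm {ν : ℝ} (τ : ProbabilityMeasure ℝ) (t : ℝ) :
    (dilate (2 * ν) (symm τ) t : Measure ℝ) =
      symmetrize ((τ : Measure ℝ).map fun u => t ^ ν * u) := by
  rw [toMeasure_dilate, symm, ProbabilityMeasure.coe_mk, map_mul_symmetrize,
    mul_div_cancel_left₀ _ two_ne_zero]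

section

variable {ν t : ℝ} {τ : ProbabilityMeasure ℝ}

theorem IsMittagLefflerLaw.isTheFundamentalSolution (hν0 : 0 < ν) (hν1 : ν ≤ 1)
    (h : IsMittagLefflerLaw ν τ) :
    IsTheFundamentalSolution (2 * ν) (dilate (2 * ν) (symm τ)) :=
  HasMittagLefflerCharFun.isTheFundamentalSolution (by positivity) (by linarith)
    (h.hasMittagLefflerCharFun hν0)

theorem IsMittagLefflerLaw.ae_pos_map (h : IsMittagLefflerLaw ν τ) (ht : 0 < t) :
    ∀ᵐ u ∂((τ : Measure ℝ).map fun u => t ^ ν * u), 0 < u := by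
  rw [ae_map_iff (by fun_prop) measurableSet_Ioi]
  filter_upwards [h.ae_pos] with u hu
  exact mul_pos (Real.rpow_pos_of_pos ht _) hu

theorem IsMittagLefflerLaw.fold_dilate (h : IsMittagLefflerLaw ν τ) (ht : 0 < t) :
    fold (dilate (2 * ν) (symm τ) t) = (τ : Measure ℝ).map fun u => t ^ ν * u := by
  rw [toMeasure_dilate_symm, fold_symmetrize (h.ae_pos_map ht)]

theorem vBar_eq (ν u t : ℝ) : vBar ν u t = 1 / t ^ ν * wrightM ν (u / t ^ ν) := rfl

theorem measurable_vBar (hν0 : 0 < ν) (hν1 : ν < 1) (t : ℝ) : Measurable fun u => vBar ν u t := by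
  simp only [vBar_eq]
  exact ((measurable_wrightM hν0 hν1).comp (by fun_prop)).const_mul _

theorem IsMittagLefflerLaw.map_eq_withDensity (hν0 : 0 < ν) (hν1 : ν < 1)
    (h : IsMittagLefflerLaw ν τ) (ht : 0 < t) :
    ((τ : Measure ℝ).map fun u => t ^ ν * u) =
      (volume.restrict (Ioi (0 : ℝ))).withDensity fun u => ENNReal.ofReal (vBar ν u t) := by
  rw [(h.eq_withDensity hν0 hν1).2,
    map_mul_withDensity (measurable_wrightM hν0 hν1) (Real.rpow_pos_of_pos ht ν)]
  rfl

theorem IsMittagLefflerLaw.dilate_eq_withDensity (hν0 : 0 < ν) (hν1 : ν < 1)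
    (h : IsMittagLefflerLaw ν τ) (ht : 0 < t) :
    (dilate (2 * ν) (symm τ) t : Measure ℝ) =
      volume.withDensity fun u => ENNReal.ofReal (vBar ν |u| t / 2) := by
  rw [toMeasure_dilate_symm, h.map_eq_withDensity hν0 hν1 ht,
    symmetrize_withDensity (measurable_vBar hν0 hν1 t)]

theorem IsMittagLefflerLaw.vBar_nonneg (hν0 : 0 < ν) (hν1 : ν < 1)
    (h : IsMittagLefflerLaw ν τ) (ht : 0 < t) {u : ℝ} (hu : 0 ≤ u) : 0 ≤ vBar ν u t := by
  rw [vBar_eq]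
  exact mul_nonneg (by positivity) ((h.eq_withDensity hν0 hν1).1 _ (by positivity))

theorem tendsto_vBar (hν0 : 0 < ν) (hν1 : ν < 1) (ht : 0 < t) :
    Tendsto (fun u : ℝ => vBar ν |u| t / 2) (cocompact ℝ) (𝓝 0) := by
  obtain ⟨C, hC⟩ := exists_abs_wrightM_le hν0 hν1
  have htν : 0 < t ^ ν := Real.rpow_pos_of_pos ht ν
  have h1 : Tendsto (wrightM ν) atTop (𝓝 0) := by
    refine squeeze_zero_norm' ?_ (tendsto_const_nhds (x := C).div_atTop tendsto_id)
    filter_upwards [eventually_gt_atTop 0] with u hu using hC u hu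
  have h2 : Tendsto (fun u : ℝ => |u| / t ^ ν) (cocompact ℝ) atTop :=
    (tendsto_norm_cocompact_atTop (E := ℝ)).atTop_div_const htν
  simpa [vBar_eq] using ((h1.comp h2).const_mul (1 / t ^ ν)).div_const 2

/-- The subordination identity: symmetrizing the law of index `ν/2` gives a Mittag-Leffler series of
order `2 (ν/2) = ν`, so both sides are `E_ν(-t^ν y²)`. -/
theorem charFun_dilate_eq_laplace {τ' : ProbabilityMeasure ℝ} (hν0 : 0 < ν)
    (h : IsMittagLefflerLaw (ν / 2) τ) (h' : IsMittagLefflerLaw ν τ') (ht : 0 < t) (y : ℝ) :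
    charFun (dilate (2 * (ν / 2)) (symm τ) t : Measure ℝ) y =
      ((∫ s, Real.exp (-(s * y ^ 2)) ∂((τ' : Measure ℝ).map fun u => t ^ ν * u) : ℝ) : ℂ) := by
  have h1 := h.hasMittagLefflerCharFun (by positivity) (t ^ (ν / 2) * y)
  have h2 := h'.hasSum_laplace hν0 (s := t ^ ν * y ^ 2) (by positivity)
  have e1 : charFun (dilate (2 * (ν / 2)) (symm τ) t : Measure ℝ) y =
      charFun (symmetrize τ) (t ^ (ν / 2) * y) := by
    rw [toMeasure_dilate, mul_div_cancel_left₀ _ two_ne_zero, charFun_map_mul]; rfl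
  have e2 : ∫ s, Real.exp (-(s * y ^ 2)) ∂((τ' : Measure ℝ).map fun u => t ^ ν * u) =
      ∫ u, Real.exp (-(t ^ ν * y ^ 2 * u)) ∂(τ' : Measure ℝ) := by
    rw [integral_map (by fun_prop) (by fun_prop)]
    congr 1; ext u; congr 1; ring
  rw [e1, e2]
  refine h1.unique ((Complex.hasSum_ofReal.2 h2).congr_fun fun n => ?_)
  have e3 : (t ^ (ν / 2) * y) ^ 2 = t ^ ν * y ^ 2 := by
    rw [mul_pow, ← Real.rpow_natCast, ← Real.rpow_mul ht.le]; congr 2; push_cast; ring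
  rw [e3, mul_div_cancel₀ _ two_ne_zero]

end

end FracDiff

end

theorem corollary4p1 (α : ℝ) (hα0 : 0 < α) (hα1 : α ≤ 1) :
    ∃ U V : ℝ → ProbabilityMeasure ℝ,
      -- `U` is the solution of the problem of order `α`, `V` that of the problem of order `2 α`
      FracDiff.IsTheFundamentalSolution α U ∧
      FracDiff.IsTheFundamentalSolution (2 * α) V ∧
      ∀ t : ℝ, 0 < t →
        -- the folded solution is a probability law on `[0, ∞)`, the law of the random time
        IsProbabilityMeasure (FracDiff.fold (V t)) ∧
        -- `U t` is the transition function of Brownian motion, taken at that random time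
        (∀ A : Set ℝ, MeasurableSet A →
          (U t : Measure ℝ) A = ∫⁻ s, FracDiff.brownianLaw s A ∂(FracDiff.fold (V t))) ∧
        (∀ (Ω : Type*) [MeasurableSpace Ω] (P : Measure Ω) [IsProbabilityMeasure P]
            (B : ℝ≥0 → Ω → ℝ) (T : Ω → ℝ≥0),
          IsBrownianReal B P → Measurable T → IndepFun T (fun ω s => B s ω) P →
          P.map (fun ω => (T ω : ℝ)) = FracDiff.fold (V t) →
          AEMeasurable (fun ω => √2 * B (T ω) ω) P ∧
            P.map (fun ω => √2 * B (T ω) ω) = (U t : Measure ℝ)) ∧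
        -- the law of the random time, for `α < 1` and for `α = 1`
        (α < 1 →
          (∀ u : ℝ, 0 ≤ u → 0 ≤ FracDiff.vBar α u t) ∧
          (V t : Measure ℝ) =
            volume.withDensity (fun u => ENNReal.ofReal (FracDiff.vBar α |u| t / 2)) ∧
          Tendsto (fun u : ℝ => FracDiff.vBar α |u| t / 2) (cocompact ℝ) (𝓝 0) ∧
          FracDiff.fold (V t) = (volume.restrict (Ici (0 : ℝ))).withDensity
            (fun u => ENNReal.ofReal (FracDiff.vBar α u t))) ∧
        (α = 1 → FracDiff.fold (V t) = Measure.dirac t) ∧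
        -- the explicit formula for the solution
        (∀ x : ℝ, 0 ≤ FracDiff.uDensity α x t) ∧
        (U t : Measure ℝ) =
          volume.withDensity (fun x => ENNReal.ofReal (FracDiff.uDensity α x t)) := by
  -- Symmetrization doubles the index, so index `α/2` serves the problem of order `α`, and index `α`
  -- that of order `2α`.
  obtain ⟨τ₁, h₁, -⟩ := FracDiff.exists_isMittagLefflerLaw (half_pos hα0) (by linarith : α / 2 ≤ 1)
  obtain ⟨τ₂, h₂, hone⟩ := FracDiff.exists_isMittagLefflerLaw hα0 hα1
  have hU := h₁.isTheFundamentalSolution (half_pos hα0) (by linarith)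
  have hV := h₂.isTheFundamentalSolution hα0 hα1
  refine ⟨FracDiff.dilate (2 * (α / 2)) (FracDiff.symm τ₁), FracDiff.dilate (2 * α) (FracDiff.symm τ₂),
    by rwa [mul_div_cancel₀ α two_ne_zero] at hU ⊢, hV, fun t ht => ?_⟩
  have hfold := h₂.fold_dilate ht
  have hchar := FracDiff.charFun_dilate_eq_laplace hα0 h₁ h₂ ht
  have hα2 : α / 2 < 1 := by linarith
  -- The density of `U t` is that of `V t` with `α` replaced by `α/2`; since `α/2 < 1`, it is
  -- available even for `α = 1`.
  have hu : ∀ x, FracDiff.uDensity α x t = FracDiff.vBar (α / 2) |x| t / 2 := fun x => by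
    rw [FracDiff.uDensity, FracDiff.vBar]; field_simp
  have hprob : IsProbabilityMeasure ((τ₂ : Measure ℝ).map fun u => t ^ α * u) :=
    Measure.isProbabilityMeasure_map (by fun_prop)
  rw [hfold]
  refine ⟨hprob, FracDiff.eq_lintegral_brownianLaw (h₂.ae_pos_map ht) hchar, ?_, fun hlt => ?_,
    fun h1 => ?_, fun x => ?_, ?_⟩
  · intro Ω _ P _ B T hB hT hind hmap
    exact FracDiff.map_brownian_randomTime hB hT hind fun y => by rw [hmap, hchar]
  · refine ⟨fun u hu => h₂.vBar_nonneg hα0 hlt ht hu, h₂.dilate_eq_withDensity hα0 hlt ht,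
      FracDiff.tendsto_vBar hα0 hlt ht, ?_⟩
    rw [h₂.map_eq_withDensity hα0 hlt ht, Measure.restrict_congr_set Ioi_ae_eq_Ici]
  · rw [hone h1, h1, Measure.map_dirac' (by fun_prop : Measurable fun u : ℝ => t ^ (1 : ℝ) * u)]
    simp
  · rw [hu]
    exact div_nonneg (h₁.vBar_nonneg (half_pos hα0) hα2 ht (abs_nonneg x)) (by norm_num)
  · simp only [hu]
    exact h₁.dilate_eq_withDensity (half_pos hα0) hα2 ht
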